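/- Let $d\ge 1$, let $V\in L^\infty(\mathbb R^d)$ be complex valued and compactly supported, and let $\phi\in C^\infty_{\rm comp}(\mathbb R)$ be complex valued and even. With $|D|=(-\Delta)^{1/2}$, let $U_0(t)$ be the free wave group on the complex Hilbert space $H^1\times L^2(\mathbb R^d)$, where $\|f\|_{H^1}^2=\|f\|_{L^2}^2+\|\nabla f\|_{L^2}^2$, $$ U_0(t)=\begin{bmatrix}\cos(t|D|)&\dfrac{\sin(t|D|)}{|D|}\\[2mm] -|D|\sin(t|D|)&\cos(t|D|)\end{bmatrix},\qquad \mathbf V=\begin{bmatrix}0&0\\V&0\end{bmatrix}, $$ and let the first Duhamel term be $$ W_{1,V}(t)=\int_0^t U_0(t-s)\,\mathbf V\,U_0(s)\,ds,\qquad \langle\phi,W_{1,V}\rangle=\int_{\mathbb R}\phi(t)\,W_{1,V}(t)\,dt , $$ the integrals being strongly convergent. Then $\langle\phi,W_{1,V}\rangle$ is a bounded trace class operator on $H^1\times L^2(\mathbb R^d)$, and $$ \operatorname{tr}\langle\phi,W_{1,V}\rangle=\tfrac12\,\nu_d(\phi)\int_{\mathbb R^d}V(x)\,dx , $$ where, with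 $D=-i\partial_t$ on $\mathbb R$ (so that $|D|^{k}$ has Fourier symbol $|\tau|^{k}$) and $c_d=2^{3-d}\pi^{1-\frac d2}/\Gamma(\frac d2-1)$, $$ \nu_d(\phi)=\begin{cases} 2\int_0^\infty t\,\phi(t)\,dt,& d=1,\\ 2\pi^{-1}\int_0^\infty\phi(t)\,dt,& d=2,\\ c_d\,(D^{d-3}\phi)(0),& d\ge 3\text{ odd},\\ c_d\,(|D|^{d-3}\phi)(0),& d\ge 4\text{ even}. \end{cases} $$ Moreover, for $d>1$, $$ \nu_d(\phi)=\begin{cases} 2(-2\pi)^{\frac{1-d}2}\int_0^\infty \partial_t(t^{-1}\partial_t)^{\frac{d-3}2}\phi(t)\,dt,& d\ge 3\text{ odd},\\ -4(-2\pi)^{-\frac d2}\int_0^\infty (t^{-1}\partial_t)^{\frac{d-2}2}\phi(t)\,dt,& d\ge 2\text{ even}. \end{cases} $$ -/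

import Mathlib

open MeasureTheory Set
open scoped ENNReal FourierTransform

noncomputable section

namespace WaveTrace

/-- Euclidean space `ℝ^d`. -/
abbrev Space (d : ℕ) : Type := EuclideanSpace ℝ (Fin d)

/-- The complex Hilbert space `L²(ℝ^d)`. -/
abbrev L2 (d : ℕ) : Type := Lp ℂ 2 (volume : Measure (Space d))

/-! ### Multiplication operators and Fourier multipliers on `L²` -/

/-- Multiplication by a function `m ∈ L^∞(ℝ^d)`, as a bounded operator on `L²(ℝ^d)`. -/
def mulOp {d : ℕ} (m : Space d → ℂ) (hm : MemLp m ∞ volume) : L2 d →L[ℂ] L2 d :=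
  (ContinuousLinearMap.mul ℂ ℂ).holderL volume ∞ 2 2 (hm.toLp m)

theorem mulOp_ae {d : ℕ} (m : Space d → ℂ) (hm : MemLp m ∞ volume) (f : L2 d) :
    mulOp m hm f =ᵐ[volume] fun x => m x * f x := by
  have h := (ContinuousLinearMap.mul ℂ ℂ).coeFn_holder (r := 2) (hm.toLp m) f
  filter_upwards [h, hm.coeFn_toLp] with x hx hx'
  change ((ContinuousLinearMap.mul ℂ ℂ).holder 2 (hm.toLp m) f : Space d → ℂ) x = _
  simpa [hx'] using hx

/-- The unitary Fourier transform of `L²(ℝ^d)`, normalised as `∫ exp (-2πi⟨x,ξ⟩) f x dx`. -/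
def fourierL2 (d : ℕ) : L2 d ≃ₗᵢ[ℂ] L2 d := Lp.fourierTransformₗᵢ (Space d) ℂ

/-- The Fourier multiplier with symbol `m ∈ L^∞(ℝ^d)`, as a bounded operator on `L²(ℝ^d)`. -/
def multiplier {d : ℕ} (m : Space d → ℂ) (hm : MemLp m ∞ volume) : L2 d →L[ℂ] L2 d :=
  (fourierL2 d).symm.toContinuousLinearEquiv.toContinuousLinearMap ∘L
    (mulOp m hm ∘L (fourierL2 d).toContinuousLinearEquiv.toContinuousLinearMap)

theorem fourier_multiplier_ae {d : ℕ} (m : Space d → ℂ) (hm : MemLp m ∞ volume) (f : L2 d) :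
    fourierL2 d (multiplier m hm f) =ᵐ[volume] fun ξ => m ξ * fourierL2 d f ξ := by
  have h : fourierL2 d (multiplier m hm f) = mulOp m hm (fourierL2 d f) := by
    simp [multiplier]
  rw [h]
  exact mulOp_ae m hm _

/-- The symbol of `|D| = (-Δ)^{1/2}` for the above normalisation of the Fourier transform. -/
def absSymbol {d : ℕ} (ξ : Space d) : ℝ := 2 * Real.pi * ‖ξ‖

theorem continuous_absSymbol {d : ℕ} : Continuous (absSymbol (d := d)) := by
  unfold absSymbol; fun_prop

/-- The symbol of `cos (t|D|)`. -/
def cosSymbol {d : ℕ} (t : ℝ) (ξ : Space d) : ℂ := (Real.cos (t * absSymbol ξ) : ℝ)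

/-- The symbol of `sin (t|D|)`. -/
def sinSymbol {d : ℕ} (t : ℝ) (ξ : Space d) : ℂ := (Real.sin (t * absSymbol ξ) : ℝ)

/-- The symbol of `sin (t|D|) / |D|`, with its continuous extension to `ξ = 0`. -/
def sincSymbol {d : ℕ} (t : ℝ) (ξ : Space d) : ℂ := (t * Real.sinc (t * absSymbol ξ) : ℝ)

theorem absSymbol_mul_sincSymbol {d : ℕ} (t : ℝ) (ξ : Space d) :
    (absSymbol ξ : ℂ) * sincSymbol t ξ = sinSymbol t ξ := by
  unfold sincSymbol sinSymbol
  by_cases h : t * absSymbol ξ = 0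
  · rcases mul_eq_zero.1 h with h' | h' <;> simp [h']
  · rw [Real.sinc_of_ne_zero h, ← Complex.ofReal_mul]
    congr 1
    have h1 : t ≠ 0 := left_ne_zero_of_mul h
    have h2 : absSymbol ξ ≠ 0 := right_ne_zero_of_mul h
    field_simp

theorem memLp_cosSymbol (d : ℕ) (t : ℝ) : MemLp (cosSymbol (d := d) t) ∞ volume := by
  have h := continuous_absSymbol (d := d)
  refine memLp_top_of_bound (C := 1) ?_ (.of_forall fun ξ => ?_)
  · exact Continuous.aestronglyMeasurable (by unfold cosSymbol; fun_prop)
  · rw [cosSymbol, Complex.norm_real]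
    exact Real.abs_cos_le_one _

theorem memLp_sinSymbol (d : ℕ) (t : ℝ) : MemLp (sinSymbol (d := d) t) ∞ volume := by
  have h := continuous_absSymbol (d := d)
  refine memLp_top_of_bound (C := 1) ?_ (.of_forall fun ξ => ?_)
  · exact Continuous.aestronglyMeasurable (by unfold sinSymbol; fun_prop)
  · rw [sinSymbol, Complex.norm_real]
    exact Real.abs_sin_le_one _

theorem memLp_sincSymbol (d : ℕ) (t : ℝ) : MemLp (sincSymbol (d := d) t) ∞ volume := by
  have h := continuous_absSymbol (d := d)
  have hs := Real.continuous_sinc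
  refine memLp_top_of_bound (C := |t|) ?_ (.of_forall fun ξ => ?_)
  · exact Continuous.aestronglyMeasurable (by unfold sincSymbol; fun_prop)
  · rw [sincSymbol, Complex.norm_real, Real.norm_eq_abs, abs_mul]
    exact mul_le_of_le_one_right (abs_nonneg t) (Real.abs_sinc_le_one _)

/-- `cos (t|D|)` on `L²(ℝ^d)`. -/
def cosOp (d : ℕ) (t : ℝ) : L2 d →L[ℂ] L2 d := multiplier _ (memLp_cosSymbol d t)

/-- `sin (t|D|)` on `L²(ℝ^d)`. -/
def sinOp (d : ℕ) (t : ℝ) : L2 d →L[ℂ] L2 d := multiplier _ (memLp_sinSymbol d t)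

/-- `sin (t|D|) / |D|` on `L²(ℝ^d)`. -/
def sincOp (d : ℕ) (t : ℝ) : L2 d →L[ℂ] L2 d := multiplier _ (memLp_sincSymbol d t)

/-! ### The energy space `H¹ × L²` -/

/-- `g = |D| f` for `f, g ∈ L²(ℝ^d)`. -/
def IsAbsD {d : ℕ} (f g : L2 d) : Prop :=
  ∀ᵐ ξ ∂(volume : Measure (Space d)), fourierL2 d g ξ = (absSymbol ξ : ℂ) * fourierL2 d f ξ

/-- The Sobolev space `H¹(ℝ^d) = {f ∈ L² : |D| f ∈ L²}`. An element is recorded as the pair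
`(f, |D| f)`, whose second entry is determined by `f`; the inner product inherited from `L² × L²` is
`⟪f, g⟫ + ⟪|D| f, |D| g⟫`, so that the norm is `(‖f‖² + ‖∇ f‖²)^{1/2}`, the `L²` norm of `⟨D⟩ f`. -/
def H1 (d : ℕ) : Submodule ℂ (WithLp 2 (L2 d × L2 d)) where
  carrier := {u | IsAbsD u.fst u.snd}
  zero_mem' := by
    have h0 := Lp.coeFn_zero ℂ 2 (volume : Measure (Space d))
    simp only [mem_ofPred_eq, IsAbsD, WithLp.zero_fst, WithLp.zero_snd, map_zero]
    filter_upwards [h0] with ξ h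
    rw [h]
    simp
  add_mem' := by
    intro u v hu hv
    simp only [mem_ofPred_eq, IsAbsD, WithLp.add_fst, WithLp.add_snd, map_add] at hu hv ⊢
    filter_upwards [hu, hv, Lp.coeFn_add (fourierL2 d u.fst) (fourierL2 d v.fst),
      Lp.coeFn_add (fourierL2 d u.snd) (fourierL2 d v.snd)] with ξ h1 h2 h3 h4
    rw [h3, h4, Pi.add_apply, Pi.add_apply, h1, h2]
    ring
  smul_mem' := by
    intro c u hu
    simp only [mem_ofPred_eq, IsAbsD, WithLp.smul_fst, WithLp.smul_snd, map_smul] at hu ⊢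
    filter_upwards [hu, Lp.coeFn_smul c (fourierL2 d u.fst),
      Lp.coeFn_smul c (fourierL2 d u.snd)] with ξ h1 h2 h3
    rw [h2, h3, Pi.smul_apply, Pi.smul_apply, h1, smul_eq_mul, smul_eq_mul]
    ring

theorem isClosed_H1 (d : ℕ) : IsClosed (H1 d : Set (WithLp 2 (L2 d × L2 d))) := by
  have hc := continuous_absSymbol (d := d)
  have hpos : ∀ ξ : Space d, 0 ≤ absSymbol ξ := fun ξ => by unfold absSymbol; positivity
  have hne : ∀ ξ : Space d, 1 + absSymbol ξ ≠ 0 := fun ξ => by have := hpos ξ; positivity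
  have ha : MemLp (fun ξ : Space d => (((1 + absSymbol ξ)⁻¹ : ℝ) : ℂ)) ∞ volume := by
    refine memLp_top_of_bound (C := 1) ?_ (.of_forall fun ξ => ?_)
    · exact Continuous.aestronglyMeasurable
        (Complex.continuous_ofReal.comp ((continuous_const.add hc).inv₀ hne))
    · rw [Complex.norm_real, Real.norm_eq_abs, abs_of_nonneg (by have := hpos ξ; positivity)]
      exact inv_le_one_of_one_le₀ (by linarith [hpos ξ])
  have hb : MemLp (fun ξ : Space d => ((absSymbol ξ * (1 + absSymbol ξ)⁻¹ : ℝ) : ℂ)) ∞ volume := by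
    refine memLp_top_of_bound (C := 1) ?_ (.of_forall fun ξ => ?_)
    · exact Continuous.aestronglyMeasurable
        (Complex.continuous_ofReal.comp (hc.mul ((continuous_const.add hc).inv₀ hne)))
    · have := hpos ξ
      rw [Complex.norm_real, Real.norm_eq_abs, abs_of_nonneg (by positivity), ← div_eq_mul_inv]
      exact div_le_one_of_le₀ (by linarith) (by positivity)
  have key : (H1 d : Set (WithLp 2 (L2 d × L2 d))) =
      {u | mulOp _ ha (fourierL2 d u.snd) = mulOp _ hb (fourierL2 d u.fst)} := by
    ext u
    change IsAbsD u.fst u.snd ↔ mulOp _ ha (fourierL2 d u.snd) = mulOp _ hb (fourierL2 d u.fst)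
    rw [Lp.ext_iff]
    have e1 := mulOp_ae _ ha (fourierL2 d u.snd)
    have e2 := mulOp_ae _ hb (fourierL2 d u.fst)
    constructor
    · intro h
      filter_upwards [h, e1, e2] with ξ h h1 h2
      rw [h1, h2, h]
      push_cast
      ring
    · intro h
      filter_upwards [h, e1, e2] with ξ h h1 h2
      rw [h1, h2] at h
      have hn : (1 + (absSymbol ξ : ℂ)) ≠ 0 := by exact_mod_cast hne ξ
      push_cast at h
      field_simp at h
      exact h
  rw [key]
  refine isClosed_eq ?_ ?_
  · exact (mulOp _ ha).continuous.comp
      ((fourierL2 d).continuous.comp (WithLp.sndL 2 ℂ (L2 d) (L2 d)).continuous)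
  · exact (mulOp _ hb).continuous.comp
      ((fourierL2 d).continuous.comp (WithLp.fstL 2 ℂ (L2 d) (L2 d)).continuous)

instance instCompleteSpaceH1 (d : ℕ) : CompleteSpace (H1 d) :=
  (isClosed_H1 d).completeSpace_coe

/-- The inclusion `H¹(ℝ^d) → L²(ℝ^d)`. -/
def H1.toL2 (d : ℕ) : H1 d →L[ℂ] L2 d := WithLp.fstL 2 ℂ (L2 d) (L2 d) ∘L (H1 d).subtypeL

/-- The operator `|D| : H¹(ℝ^d) → L²(ℝ^d)`. -/
def H1.absD (d : ℕ) : H1 d →L[ℂ] L2 d := WithLp.sndL 2 ℂ (L2 d) (L2 d) ∘L (H1 d).subtypeL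

/-- The Hilbert space `H¹(ℝ^d) × L²(ℝ^d)`. -/
abbrev Energy (d : ℕ) : Type := WithLp 2 (H1 d × L2 d)

/-- The operator `x ↦ (A x, B x)` into a Hilbert space product. -/
def pairOp {G E F : Type*} [NormedAddCommGroup G] [NormedSpace ℂ G] [NormedAddCommGroup E]
    [NormedSpace ℂ E] [NormedAddCommGroup F] [NormedSpace ℂ F] (A : G →L[ℂ] E) (B : G →L[ℂ] F) :
    G →L[ℂ] WithLp 2 (E × F) :=
  (WithLp.prodContinuousLinearEquiv 2 ℂ E F).symm.toContinuousLinearMap ∘L (A.prod B)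

/-! ### The free wave group and the first Duhamel term -/

/-- `cos (t|D|)` on `H¹(ℝ^d)`. -/
def cosH1 (d : ℕ) (t : ℝ) : H1 d →L[ℂ] H1 d :=
  (pairOp (cosOp d t ∘L H1.toL2 d) (cosOp d t ∘L H1.absD d)).codRestrict (H1 d) (by
    intro u
    change IsAbsD (cosOp d t (H1.toL2 d u)) (cosOp d t (H1.absD d u))
    have hu : IsAbsD (H1.toL2 d u) (H1.absD d u) := u.2
    filter_upwards [hu, fourier_multiplier_ae _ (memLp_cosSymbol d t) (H1.toL2 d u),
      fourier_multiplier_ae _ (memLp_cosSymbol d t) (H1.absD d u)] with ξ h1 h2 h3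
    simp only [cosOp]
    rw [h2, h3, h1]
    ring)

/-- `sin (t|D|) / |D|` from `L²(ℝ^d)` to `H¹(ℝ^d)`. -/
def sincH1 (d : ℕ) (t : ℝ) : L2 d →L[ℂ] H1 d :=
  (pairOp (sincOp d t) (sinOp d t)).codRestrict (H1 d) (by
    intro f
    change IsAbsD (sincOp d t f) (sinOp d t f)
    filter_upwards [fourier_multiplier_ae _ (memLp_sincSymbol d t) f,
      fourier_multiplier_ae _ (memLp_sinSymbol d t) f] with ξ h2 h3
    simp only [sincOp, sinOp]
    rw [h2, h3, ← absSymbol_mul_sincSymbol]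
    ring)

/-- The free wave group on `H¹ × L²`,
`U₀(t) (f, g) = (cos (t|D|) f + |D|⁻¹ sin (t|D|) g, -sin (t|D|) |D| f + cos (t|D|) g)`. -/
def freeGroup (d : ℕ) (t : ℝ) : Energy d →L[ℂ] Energy d :=
  pairOp
    (cosH1 d t ∘L WithLp.fstL 2 ℂ (H1 d) (L2 d) + sincH1 d t ∘L WithLp.sndL 2 ℂ (H1 d) (L2 d))
    (-(sinOp d t ∘L H1.absD d ∘L WithLp.fstL 2 ℂ (H1 d) (L2 d)) +
      cosOp d t ∘L WithLp.sndL 2 ℂ (H1 d) (L2 d))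

/-- The operator `(f, g) ↦ (0, V f)` on `H¹ × L²`. -/
def potentialOp {d : ℕ} (V : Space d → ℂ) (hV : MemLp V ∞ volume) : Energy d →L[ℂ] Energy d :=
  pairOp 0 (mulOp V hV ∘L H1.toL2 d ∘L WithLp.fstL 2 ℂ (H1 d) (L2 d))

/-- The integrand `U₀(t - s) 𝐕 U₀(s) F` of the first Duhamel term. -/
def duhamelIntegrand {d : ℕ} (V : Space d → ℂ) (hV : MemLp V ∞ volume) (t s : ℝ) (F : Energy d) :
    Energy d :=
  freeGroup d (t - s) (potentialOp V hV (freeGroup d s F))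

/-- The first Duhamel term `W₁(t) F = ∫₀ᵗ U₀(t - s) 𝐕 U₀(s) F ds`. -/
def W1 {d : ℕ} (V : Space d → ℂ) (hV : MemLp V ∞ volume) (t : ℝ) (F : Energy d) : Energy d :=
  ∫ s in (0 : ℝ)..t, duhamelIntegrand V hV t s F

/-- The bounded operator `T` is `⟨φ, W₁⟩ = ∫ φ(t) W₁(t) dt`, all integrals being convergent. -/
def IsPairingW1 {d : ℕ} (V : Space d → ℂ) (hV : MemLp V ∞ volume) (φ : ℝ → ℂ)
    (T : Energy d →L[ℂ] Energy d) : Prop :=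
  ∀ F : Energy d,
    (∀ t, IntervalIntegrable (fun s => duhamelIntegrand V hV t s F) volume 0 t) ∧
    Integrable (fun t => φ t • W1 V hV t F) ∧
    T F = ∫ t, φ t • W1 V hV t F

/-! ### Trace class operators -/

section TraceClass

variable {H : Type} [NormedAddCommGroup H] [InnerProductSpace ℂ H]

/-- `T` is trace class (equivalently nuclear, as `H` is a Hilbert space): it is a sum
`∑ ⟪xₙ, ·⟫ yₙ` with `∑ ‖xₙ‖ ‖yₙ‖ < ∞`. -/
def IsTraceClass (T : H →L[ℂ] H) : Prop :=
  ∃ x y : ℕ → H, (Summable fun n => ‖x n‖ * ‖y n‖) ∧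
    ∀ z, HasSum (fun n => inner ℂ (x n) z • y n) (T z)

/-- `T` is trace class with trace `c`: the diagonal sum converges unconditionally to `c` in every
Hilbert basis. -/
def HasTrace (T : H →L[ℂ] H) (c : ℂ) : Prop :=
  IsTraceClass T ∧
    ∀ (ι : Type) (b : HilbertBasis ι ℂ H), HasSum (fun i => inner ℂ (b i) (T (b i))) c

end TraceClass

/-! ### The distribution `ν_d` -/

/-- `D^k φ(0)` with `D = -i ∂_t`. -/
def powD (k : ℕ) (φ : ℝ → ℂ) : ℂ := (-Complex.I) ^ k * iteratedDeriv k φ 0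

/-- `|D|^k φ(0)`, where `|D|^k` is the Fourier multiplier with symbol `|τ|^k` in the angular
frequency `τ = 2πξ`. -/
def powAbsD (k : ℕ) (φ : ℝ → ℂ) : ℂ :=
  𝓕⁻ (fun ξ : ℝ => (((2 * Real.pi * |ξ|) ^ k : ℝ) : ℂ) * 𝓕 φ ξ) 0

/-- `c_d = 2^{3-d} π^{1-d/2} / Γ(d/2 - 1)`. -/
def cConst (d : ℕ) : ℝ :=
  (2 : ℝ) ^ (3 - (d : ℝ)) * Real.pi ^ (1 - (d : ℝ) / 2) / Real.Gamma ((d : ℝ) / 2 - 1)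

/-- `ν_d(φ)`, for `d ≥ 1`. -/
def nu (d : ℕ) (φ : ℝ → ℂ) : ℂ :=
  if d = 1 then 2 * ∫ t in Ioi (0 : ℝ), (t : ℂ) * φ t
  else if d = 2 then 2 * (Real.pi : ℂ)⁻¹ * ∫ t in Ioi (0 : ℝ), φ t
  else if Odd d then (cConst d : ℂ) * powD (d - 3) φ
  else (cConst d : ℂ) * powAbsD (d - 3) φ

/-- The operator `t⁻¹ ∂_t`. -/
def invTD (φ : ℝ → ℂ) : ℝ → ℂ := fun t => (t : ℂ)⁻¹ * deriv φ t

end WaveTrace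

end

/-!
The matrix element `⟪u, U₀(t - s) 𝐕 U₀(s) z⟫` is a sum of four terms. As `φ` is even, only the two
that change sign under `(t, s) ↦ (-t, -s)` survive integration against `φ`: the one acting between
positions and the one acting between velocities (`inner_pairingW1`). In the coordinates
`(u, s) = (t - s, s)` on the triangle `0 < s < t` (`integral_triangle`) they become the integral
over `u, s > 0` of `φ(u + s)` times `(1 + |D|²) |D|⁻¹ sin (u|D|) V cos (s|D|)`, respectively
`cos (u|D|) V |D|⁻¹ sin (s|D|)`; the factor `1 + |D|²` comes from the inner product of `H¹`.

Before integration no symbol decays fast enough for these operators to be trace class. Integration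
by parts in the variable of the sine gives boundary terms only at the end `0`, so that
`∫ φ(u + s) |D|⁻¹ sin (u|D|) du` is a polynomial in `(1 + |D|²)⁻¹` with coefficients
`(1 - ∂²)ʲ φ(s)`, up to a remainder `O((1 + |D|²)⁻ᴺ)` (`tailSymbol_eq`). In the polynomial part the
remaining integration over the other variable produces the cosine transform of an even test
function, which decays rapidly (`cosTransform_eq`). Hence `⟨φ, W₁⟩` is a finite sum of
superpositions of operators `A† m(D) V l(D) A`, with `A` one of the projections of `H¹ × L²` to
`L²`, in which one of `m`, `l` is bounded and the other one is `O((1 + ‖ξ‖)^{-(d + 1)})`.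

Such an operator is trace class. Write `V = v₁ v̄₂` with `v₂` a smooth cutoff (or the other way
round). By Plancherel, multiplication by `V` is the integral over `κ` of the rank one operators
`|e_κ v₁⟩⟨e_κ v₂|`, where `e_κ` is the character of frequency `κ` (`inner_mulOp_eq_integral`); after
insertion of the symbols the integrand is absolutely integrable, since a decaying symbol makes
modulations of a Schwartz function small at high frequency (`norm_multiplier_modOp_le`). An
absolutely convergent integral of rank one operators is nuclear, with the integral of the traces as
its trace (`hasFormTrace_integral`). With `α(D) = A A†`, the trace is `∫ V` times `∫ α m l`
(`hasFormTrace_of_decay`). The powers of `1 + |D|²` recombine, and the position and the velocity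
parts contribute the same amount, which gives `tr ⟨φ, W₁⟩ = 4 ∫ V ∫ p(ξ) dξ`, where
`p(ξ) = ∫∫ φ(u + s) |D|⁻¹ sin (u|D|) cos (s|D|) du ds = ½ ∫ t φ(t) |D|⁻¹ sin (t|D|) dt`
(`hasTrace_pairingW1`, `phaseSymbol_eq`).

It remains to show `ν_d(φ) = 8 ∫ p` (`nu_eq_integral_phaseSymbol`). The function `p` is radial with
profile `q`, and `(𝓕 φ)'(r) = -16 π² r q(r)` (`hasDerivAt_fourier_phaseProfile`). For `d ≥ 2`, in
polar coordinates, an integration by parts turns `∫ r^{d-1} q` into the half-line moment of order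
`d - 3` of `𝓕 φ` (for `d = 2` into `𝓕 φ(0)`), which is `ν_d(φ)` up to its constant because `𝓕 φ` is
even (`nu_eq_halfMoment`). For `d = 1`, `q` itself is a multiple of the Fourier transform of a
primitive of `t φ(t)`.

For the formulas with `t⁻¹ ∂_t`: if `ψ = t⁻¹ φ'`, then `(𝓕 ψ)' = 4 π² r 𝓕 φ`, so a further
integration by parts gives `ν_{d+2}(φ) = -(2π)⁻¹ ν_d(ψ)` for `d ≥ 2` (`nu_add_two`). Since
`t⁻¹ φ'` is again an even test function, induction from `d = 2` and `d = 3` proves the formulas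
(`nu_even_eq`, `nu_odd_eq`).
-/

noncomputable section

namespace WaveTrace

/-! ### Nuclear sesquilinear forms -/

section NuclearForm

variable {H : Type} [NormedAddCommGroup H] [InnerProductSpace ℂ H]

/-- The form `B` is nuclear with trace `c`: it is a countable absolutely convergent sum of rank one
forms `(u, z) ↦ ⟪xᵢ, z⟫ ⟪u, yᵢ⟫`, and `∑ ⟪xᵢ, yᵢ⟫ = c`. -/
def HasFormTrace (B : H → H → ℂ) (c : ℂ) : Prop :=
  ∃ (ι : Type) (_ : Countable ι) (x y : ι → H), (Summable fun i => ‖x i‖ * ‖y i‖) ∧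
    (∀ u z, HasSum (fun i => inner ℂ (x i) z * inner ℂ u (y i)) (B u z)) ∧
    HasSum (fun i => inner ℂ (x i) (y i)) c

theorem HasFormTrace.add {B₁ B₂ : H → H → ℂ} {c₁ c₂ : ℂ} (h₁ : HasFormTrace B₁ c₁)
    (h₂ : HasFormTrace B₂ c₂) : HasFormTrace (fun u z => B₁ u z + B₂ u z) (c₁ + c₂) := by
  obtain ⟨ι₁, _, x₁, y₁, hs₁, hB₁, hc₁⟩ := h₁
  obtain ⟨ι₂, _, x₂, y₂, hs₂, hB₂, hc₂⟩ := h₂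
  refine ⟨ι₁ ⊕ ι₂, inferInstance, Sum.elim x₁ x₂, Sum.elim y₁ y₂, ?_, fun u z => ?_, ?_⟩
  · exact (HasSum.sum (f := fun i => ‖Sum.elim x₁ x₂ i‖ * ‖Sum.elim y₁ y₂ i‖)
      hs₁.hasSum hs₂.hasSum).summable
  · exact HasSum.sum (f := fun i => inner ℂ (Sum.elim x₁ x₂ i) z * inner ℂ u (Sum.elim y₁ y₂ i))
      (hB₁ u z) (hB₂ u z)
  · exact HasSum.sum (f := fun i => inner ℂ (Sum.elim x₁ x₂ i) (Sum.elim y₁ y₂ i)) hc₁ hc₂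

theorem HasFormTrace.zero : HasFormTrace (fun _ _ : H => (0 : ℂ)) 0 :=
  ⟨Empty, inferInstance, Empty.elim, Empty.elim, (hasSum_empty).summable,
    fun _ _ => hasSum_empty, hasSum_empty⟩

theorem HasFormTrace.sum {κ : Type*} (S : Finset κ) {B : κ → H → H → ℂ} {c : κ → ℂ}
    (h : ∀ k ∈ S, HasFormTrace (B k) (c k)) :
    HasFormTrace (fun u z => ∑ k ∈ S, B k u z) (∑ k ∈ S, c k) := by
  classical
  induction S using Finset.induction_on with
  | empty => simpa using HasFormTrace.zero
  | insert a S ha ih =>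
    simp only [Finset.sum_insert ha]
    exact (h a (Finset.mem_insert_self a S)).add
      (ih fun k hk => h k (Finset.mem_insert_of_mem hk))

theorem HasFormTrace.const_mul {B : H → H → ℂ} {c : ℂ} (a : ℂ) (h : HasFormTrace B c) :
    HasFormTrace (fun u z => a * B u z) (a * c) := by
  obtain ⟨ι, _, x, y, hs, hB, hc⟩ := h
  refine ⟨ι, inferInstance, x, fun i => a • y i, ?_, fun u z => ?_, ?_⟩
  · refine (hs.mul_left ‖a‖).congr fun i => ?_
    rw [norm_smul]; ring
  · refine ((hB u z).mul_left a).congr_fun fun i => ?_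
    rw [inner_smul_right]; ring
  · refine (hc.mul_left a).congr_fun fun i => ?_
    rw [inner_smul_right]

theorem hasSum_norm_sq_inner {ι : Type*} (b : HilbertBasis ι ℂ H) (v : H) :
    HasSum (fun i => ‖inner ℂ (b i) v‖ ^ 2) (‖v‖ ^ 2) := by
  have h := (b.hasSum_inner_mul_inner v v).mapL Complex.reCLM
  simp only [Complex.reCLM_apply] at h
  have h0 : (inner ℂ v v).re = ‖v‖ ^ 2 := by rw [inner_self_eq_norm_sq_to_K]; norm_cast
  rw [h0] at h
  refine h.congr_fun fun i => ?_
  rw [← inner_conj_symm v (b i), Complex.conj_mul']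
  norm_cast

theorem summable_norm_inner_mul_inner {ι : Type*} (b : HilbertBasis ι ℂ H) (x y : H) :
    (Summable fun i => ‖inner ℂ x (b i) * inner ℂ (b i) y‖) ∧
      ∑' i, ‖inner ℂ x (b i) * inner ℂ (b i) y‖ ≤ ‖x‖ * ‖y‖ := by
  have h := Real.summable_and_inner_le_Lp_mul_Lq_tsum_of_nonneg (p := 2) (q := 2)
    (f := fun i => ‖inner ℂ (b i) x‖) (g := fun i => ‖inner ℂ (b i) y‖)
    Real.HolderConjugate.two_two (fun _ => norm_nonneg _) (fun _ => norm_nonneg _)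
    (by simpa using (hasSum_norm_sq_inner b x).summable)
    (by simpa using (hasSum_norm_sq_inner b y).summable)
  simp only [Real.rpow_two, (hasSum_norm_sq_inner b _).tsum_eq, ← Real.sqrt_eq_rpow,
    Real.sqrt_sq (norm_nonneg _)] at h
  simp only [norm_mul, norm_inner_symm x]
  exact h

/-- A nuclear sum of rank one forms has the same diagonal sum in every Hilbert basis: expand each
`⟪xₙ, yₙ⟫` in the basis by Parseval and interchange the two sums. -/
theorem hasSum_diag_of_nuclear {ι κ : Type*} {B : H → H → ℂ} {x y : ι → H}
    (hs : Summable fun n => ‖x n‖ * ‖y n‖)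
    (hB : ∀ u z, HasSum (fun n => inner ℂ (x n) z * inner ℂ u (y n)) (B u z))
    (b : HilbertBasis κ ℂ H) :
    HasSum (fun i => B (b i) (b i)) (∑' n, inner ℂ (x n) (y n)) := by
  have hP : ∀ n, HasSum (fun i => inner ℂ (x n) (b i) * inner ℂ (b i) (y n))
      (inner ℂ (x n) (y n)) := fun n => b.hasSum_inner_mul_inner (x n) (y n)
  have hsum : Summable fun p : ι × κ => inner ℂ (x p.1) (b p.2) * inner ℂ (b p.2) (y p.1) := by
    refine Summable.of_norm ((summable_prod_of_nonneg
      (f := fun p : ι × κ => ‖inner ℂ (x p.1) (b p.2) * inner ℂ (b p.2) (y p.1)‖)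
      fun p => norm_nonneg _).2 ⟨fun n => ?_, ?_⟩)
    · exact (summable_norm_inner_mul_inner b (x n) (y n)).1
    · exact Summable.of_nonneg_of_le (fun n => tsum_nonneg fun i => norm_nonneg _)
        (fun n => (summable_norm_inner_mul_inner b (x n) (y n)).2) hs
  have htot : HasSum (fun p : ι × κ => inner ℂ (x p.1) (b p.2) * inner ℂ (b p.2) (y p.1))
      (∑' n, inner ℂ (x n) (y n)) := by
    have := hsum.hasSum
    rwa [← (this.prod_fiberwise hP).tsum_eq] at this
  exact ((Equiv.prodComm κ ι).hasSum_iff.2 htot).prod_fiberwise fun i => hB (b i) (b i)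

/-- A bounded operator whose sesquilinear form is nuclear is trace class. The countable index set is
embedded in `ℕ`, and the rank one terms are extended by zero. -/
theorem HasFormTrace.hasTrace [CompleteSpace H] {B : H → H → ℂ} {c : ℂ} {T : H →L[ℂ] H}
    (h : HasFormTrace B c) (hT : ∀ u z, inner ℂ u (T z) = B u z) : HasTrace T c := by
  obtain ⟨ι, _, x, y, hs, hB, hc⟩ := h
  obtain ⟨e, he⟩ := exists_injective_nat ι
  have hsum : ∀ z, HasSum (fun i => inner ℂ (x i) z • y i) (T z) := fun z => by
    have hS : Summable fun i => inner ℂ (x i) z • y i := by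
      refine Summable.of_norm_bounded (hs.mul_right ‖z‖) fun i => ?_
      rw [norm_smul]
      calc _ ≤ (‖x i‖ * ‖z‖) * ‖y i‖ := by gcongr; exact norm_inner_le_norm _ _
        _ = _ := by ring
    have : T z = ∑' i, inner ℂ (x i) z • y i := by
      refine ext_inner_left ℂ fun u => ?_
      rw [hT]
      refine (hB u z).unique ?_
      simpa [inner_smul_right] using hS.hasSum.mapL (innerSL ℂ u)
    rw [this]
    exact hS.hasSum
  refine ⟨⟨Function.extend e x 0, Function.extend e y 0, ?_, fun z => ?_⟩, fun κ b => ?_⟩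
  · refine (he.summable_iff fun n hn => ?_).1 ?_
    · rw [Function.extend_apply' _ _ _ (by simpa using hn)]; simp
    · simpa [Function.comp_def, he.extend_apply] using hs
  · refine (he.hasSum_iff fun n hn => ?_).1 ?_
    · rw [Function.extend_apply' _ _ _ (by simpa using hn)]; simp
    · simpa [Function.comp_def, he.extend_apply] using hsum z
  · have := hasSum_diag_of_nuclear hs hB b
    simpa only [hc.tsum_eq, ← hT] using this

/-! ### Integrals of rank one operators -/

theorem exists_countable_hilbertBasis (E : Type) [NormedAddCommGroup E] [InnerProductSpace ℂ E]
    [CompleteSpace E] [TopologicalSpace.SeparableSpace E] :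
    ∃ (ι : Type) (_ : Countable ι), Nonempty (HilbertBasis ι ℂ E) := by
  obtain ⟨w, b, hb⟩ := exists_hilbertBasis ℂ E
  refine ⟨w, ?_, ⟨b⟩⟩
  -- the balls of radius `1/2` about the basis vectors are disjoint
  refine Pairwise.countable_of_isOpen_disjoint (s := fun i : w => Metric.ball (b i) (1 / 2))
    (fun i j hij => ?_) (fun _ => Metric.isOpen_ball)
    (fun i => ⟨b i, Metric.mem_ball_self (by norm_num)⟩)
  refine Metric.ball_disjoint_ball ?_
  have h1 : ‖b i - b j‖ ^ 2 = 2 := by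
    rw [@norm_sub_sq ℂ, b.orthonormal.2 hij, b.orthonormal.1 i, b.orthonormal.1 j]; norm_num
  rw [dist_eq_norm]
  nlinarith [norm_nonneg (b i - b j)]

section Integral

variable {Ω : Type} [MeasurableSpace Ω] {μ : Measure Ω}

theorem norm_sq_eq_integral (f : Lp ℂ 2 μ) : ‖f‖ ^ 2 = ∫ ω, ‖f ω‖ ^ 2 ∂μ := by
  have h0 : ((‖f‖ ^ 2 : ℝ) : ℂ) = ((∫ ω, ‖f ω‖ ^ 2 ∂μ : ℝ) : ℂ) := by
    rw [← integral_complex_ofReal, Complex.ofReal_pow]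
    refine (inner_self_eq_norm_sq_to_K (𝕜 := ℂ) f).symm.trans ?_
    rw [L2.inner_def]
    refine integral_congr_ae (.of_forall fun ω => ?_)
    simp only [RCLike.inner_apply, Complex.mul_conj']
    norm_cast
  exact_mod_cast h0

theorem integrable_inner_mul_inner {r s : Ω → H} (hr : AEStronglyMeasurable r μ)
    (hs : AEStronglyMeasurable s μ) (hrs : Integrable (fun ω => ‖r ω‖ * ‖s ω‖) μ) (u z : H) :
    Integrable (fun ω => inner ℂ (r ω) z * inner ℂ u (s ω)) μ := by
  refine (hrs.mul_const (‖z‖ * ‖u‖)).mono'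
    ((hr.inner aestronglyMeasurable_const).mul (aestronglyMeasurable_const.inner hs))
    (.of_forall fun ω => ?_)
  rw [norm_mul]
  calc _ ≤ (‖r ω‖ * ‖z‖) * (‖u‖ * ‖s ω‖) := by
        gcongr <;> exact norm_inner_le_norm _ _
    _ = _ := by ring

/-- The diagonal sum of `∫ |s(ω)⟩⟨r(ω)| dμ` in a countable Hilbert basis. -/
theorem hasSum_integral_inner_mul_inner {r s : Ω → H} (hr : AEStronglyMeasurable r μ)
    (hs : AEStronglyMeasurable s μ) (hrs : Integrable (fun ω => ‖r ω‖ * ‖s ω‖) μ)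
    {κ : Type} [Countable κ] (b : HilbertBasis κ ℂ H) :
    HasSum (fun j => ∫ ω, inner ℂ (r ω) (b j) * inner ℂ (b j) (s ω) ∂μ)
      (∫ ω, inner ℂ (r ω) (s ω) ∂μ) := by
  have hm : ∀ j, AEStronglyMeasurable (fun ω => inner ℂ (r ω) (b j) * inner ℂ (b j) (s ω)) μ :=
    fun j => (integrable_inner_mul_inner hr hs hrs _ _).1
  refine hasSum_integral_of_dominated_convergence
    (fun j ω => ‖inner ℂ (r ω) (b j) * inner ℂ (b j) (s ω)‖) hm
    (fun j => .of_forall fun ω => le_rfl)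
    (.of_forall fun ω => (summable_norm_inner_mul_inner b _ _).1) ?_
    (.of_forall fun ω => b.hasSum_inner_mul_inner _ _)
  refine hrs.mono' ?_ (.of_forall fun ω => ?_)
  · exact (AEMeasurable.tsum fun j => (hm j).norm.aemeasurable).aestronglyMeasurable
  · rw [Real.norm_of_nonneg (tsum_nonneg fun _ => norm_nonneg _)]
    exact (summable_norm_inner_mul_inner b _ _).2

/-- The coefficient `∫ e(ω) r(ω) dμ` of an `H`-valued square integrable function. -/
theorem inner_integral_smul [CompleteSpace H] {r : Ω → H} (hr : MemLp r 2 μ) (e : Lp ℂ 2 μ)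
    (z : H) :
    inner ℂ (∫ ω, e ω • r ω ∂μ) z = inner ℂ e ((hr.inner_const (𝕜 := ℂ) z).toLp _) := by
  have hi : Integrable (fun ω => e ω • r ω) μ :=
    memLp_one_iff_integrable.1 (hr.smul (Lp.memLp e))
  rw [← inner_conj_symm, ← integral_inner hi, ← integral_conj, L2.inner_def]
  refine integral_congr_ae ?_
  filter_upwards [(hr.inner_const (𝕜 := ℂ) z).coeFn_toLp] with ω hω
  rw [hω, inner_smul_right, map_mul, inner_conj_symm, RCLike.inner_apply, mul_comm]

/-- Bessel's inequality for `H`-valued functions, expanded in a basis of scalar functions. -/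
theorem summable_norm_sq_integral_smul [CompleteSpace H]
    [TopologicalSpace.SeparableSpace H] {r : Ω → H} (hr : MemLp r 2 μ) {ι : Type}
    (e : HilbertBasis ι ℂ (Lp ℂ 2 μ)) : Summable fun i => ‖∫ ω, e i ω • r ω ∂μ‖ ^ 2 := by
  obtain ⟨κ, _, ⟨b⟩⟩ := exists_countable_hilbertBasis H
  set R : H → Lp ℂ 2 μ := fun z => (hr.inner_const (𝕜 := ℂ) z).toLp _ with hR
  have hRn : ∀ z, ‖R z‖ ^ 2 = ∫ ω, ‖inner ℂ (r ω) z‖ ^ 2 ∂μ := fun z => by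
    rw [norm_sq_eq_integral]
    refine integral_congr_ae ?_
    filter_upwards [(hr.inner_const (𝕜 := ℂ) z).coeFn_toLp] with ω hω
    rw [hR, hω]
  have h1 : Summable fun j => ‖R (b j)‖ ^ 2 := by
    have hint : ∀ z, Integrable (fun ω => ‖inner ℂ (r ω) z‖ ^ 2) μ := fun z =>
      (hr.inner_const (𝕜 := ℂ) z).integrable_norm_pow (by norm_num)
    refine summable_of_sum_le (c := ∫ ω, ‖r ω‖ ^ 2 ∂μ) (fun _ => by positivity) fun S => ?_
    simp only [hRn]
    rw [← integral_finsetSum _ fun j _ => hint _]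
    refine integral_mono (integrable_finsetSum _ fun j _ => hint _)
      (hr.integrable_norm_pow (by norm_num)) fun ω => ?_
    simp only [norm_inner_symm (r ω)]
    exact b.orthonormal.sum_inner_products_le _
  have h2 : Summable fun p : κ × ι => ‖inner ℂ (e p.2) (R (b p.1))‖ ^ 2 := by
    refine (summable_prod_of_nonneg
      (f := fun p : κ × ι => ‖inner ℂ (e p.2) (R (b p.1))‖ ^ 2)
      fun p => sq_nonneg _).2 ⟨fun j => (hasSum_norm_sq_inner e (R (b j))).summable, ?_⟩
    exact h1.congr fun j => (hasSum_norm_sq_inner e (R (b j))).tsum_eq.symm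
  have h3 := ((Equiv.prodComm ι κ).summable_iff.2 h2).prod
  refine h3.congr fun i => ?_
  rw [← (hasSum_norm_sq_inner b _).tsum_eq]
  refine tsum_congr fun j => ?_
  simp only [Function.comp_apply, Equiv.prodComm_apply, Prod.fst_swap, Prod.snd_swap]
  rw [norm_inner_symm (b j), inner_integral_smul hr]

theorem hasFormTrace_integral_of_memLp [CompleteSpace H] [TopologicalSpace.SeparableSpace H]
    [TopologicalSpace.SeparableSpace (Lp ℂ 2 μ)] {r s : Ω → H}
    (hr : MemLp r 2 μ) (hs : MemLp s 2 μ) :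
    HasFormTrace (fun u z => ∫ ω, inner ℂ (r ω) z * inner ℂ u (s ω) ∂μ)
      (∫ ω, inner ℂ (r ω) (s ω) ∂μ) := by
  obtain ⟨ι, _, ⟨e⟩⟩ := exists_countable_hilbertBasis (Lp ℂ 2 μ)
  obtain ⟨κ, _, ⟨b⟩⟩ := exists_countable_hilbertBasis H
  have hsum : Summable fun i => ‖∫ ω, e i ω • r ω ∂μ‖ * ‖∫ ω, e i ω • s ω ∂μ‖ := by
    refine Summable.of_nonneg_of_le (fun _ => by positivity) (fun i => ?_)
      ((summable_norm_sq_integral_smul hr e).add (summable_norm_sq_integral_smul hs e))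
    nlinarith [sq_nonneg (‖∫ ω, e i ω • r ω ∂μ‖ - ‖∫ ω, e i ω • s ω ∂μ‖),
      sq_nonneg (‖∫ ω, e i ω • r ω ∂μ‖), sq_nonneg (‖∫ ω, e i ω • s ω ∂μ‖)]
  have hB : ∀ u z, HasSum (fun i => inner ℂ (∫ ω, e i ω • r ω ∂μ) z *
      inner ℂ u (∫ ω, e i ω • s ω ∂μ)) (∫ ω, inner ℂ (r ω) z * inner ℂ u (s ω) ∂μ) := by
    intro u z
    have h := e.hasSum_inner_mul_inner ((hs.inner_const (𝕜 := ℂ) u).toLp _)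
      ((hr.inner_const (𝕜 := ℂ) z).toLp _)
    have h1 : inner ℂ ((hs.inner_const (𝕜 := ℂ) u).toLp _) ((hr.inner_const (𝕜 := ℂ) z).toLp _) =
        ∫ ω, inner ℂ (r ω) z * inner ℂ u (s ω) ∂μ := by
      rw [L2.inner_def]
      refine integral_congr_ae ?_
      filter_upwards [(hr.inner_const (𝕜 := ℂ) z).coeFn_toLp,
        (hs.inner_const (𝕜 := ℂ) u).coeFn_toLp] with ω h1 h2
      rw [h1, h2, RCLike.inner_apply, inner_conj_symm]
    rw [h1] at h
    refine h.congr_fun fun i => ?_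
    rw [inner_integral_smul hr, ← inner_conj_symm u, inner_integral_smul hs, inner_conj_symm,
      mul_comm]
  refine ⟨ι, inferInstance, _, _, hsum, hB, ?_⟩
  have h1 := hasSum_diag_of_nuclear hsum hB b
  have h2 := hasSum_integral_inner_mul_inner hr.1 hs.1
    ((hr.norm.integrable_mul hs.norm)) b
  rw [h2.unique h1]
  refine (Summable.of_norm_bounded hsum fun i => norm_inner_le_norm _ _).hasSum

/-- An absolutely convergent integral of rank one operators is trace class, with trace
`∫ ⟪r, s⟫`. -/
theorem hasFormTrace_integral [CompleteSpace H] [TopologicalSpace.SeparableSpace H]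
    [TopologicalSpace.SeparableSpace (Lp ℂ 2 μ)] {r s : Ω → H}
    (hr : AEStronglyMeasurable r μ) (hs : AEStronglyMeasurable s μ)
    (hrs : Integrable (fun ω => ‖r ω‖ * ‖s ω‖) μ) :
    HasFormTrace (fun u z => ∫ ω, inner ℂ (r ω) z * inner ℂ u (s ω) ∂μ)
      (∫ ω, inner ℂ (r ω) (s ω) ∂μ) := by
  -- Balance the two factors so that both become square integrable. Where `r` or `s` vanishes, the
  -- convention `x / 0 = 0` makes both new factors vanish.
  have key : ∀ {p q : Ω → H}, AEStronglyMeasurable p μ → AEStronglyMeasurable q μ →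
      Integrable (fun ω => ‖p ω‖ * ‖q ω‖) μ →
      MemLp (fun ω => ((√(‖q ω‖ / ‖p ω‖) : ℝ) : ℂ) • p ω) 2 μ := by
    intro p q hp hq hpq
    have hm : AEStronglyMeasurable (fun ω => ((√(‖q ω‖ / ‖p ω‖) : ℝ) : ℂ) • p ω) μ := by
      refine AEStronglyMeasurable.smul ?_ hp
      exact (Complex.measurable_ofReal.comp_aemeasurable
        ((hq.norm.aemeasurable.div hp.norm.aemeasurable).sqrt)).aestronglyMeasurable
    rw [memLp_two_iff_integrable_sq_norm hm]
    refine hpq.congr (.of_forall fun ω => ?_)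
    simp only [norm_smul, Complex.norm_real, Real.norm_of_nonneg (Real.sqrt_nonneg _), mul_pow]
    rw [Real.sq_sqrt (by positivity)]
    by_cases h : ‖p ω‖ = 0
    · simp [h]
    · field_simp
  have h := hasFormTrace_integral_of_memLp (key hr hs hrs)
    (key hs hr (by simpa only [mul_comm] using hrs))
  have e : ∀ ω, (√(‖s ω‖ / ‖r ω‖) : ℝ) * (√(‖r ω‖ / ‖s ω‖) : ℝ) = 1 ∨ r ω = 0 ∨ s ω = 0 := by
    intro ω
    by_cases h1 : r ω = 0
    · exact .inr (.inl h1)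
    by_cases h2 : s ω = 0
    · exact .inr (.inr h2)
    left
    rw [← Real.sqrt_mul (by positivity)]
    have : ‖s ω‖ / ‖r ω‖ * (‖r ω‖ / ‖s ω‖) = 1 := by
      have := norm_ne_zero_iff.2 h1
      have := norm_ne_zero_iff.2 h2
      field_simp
    rw [this, Real.sqrt_one]
  convert h using 2
  · funext z
    refine integral_congr_ae (.of_forall fun ω => ?_)
    simp only [inner_smul_left, inner_smul_right, Complex.conj_ofReal]
    rcases e ω with h | h | h
    · have h' : ((√(‖s ω‖ / ‖r ω‖) : ℝ) : ℂ) * ((√(‖r ω‖ / ‖s ω‖) : ℝ) : ℂ) = 1 := by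
        exact_mod_cast h
      linear_combination (-(inner ℂ (r ω) z * inner ℂ _ (s ω))) * h'
    · simp [h]
    · simp [h]
  · funext ω
    simp only [inner_smul_left, inner_smul_right, Complex.conj_ofReal]
    rcases e ω with h | h | h
    · have h' : ((√(‖s ω‖ / ‖r ω‖) : ℝ) : ℂ) * ((√(‖r ω‖ / ‖s ω‖) : ℝ) : ℂ) = 1 := by
        exact_mod_cast h
      linear_combination (-(inner ℂ (r ω) (s ω))) * h'
    · simp [h]
    · simp [h]

end Integral

end NuclearForm

/-! ### Multiplication operators and Fourier multipliers -/

section Multiplier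

variable {d : ℕ}

theorem inner_L2_eq (f g : L2 d) : inner ℂ f g = ∫ x, (starRingEnd ℂ) (f x) * g x := by
  rw [L2.inner_def]
  exact integral_congr_ae (.of_forall fun x => RCLike.inner_apply' _ _)

theorem integrable_conj_mul (f g : L2 d) :
    Integrable (fun x => (starRingEnd ℂ) (f x) * g x) :=
  (L2.integrable_inner (𝕜 := ℂ) f g).congr (.of_forall fun _ => RCLike.inner_apply' _ _)

theorem norm_mulOp_le {m : Space d → ℂ} (hm : MemLp m ∞ volume) {C : ℝ}
    (h : ∀ᵐ x, ‖m x‖ ≤ C) (f : L2 d) : ‖mulOp m hm f‖ ≤ C * ‖f‖ := by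
  refine Lp.norm_le_mul_norm_of_ae_le_mul ?_
  filter_upwards [mulOp_ae m hm f, h] with x h1 h2
  rw [h1, norm_mul]
  gcongr

theorem mulOp_apply_congr {m m' : Space d → ℂ} (hm : MemLp m ∞ volume) (hm' : MemLp m' ∞ volume)
    (f f' : L2 d) (h : ∀ᵐ x, m x * f x = m' x * f' x) : mulOp m hm f = mulOp m' hm' f' := by
  refine Lp.ext ?_
  filter_upwards [mulOp_ae m hm f, mulOp_ae m' hm' f', h] with x h1 h2 h3
  rw [h1, h2, h3]

theorem inner_mulOp (m : Space d → ℂ) (hm : MemLp m ∞ volume) (f g : L2 d) :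
    inner ℂ f (mulOp m hm g) = ∫ x, (starRingEnd ℂ) (f x) * (m x * g x) := by
  rw [inner_L2_eq]
  refine integral_congr_ae ?_
  filter_upwards [mulOp_ae m hm g] with x h
  rw [h]

theorem memLp_conj {m : Space d → ℂ} {p : ℝ≥0∞} (hm : MemLp m p volume) :
    MemLp (fun x => (starRingEnd ℂ) (m x)) p volume :=
  hm.star

theorem inner_mulOp_left (m : Space d → ℂ) (hm : MemLp m ∞ volume) (f g : L2 d) :
    inner ℂ (mulOp m hm f) g = inner ℂ f (mulOp _ (memLp_conj hm) g) := by
  rw [inner_mulOp, inner_L2_eq]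
  refine integral_congr_ae ?_
  filter_upwards [mulOp_ae m hm f] with x h
  rw [h, map_mul]; ring

/-- Multiplication operators depend strongly continuously on a locally bounded symbol which is
pointwise continuous in the parameter. -/
theorem continuous_mulOp {X : Type*} [TopologicalSpace X] [FirstCountableTopology X]
    (m : X → Space d → ℂ) (hm : ∀ x, MemLp (m x) ∞ volume) (hc : ∀ ξ, Continuous fun x => m x ξ)
    (hb : ∀ x₀, ∃ M, ∀ᶠ x in nhds x₀, ∀ ξ, ‖m x ξ‖ ≤ M) {f : X → L2 d} (hf : Continuous f) :
    Continuous fun x => mulOp (m x) (hm x) (f x) := by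
  refine continuous_iff_continuousAt.2 fun x₀ => ?_
  obtain ⟨M, hM⟩ := hb x₀
  have hM0 : 0 ≤ M := (norm_nonneg _).trans (hM.self_of_nhds 0)
  have h1 : Filter.Tendsto (fun x => ‖mulOp (m x) (hm x) (f x₀) - mulOp (m x₀) (hm x₀) (f x₀)‖ ^ 2)
      (nhds x₀) (nhds 0) := by
    have e : ∀ x, ‖mulOp (m x) (hm x) (f x₀) - mulOp (m x₀) (hm x₀) (f x₀)‖ ^ 2 =
        ∫ ξ, ‖(m x ξ - m x₀ ξ) * f x₀ ξ‖ ^ 2 := fun x => by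
      rw [norm_sq_eq_integral]
      refine integral_congr_ae ?_
      filter_upwards [mulOp_ae (m x) (hm x) (f x₀), mulOp_ae (m x₀) (hm x₀) (f x₀),
        Lp.coeFn_sub (mulOp (m x) (hm x) (f x₀)) (mulOp (m x₀) (hm x₀) (f x₀))] with ξ h1 h2 h3
      rw [h3, Pi.sub_apply, h1, h2, sub_mul]
    simp only [e]
    have z : (0 : ℝ) = ∫ ξ : Space d, (0 : ℝ) := by simp
    rw [z]
    refine tendsto_integral_filter_of_dominated_convergence (fun ξ => (2 * M) ^ 2 * ‖f x₀ ξ‖ ^ 2)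
      (.of_forall fun x => ?_) ?_ ?_ (.of_forall fun ξ => ?_)
    · exact ((((hm x).1.sub (hm x₀).1).mul (Lp.aestronglyMeasurable (f x₀))).norm.pow 2)
    · filter_upwards [hM] with x hx
      refine .of_forall fun ξ => ?_
      rw [Real.norm_of_nonneg (by positivity), norm_mul, mul_pow]
      gcongr
      linarith [norm_sub_le (m x ξ) (m x₀ ξ), hx ξ, hM.self_of_nhds ξ]
    · exact ((Lp.memLp (f x₀)).integrable_norm_pow (by norm_num)).const_mul _
    · have := (((hc ξ).tendsto x₀).sub_const (m x₀ ξ)).mul_const (f x₀ ξ)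
      simpa using this.norm.pow 2
  have h2 : Filter.Tendsto (fun x => mulOp (m x) (hm x) (f x₀)) (nhds x₀)
      (nhds (mulOp (m x₀) (hm x₀) (f x₀))) := by
    rw [tendsto_iff_norm_sub_tendsto_zero]
    simpa using h1.sqrt
  have h3 : Filter.Tendsto (fun x => mulOp (m x) (hm x) (f x - f x₀)) (nhds x₀) (nhds 0) := by
    have h0 : Filter.Tendsto (fun x => M * ‖f x - f x₀‖) (nhds x₀) (nhds 0) := by
      simpa using ((((hf.tendsto x₀).sub_const (f x₀)).norm).const_mul M)
    refine squeeze_zero_norm' ?_ h0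
    filter_upwards [hM] with x hx
    exact norm_mulOp_le (hm x) (.of_forall hx) _
  have := h3.add h2
  simpa [ContinuousAt] using this

theorem multiplier_apply (m : Space d → ℂ) (hm : MemLp m ∞ volume) (f : L2 d) :
    multiplier m hm f = (fourierL2 d).symm (mulOp m hm (fourierL2 d f)) := rfl

theorem continuous_multiplier {X : Type*} [TopologicalSpace X] [FirstCountableTopology X]
    (m : X → Space d → ℂ) (hm : ∀ x, MemLp (m x) ∞ volume) (hc : ∀ ξ, Continuous fun x => m x ξ)
    (hb : ∀ x₀, ∃ M, ∀ᶠ x in nhds x₀, ∀ ξ, ‖m x ξ‖ ≤ M) {f : X → L2 d} (hf : Continuous f) :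
    Continuous fun x => multiplier (m x) (hm x) (f x) :=
  (fourierL2 d).symm.continuous.comp
    (continuous_mulOp m hm hc hb ((fourierL2 d).continuous.comp hf))

theorem norm_multiplier_le {m : Space d → ℂ} (hm : MemLp m ∞ volume) {C : ℝ}
    (h : ∀ᵐ x, ‖m x‖ ≤ C) (f : L2 d) : ‖multiplier m hm f‖ ≤ C * ‖f‖ := by
  rw [multiplier_apply, LinearIsometryEquiv.norm_map]
  simpa using norm_mulOp_le hm h (fourierL2 d f)

theorem inner_multiplier (m : Space d → ℂ) (hm : MemLp m ∞ volume) (f g : L2 d) :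
    inner ℂ f (multiplier m hm g) =
      ∫ ξ, (starRingEnd ℂ) (fourierL2 d f ξ) * (m ξ * fourierL2 d g ξ) := by
  rw [← (fourierL2 d).inner_map_map, multiplier_apply, LinearIsometryEquiv.apply_symm_apply,
    inner_mulOp]

theorem inner_multiplier_left (m : Space d → ℂ) (hm : MemLp m ∞ volume) (f g : L2 d) :
    inner ℂ (multiplier m hm f) g = inner ℂ f (multiplier _ (memLp_conj hm) g) := by
  rw [← (fourierL2 d).inner_map_map, multiplier_apply, LinearIsometryEquiv.apply_symm_apply,
    inner_mulOp_left, inner_multiplier, inner_mulOp]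

theorem multiplier_apply_congr {m m' : Space d → ℂ} (hm : MemLp m ∞ volume)
    (hm' : MemLp m' ∞ volume) (f f' : L2 d)
    (h : ∀ᵐ ξ, m ξ * fourierL2 d f ξ = m' ξ * fourierL2 d f' ξ) :
    multiplier m hm f = multiplier m' hm' f' := by
  rw [multiplier_apply, multiplier_apply, mulOp_apply_congr hm hm' _ _ h]

theorem multiplier_multiplier (m m' : Space d → ℂ) (hm : MemLp m ∞ volume)
    (hm' : MemLp m' ∞ volume) (h : MemLp (fun ξ => m ξ * m' ξ) ∞ volume) (f : L2 d) :
    multiplier m hm (multiplier m' hm' f) = multiplier _ h f := by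
  refine multiplier_apply_congr _ _ _ _ ?_
  filter_upwards [fourier_multiplier_ae m' hm' f] with ξ h1
  rw [h1]; ring

/-- The Fourier multiplier of an integral of symbols is the weak integral of the Fourier
multipliers. -/
theorem integral_inner_multiplier {Ω : Type*} [MeasurableSpace Ω] {ν : Measure Ω} [SFinite ν]
    (m : Ω → Space d → ℂ) (hm : ∀ ω, MemLp (m ω) ∞ volume)
    (hmeas : AEStronglyMeasurable (Function.uncurry m) (ν.prod volume)) {b : Ω → ℝ}
    (hb : Integrable b ν) (hmb : ∀ ω ξ, ‖m ω ξ‖ ≤ b ω)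
    (hM : MemLp (fun ξ => ∫ ω, m ω ξ ∂ν) ∞ volume) (f g : L2 d) :
    Integrable (fun ω => inner ℂ f (multiplier (m ω) (hm ω) g)) ν ∧
    ∫ ω, inner ℂ f (multiplier (m ω) (hm ω) g) ∂ν = inner ℂ f (multiplier _ hM g) := by
  have hint : Integrable (fun p : Ω × Space d => (starRingEnd ℂ) (fourierL2 d f p.2) *
      (m p.1 p.2 * fourierL2 d g p.2)) (ν.prod volume) := by
    have h0 := hb.mul_prod (integrable_conj_mul (fourierL2 d f) (fourierL2 d g)).norm
    refine h0.mono' ?_ (.of_forall fun p => ?_)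
    · have h1 := (Lp.aestronglyMeasurable (fourierL2 d f)).comp_snd (μ := ν)
      have h2 := (Lp.aestronglyMeasurable (fourierL2 d g)).comp_snd (μ := ν)
      exact h1.star.mul (hmeas.mul h2)
    · simp only [norm_mul, RCLike.norm_conj]
      have := hmb p.1 p.2
      calc _ = ‖m p.1 p.2‖ * (‖fourierL2 d f p.2‖ * ‖fourierL2 d g p.2‖) := by ring
        _ ≤ _ := by gcongr
  simp only [inner_multiplier]
  refine ⟨hint.integral_prod_left, ?_⟩
  rw [integral_integral_swap hint]
  refine integral_congr_ae (.of_forall fun ξ => ?_)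
  simp only [integral_const_mul, integral_mul_const]

end Multiplier

/-! ### The Fourier transform of modulated functions -/

section Modulation

variable {d : ℕ}

/-- The `L²` Fourier transform of an integrable function is given by the Fourier integral: both
agree as tempered distributions. -/
theorem fourierL2_toLp {v : Space d → ℂ} (h1 : Integrable v) (h2 : MemLp v 2 volume) :
    fourierL2 d (h2.toLp v) =ᵐ[volume] 𝓕 v := by
  have hc : Continuous (𝓕 v) := by
    have := VectorFourier.fourierIntegral_continuous (V := Space d) (W := Space d) (E := ℂ)
      (μ := volume) Real.continuous_fourierChar (L := innerₗ (Space d))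
      (by exact continuous_inner) h1
    exact this
  refine ae_eq_of_integral_contDiff_smul_eq ?_ hc.locallyIntegrable fun g hg hgc => ?_
  · exact (Lp.memLp _).locallyIntegrable (by norm_num)
  set G : SchwartzMap (Space d) ℂ := (hgc.comp_left (g := ((↑) : ℝ → ℂ)) rfl).toSchwartzMap
    (Complex.ofRealCLM.contDiff.comp hg) with hG
  have e1 := Lp.fourier_toTemperedDistribution_eq (h2.toLp v)
  have e2 := congrArg (fun T => T G) e1
  simp only [TemperedDistribution.fourier_apply, Lp.toTemperedDistribution_apply] at e2
  have hG0 : ∀ x, G x = (g x : ℂ) := fun x => rfl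
  have e3 : ∫ x, (𝓕 G) x • (h2.toLp v) x = ∫ x, G x • 𝓕 v x := by
    have h3 : ∫ x, (𝓕 G) x • (h2.toLp v) x = ∫ x, (𝓕 G) x • v x := by
      refine integral_congr_ae ?_
      filter_upwards [h2.coeFn_toLp] with x hx
      rw [hx]
    rw [h3]
    have h4 := VectorFourier.integral_fourierIntegral_smul_eq_flip (L := innerₗ (Space d))
      (f := G) (μ := volume) (ν := volume) Real.continuous_fourierChar continuous_inner G.integrable
      h1
    rw [flip_innerₗ] at h4
    exact h4
  rw [e3] at e2
  simp only [hG0, Complex.coe_smul] at e2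
  exact e2.symm

/-- The character `x ↦ exp (2πi⟨x, κ⟩)`. -/
def planeWave (κ x : Space d) : ℂ :=
  Complex.exp (((2 * Real.pi * inner ℝ x κ : ℝ) : ℂ) * Complex.I)

theorem norm_planeWave (κ x : Space d) : ‖planeWave κ x‖ = 1 :=
  Complex.norm_exp_ofReal_mul_I _

theorem continuous_planeWave_left (x : Space d) : Continuous fun κ => planeWave κ x := by
  unfold planeWave; fun_prop

theorem memLp_planeWave (κ : Space d) : MemLp (planeWave κ) ∞ volume := by
  refine memLp_top_of_bound (C := 1) ?_ (.of_forall fun ξ => (norm_planeWave κ ξ).le)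
  exact Continuous.aestronglyMeasurable (by unfold planeWave; fun_prop)

/-- Multiplication by the character `x ↦ exp (2πi⟨x, κ⟩)`. -/
def modOp (κ : Space d) : L2 d →L[ℂ] L2 d := mulOp _ (memLp_planeWave κ)

theorem continuous_modOp (v : L2 d) : Continuous fun κ : Space d => modOp κ v :=
  continuous_mulOp _ _ continuous_planeWave_left
    (fun _ => ⟨1, .of_forall fun κ x => (norm_planeWave κ x).le⟩) continuous_const

theorem norm_modOp_le (κ : Space d) (v : L2 d) : ‖modOp κ v‖ ≤ ‖v‖ := by
  have h := norm_mulOp_le (memLp_planeWave κ) (.of_forall fun x => (norm_planeWave κ x).le) v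
  rwa [one_mul] at h

/-- Modulation becomes translation on the Fourier side. -/
theorem fourierL2_modOp {v : Space d → ℂ} (h1 : Integrable v) (h2 : MemLp v 2 volume)
    (κ : Space d) : fourierL2 d (modOp κ (h2.toLp v)) =ᵐ[volume] fun ξ => 𝓕 v (ξ - κ) := by
  have h1' : Integrable fun x => planeWave κ x * v x :=
    h1.bdd_mul (memLp_planeWave κ).1 (c := 1) (.of_forall fun x => (norm_planeWave κ x).le)
  have h2' : MemLp (fun x => planeWave κ x * v x) 2 volume :=
    h2.mul (memLp_planeWave κ)
  have e : modOp κ (h2.toLp v) = h2'.toLp _ := by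
    refine Lp.ext ?_
    filter_upwards [mulOp_ae _ (memLp_planeWave κ) (h2.toLp v), h2.coeFn_toLp, h2'.coeFn_toLp]
      with x h3 h4 h5
    rw [modOp, h3, h4, h5]
  rw [e]
  filter_upwards [fourierL2_toLp h1' h2'] with ξ hξ
  rw [hξ, Real.fourier_eq', Real.fourier_eq']
  refine integral_congr_ae (.of_forall fun x => ?_)
  simp only [planeWave, smul_eq_mul, ← mul_assoc, ← Complex.exp_add, inner_sub_right]
  congr 2
  push_cast; ring

/-- Multiplication by `v₁ v̄₂` is the integral over `κ` of the rank one operators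
`|e_κ v₁⟩⟨e_κ v₂|`, by Plancherel's theorem. -/
theorem inner_mulOp_eq_integral {v₁ v₂ V : Space d → ℂ} (hV : MemLp V ∞ volume)
    (h1 : MemLp v₁ 2 volume) (h1' : MemLp v₁ ∞ volume) (h2 : MemLp v₂ 2 volume)
    (h2' : MemLp v₂ ∞ volume) (h : ∀ᵐ x, V x = v₁ x * (starRingEnd ℂ) (v₂ x)) (p q : L2 d) :
    inner ℂ p (mulOp V hV q) =
      ∫ κ, inner ℂ p (modOp κ (h1.toLp v₁)) * inner ℂ (modOp κ (h2.toLp v₂)) q := by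
  have hP : ∀ {v : Space d → ℂ} (a2 : MemLp v 2 volume) (a : MemLp v ∞ volume) (f : L2 d),
      (fun κ => inner ℂ (modOp κ (a2.toLp v)) f) =ᵐ[volume]
        fourierL2 d (mulOp _ (memLp_conj a) f) := by
    intro v a2 a f
    have i1 : Integrable fun x => (starRingEnd ℂ) (v x) * f x :=
      (memLp_conj a2).integrable_mul (Lp.memLp f)
    have i2 : MemLp (fun x => (starRingEnd ℂ) (v x) * f x) 2 volume :=
      (Lp.memLp f).mul (memLp_conj a)
    have e : mulOp _ (memLp_conj a) f = i2.toLp _ := by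
      refine Lp.ext ?_
      filter_upwards [mulOp_ae _ (memLp_conj a) f, i2.coeFn_toLp] with x h3 h4
      rw [h3, h4]
    rw [e]
    filter_upwards [fourierL2_toLp i1 i2] with κ hκ
    rw [hκ, Real.fourier_eq', inner_L2_eq]
    refine integral_congr_ae ?_
    filter_upwards [mulOp_ae _ (memLp_planeWave κ) (a2.toLp v), a2.coeFn_toLp] with x h3 h4
    rw [modOp, h3, h4, map_mul, planeWave, ← Complex.exp_conj, map_mul, Complex.conj_ofReal,
      Complex.conj_I, smul_eq_mul, mul_assoc]
    congr 2
    push_cast; ring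
  have e : inner ℂ p (mulOp V hV q) =
      inner ℂ (mulOp _ (memLp_conj h1') p) (mulOp _ (memLp_conj h2') q) := by
    rw [inner_mulOp, inner_L2_eq]
    refine integral_congr_ae ?_
    filter_upwards [mulOp_ae _ (memLp_conj h1') p, mulOp_ae _ (memLp_conj h2') q, h]
      with x e1 e2 e3
    rw [e1, e2, e3, map_mul, Complex.conj_conj]; ring
  rw [e, ← (fourierL2 d).inner_map_map, inner_L2_eq]
  refine integral_congr_ae ?_
  filter_upwards [hP h1 h1' p, hP h2 h2' q] with κ e1 e2
  rw [← e1, ← e2, inner_conj_symm]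

/-- The diagonal `κ`-average of a Fourier multiplier over modulations. -/
theorem integral_inner_modOp_multiplier {v₁ v₂ : Space d → ℂ} (h1 : MemLp v₁ 2 volume)
    (h1' : Integrable v₁) (h2 : MemLp v₂ 2 volume) (h2' : Integrable v₂) {M : Space d → ℂ}
    (hM : MemLp M ∞ volume) (hMi : Integrable M) :
    ∫ κ, inner ℂ (modOp κ (h2.toLp v₂)) (multiplier M hM (modOp κ (h1.toLp v₁))) =
      (∫ x, v₁ x * (starRingEnd ℂ) (v₂ x)) * ∫ ξ, M ξ := by
  set g : Space d → ℂ := fun ζ => (starRingEnd ℂ) (𝓕 v₂ ζ) * 𝓕 v₁ ζ with hg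
  have hae : g =ᵐ[volume]
      fun ζ => (starRingEnd ℂ) (fourierL2 d (h2.toLp v₂) ζ) * fourierL2 d (h1.toLp v₁) ζ := by
    filter_upwards [fourierL2_toLp h1' h1, fourierL2_toLp h2' h2] with ζ e1 e2
    rw [e1, e2]
  have hgi : Integrable g := (integrable_conj_mul _ _).congr hae.symm
  have hgint : ∫ ζ, g ζ = ∫ x, v₁ x * (starRingEnd ℂ) (v₂ x) := by
    rw [integral_congr_ae hae, ← inner_L2_eq, (fourierL2 d).inner_map_map, inner_L2_eq]
    refine integral_congr_ae ?_
    filter_upwards [h1.coeFn_toLp, h2.coeFn_toLp] with x e1 e2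
    rw [e1, e2, mul_comm]
  have e : ∀ κ, inner ℂ (modOp κ (h2.toLp v₂)) (multiplier M hM (modOp κ (h1.toLp v₁))) =
      ∫ ξ, M ξ * g (ξ - κ) := fun κ => by
    rw [inner_multiplier]
    refine integral_congr_ae ?_
    filter_upwards [fourierL2_modOp h1' h1 κ, fourierL2_modOp h2' h2 κ] with ξ e1 e2
    rw [e1, e2, hg]; ring
  simp only [e]
  have hint : Integrable (fun p : Space d × Space d => M p.2 * g (p.2 - p.1))
      (volume.prod volume) := by
    have h0 : Integrable (fun p : Space d × Space d => M p.1 * g (-p.2))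
      (volume.prod volume) := hMi.mul_prod hgi.comp_neg
    have h1 := (measurePreserving_prod_sub_swap (volume : Measure (Space d))
      (volume : Measure (Space d))).integrable_comp_of_integrable h0
    refine h1.congr (.of_forall fun p => ?_)
    simp [Function.comp]
  rw [integral_integral_swap hint]
  simp only [integral_const_mul, integral_sub_left_eq_self g volume]
  rw [integral_mul_const, hgint, mul_comm]

end Modulation

/-! ### Trace class operators built from a potential and two families of symbols -/

section Decay

variable {d : ℕ}

/-- The integrable rate of decay `(1 + ‖ξ‖)^{-(d + 1)}` on `ℝ^d`. -/
def decayRate (ξ : Space d) : ℝ := ((1 + ‖ξ‖) ^ (d + 1))⁻¹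

theorem decayRate_pos (ξ : Space d) : 0 < decayRate ξ := by unfold decayRate; positivity

theorem decayRate_le_one (ξ : Space d) : decayRate ξ ≤ 1 :=
  inv_le_one_of_one_le₀ (one_le_pow₀ (by linarith [norm_nonneg ξ]))

theorem continuous_decayRate : Continuous (decayRate (d := d)) := by
  unfold decayRate
  exact Continuous.inv₀ (by fun_prop) fun ξ => by positivity

theorem integrable_decayRate : Integrable (decayRate (d := d)) := by
  have h := integrable_one_add_norm (E := Space d) (μ := volume) (r := (d + 1 : ℕ))
    (by simp)
  refine h.congr (.of_forall fun ξ => ?_)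
  simp only [decayRate]
  rw [Real.rpow_neg (by positivity), Real.rpow_natCast]

/-- Peetre's inequality. -/
theorem decayRate_le_mul (ξ κ : Space d) :
    decayRate ξ ≤ decayRate κ * (decayRate (ξ - κ))⁻¹ := by
  unfold decayRate
  rw [inv_inv, inv_mul_eq_div, le_div_iff₀ (by positivity), inv_mul_le_iff₀ (by positivity),
    ← mul_pow]
  refine pow_le_pow_left₀ (by positivity) ?_ _
  have : ‖κ‖ ≤ ‖ξ‖ + ‖ξ - κ‖ := by
    calc ‖κ‖ = ‖ξ - (ξ - κ)‖ := by simp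
      _ ≤ _ := norm_sub_le _ _
  nlinarith [norm_nonneg ξ, norm_nonneg (ξ - κ)]

/-- A decaying Fourier multiplier makes the modulations `e_κ χ` of a Schwartz function small for
large `κ`. -/
theorem norm_multiplier_modOp_le (χ : SchwartzMap (Space d) ℂ) :
    ∃ K, 0 ≤ K ∧ ∀ (m : Space d → ℂ) (hm : MemLp m ∞ volume) (C : ℝ),
      (∀ ξ, ‖m ξ‖ ≤ C * decayRate ξ) → ∀ κ,
      ‖multiplier m hm (modOp κ ((χ.memLp 2).toLp χ))‖ ≤ C * K * decayRate κ := by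
  obtain ⟨B, hB⟩ : ∃ B, ∀ ζ, ‖𝓕 (χ : Space d → ℂ) ζ‖ ≤ B * decayRate ζ ^ 2 := by
    refine ⟨2 ^ ((d + 1) * 2) * ((Finset.Iic ((d + 1) * 2, 0)).sup
      fun m => SchwartzMap.seminorm ℂ m.1 m.2) (𝓕 χ), fun ζ => ?_⟩
    have h := SchwartzMap.one_add_le_sup_seminorm_apply (𝕜 := ℂ) (m := ((d + 1) * 2, 0))
      le_rfl le_rfl (𝓕 χ) ζ
    rw [norm_iteratedFDeriv_zero] at h
    rw [decayRate, inv_pow, ← pow_mul, ← div_eq_mul_inv, le_div_iff₀ (by positivity), mul_comm]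
    exact h
  have hB0 : 0 ≤ B := by
    have := (norm_nonneg _).trans (hB 0)
    have h2 := decayRate_pos (0 : Space d)
    by_contra hneg
    nlinarith [sq_pos_of_pos h2]
  refine ⟨√(∫ ζ : Space d, (B * decayRate ζ) ^ 2), Real.sqrt_nonneg _, fun m hm C hmC κ => ?_⟩
  have hC0 : 0 ≤ C := by
    have := (norm_nonneg _).trans (hmC 0)
    have h2 := decayRate_pos (0 : Space d)
    by_contra hneg
    nlinarith
  have hBi : Integrable fun ζ : Space d => (B * decayRate ζ) ^ 2 := by
    refine ((integrable_decayRate (d := d)).const_mul (B ^ 2)).mono'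
      ((continuous_const.mul continuous_decayRate).pow 2).aestronglyMeasurable
      (.of_forall fun ζ => ?_)
    rw [Real.norm_of_nonneg (by positivity), mul_pow]
    gcongr
    nlinarith [decayRate_pos ζ, decayRate_le_one ζ]
  have hd := decayRate_pos κ
  set g : L2 d := fourierL2 d (modOp κ ((χ.memLp 2).toLp χ)) with hg
  have hpt : ∀ᵐ ξ, ‖mulOp m hm g ξ‖ ^ 2 ≤ (C * decayRate κ) ^ 2 * (B * decayRate (ξ - κ)) ^ 2 := by
    filter_upwards [mulOp_ae m hm g, fourierL2_modOp χ.integrable (χ.memLp 2) κ] with ξ h1 h2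
    rw [h1, hg, h2, ← mul_pow, norm_mul]
    refine pow_le_pow_left₀ (by positivity) ?_ 2
    have hd' := decayRate_pos (ξ - κ)
    calc ‖m ξ‖ * ‖𝓕 (χ : Space d → ℂ) (ξ - κ)‖
        ≤ (C * (decayRate κ * (decayRate (ξ - κ))⁻¹)) * (B * decayRate (ξ - κ) ^ 2) := by
          refine mul_le_mul ((hmC ξ).trans ?_) (hB _) (norm_nonneg _) (by positivity)
          exact mul_le_mul_of_nonneg_left (decayRate_le_mul ξ κ) hC0
      _ = _ := by field_simp
  have hsq : ‖mulOp m hm g‖ ^ 2 ≤ (C * decayRate κ) ^ 2 * ∫ ζ : Space d, (B * decayRate ζ) ^ 2 := by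
    rw [norm_sq_eq_integral,
      ← integral_sub_right_eq_self (fun ζ : Space d => (B * decayRate ζ) ^ 2) κ,
      ← integral_const_mul]
    have i1 : Integrable fun ξ => ‖mulOp m hm g ξ‖ ^ 2 :=
      (Lp.memLp (mulOp m hm g)).integrable_norm_pow (by norm_num)
    have i2 : Integrable fun ξ => (C * decayRate κ) ^ 2 * (B * decayRate (ξ - κ)) ^ 2 :=
      (hBi.comp_sub_right κ).const_mul _
    exact integral_mono_ae i1 i2 hpt
  rw [multiplier_apply, LinearIsometryEquiv.norm_map, mul_right_comm]
  have hI : 0 ≤ ∫ ζ : Space d, (B * decayRate ζ) ^ 2 := integral_nonneg fun ζ => sq_nonneg _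
  generalize (∫ ζ : Space d, (B * decayRate ζ) ^ 2) = I at hsq hI
  have hq : ‖mulOp m hm g‖ ^ 2 ≤ (C * decayRate κ * √I) ^ 2 := by
    rwa [mul_pow _ (√I), Real.sq_sqrt hI]
  exact (pow_le_pow_iff_left₀ (norm_nonneg _)
    (mul_nonneg (mul_nonneg hC0 hd.le) (Real.sqrt_nonneg _)) two_ne_zero).1 hq

end Decay

section Symbols

variable {d : ℕ} {H : Type} [NormedAddCommGroup H] [InnerProductSpace ℂ H] [CompleteSpace H]
  [TopologicalSpace.SeparableSpace H]

theorem memLp_of_continuous_of_bound {m : Space d → ℂ} (hm : Continuous m) {C : ℝ}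
    (h : ∀ ξ, ‖m ξ‖ ≤ C) : MemLp m ∞ volume :=
  memLp_top_of_bound hm.aestronglyMeasurable C (.of_forall h)

/-- Superposition of the operators `A† m(D) V l(D) A`, with `V = v₁ v̄₂`. Each is the integral over
`κ` of the rank one operators `|A† m(D) e_κ v₁⟩⟨A† l(D)* e_κ v₂|`, which is absolutely convergent by
hypothesis. -/
theorem hasFormTrace_symbols (A : H →L[ℂ] L2 d) {α : Space d → ℂ} (hα : MemLp α ∞ volume)
    (hA : ∀ f, A (A.adjoint f) = multiplier α hα f)
    {v₁ v₂ V : Space d → ℂ} (hV : MemLp V ∞ volume) (h1 : MemLp v₁ 2 volume)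
    (h1' : MemLp v₁ ∞ volume) (h1i : Integrable v₁) (h2 : MemLp v₂ 2 volume)
    (h2' : MemLp v₂ ∞ volume) (h2i : Integrable v₂)
    (h : ∀ᵐ x, V x = v₁ x * (starRingEnd ℂ) (v₂ x)) {ν : Measure ℝ} [IsFiniteMeasure ν]
    {m l : ℝ → Space d → ℂ} (hmc : Continuous (Function.uncurry m))
    (hlc : Continuous (Function.uncurry l)) {C : ℝ} (hmC : ∀ σ ξ, ‖m σ ξ‖ ≤ C)
    (hlC : ∀ σ ξ, ‖l σ ξ‖ ≤ C) (hm : ∀ σ, MemLp (m σ) ∞ volume) (hl : ∀ σ, MemLp (l σ) ∞ volume)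
    (hdecay : ∀ σ κ, ‖multiplier (m σ) (hm σ) (modOp κ (h1.toLp v₁))‖ *
      ‖multiplier _ (memLp_conj (hl σ)) (modOp κ (h2.toLp v₂))‖ ≤ C * decayRate κ)
    (hml : ∀ σ ξ, ‖m σ ξ * l σ ξ‖ ≤ C * decayRate ξ) :
    HasFormTrace (fun u z => ∫ σ, inner ℂ (A u)
        (multiplier (m σ) (hm σ) (mulOp V hV (multiplier (l σ) (hl σ) (A z)))) ∂ν)
      ((∫ x, V x) * ∫ σ, (∫ ξ, α ξ * (m σ ξ * l σ ξ)) ∂ν) := by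
  set s : ℝ × Space d → H := fun p =>
    A.adjoint (multiplier (m p.1) (hm p.1) (modOp p.2 (h1.toLp v₁))) with hs
  set r : ℝ × Space d → H := fun p =>
    A.adjoint (multiplier _ (memLp_conj (hl p.1)) (modOp p.2 (h2.toLp v₂))) with hr
  have hsc : Continuous s := by
    refine A.adjoint.continuous.comp (continuous_multiplier (fun p : ℝ × Space d => m p.1) _
      (fun ξ => ?_) (fun _ => ⟨C, .of_forall fun p ξ => hmC p.1 ξ⟩)
      ((continuous_modOp _).comp continuous_snd))
    exact hmc.comp (by fun_prop : Continuous fun p : ℝ × Space d => (p.1, ξ))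
  have hrc : Continuous r := by
    refine A.adjoint.continuous.comp (continuous_multiplier
      (fun (p : ℝ × Space d) ξ => (starRingEnd ℂ) (l p.1 ξ)) _
      (fun ξ => ?_) (fun _ => ⟨C, .of_forall fun p ξ => ?_⟩)
      ((continuous_modOp _).comp continuous_snd))
    · exact Complex.continuous_conj.comp
        (hlc.comp (by fun_prop : Continuous fun p : ℝ × Space d => (p.1, ξ)))
    · rw [RCLike.norm_conj]; exact hlC _ _
  have hrs : Integrable (fun p => ‖r p‖ * ‖s p‖) (ν.prod volume) := by
    have h0 : Integrable (fun p : ℝ × Space d => (‖A.adjoint‖ ^ 2 * C) * decayRate p.2)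
      (ν.prod volume) := (integrable_const _).mul_prod integrable_decayRate
    refine h0.mono' (hrc.norm.mul hsc.norm).aestronglyMeasurable (.of_forall fun p => ?_)
    rw [Real.norm_of_nonneg (by positivity)]
    calc ‖r p‖ * ‖s p‖
        ≤ (‖A.adjoint‖ * ‖multiplier _ (memLp_conj (hl p.1)) (modOp p.2 (h2.toLp v₂))‖) *
          (‖A.adjoint‖ * ‖multiplier (m p.1) (hm p.1) (modOp p.2 (h1.toLp v₁))‖) := by
          gcongr <;> exact ContinuousLinearMap.le_opNorm _ _
      _ = ‖A.adjoint‖ ^ 2 * (‖multiplier (m p.1) (hm p.1) (modOp p.2 (h1.toLp v₁))‖ *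
          ‖multiplier _ (memLp_conj (hl p.1)) (modOp p.2 (h2.toLp v₂))‖) := by ring
      _ ≤ ‖A.adjoint‖ ^ 2 * (C * decayRate p.2) :=
          mul_le_mul_of_nonneg_left (hdecay _ _) (by positivity)
      _ = _ := by ring
  have hrm : AEStronglyMeasurable r (ν.prod volume) := hrc.aestronglyMeasurable
  have hsm : AEStronglyMeasurable s (ν.prod volume) := hsc.aestronglyMeasurable
  have : Fact ((2 : ℝ≥0∞) ≠ ∞) := ⟨by norm_num⟩
  have key := hasFormTrace_integral hrm hsm hrs
  have hform : ∀ u z, ∫ p, inner ℂ (r p) z * inner ℂ u (s p) ∂(ν.prod volume) =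
      ∫ σ, inner ℂ (A u)
        (multiplier (m σ) (hm σ) (mulOp V hV (multiplier (l σ) (hl σ) (A z)))) ∂ν := by
    intro u z
    rw [integral_prod _ (integrable_inner_mul_inner hrm hsm hrs u z)]
    refine integral_congr_ae (.of_forall fun σ => ?_)
    have e1 : inner ℂ (A u)
        (multiplier (m σ) (hm σ) (mulOp V hV (multiplier (l σ) (hl σ) (A z)))) =
        inner ℂ (multiplier _ (memLp_conj (hm σ)) (A u))
          (mulOp V hV (multiplier (l σ) (hl σ) (A z))) := by
      rw [inner_multiplier_left]; simp only [Complex.conj_conj]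
    beta_reduce
    rw [e1, inner_mulOp_eq_integral hV h1 h1' h2 h2' h]
    refine integral_congr_ae (.of_forall fun κ => ?_)
    simp only [hr, hs]
    rw [A.adjoint_inner_left, A.adjoint_inner_right, inner_multiplier_left, inner_multiplier_left,
      mul_comm]
    simp only [Complex.conj_conj]
  have htrace : ∫ p, inner ℂ (r p) (s p) ∂(ν.prod volume) =
      (∫ x, V x) * ∫ σ, (∫ ξ, α ξ * (m σ ξ * l σ ξ)) ∂ν := by
    have hi : Integrable (fun p => inner ℂ (r p) (s p)) (ν.prod volume) :=
      hrs.mono' (hrc.inner hsc).aestronglyMeasurable (.of_forall fun p => norm_inner_le_norm _ _)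
    rw [integral_prod _ hi, ← integral_const_mul]
    refine integral_congr_ae (.of_forall fun σ => ?_)
    have hml' : MemLp (fun ξ => m σ ξ * l σ ξ) ∞ volume := (hl σ).mul (hm σ)
    have hM : MemLp (fun ξ => α ξ * (m σ ξ * l σ ξ)) ∞ volume := hml'.mul hα
    have hmli : Integrable (fun ξ => m σ ξ * l σ ξ) :=
      ((integrable_decayRate (d := d)).const_mul C).mono' hml'.1 (.of_forall fun ξ => hml σ ξ)
    have hMi : Integrable (fun ξ => α ξ * (m σ ξ * l σ ξ)) :=
      memLp_one_iff_integrable.1 ((memLp_one_iff_integrable.2 hmli).mul hα)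
    have := integral_inner_modOp_multiplier h1 h1i h2 h2i hM hMi
    rw [← integral_congr_ae h] at this
    beta_reduce
    rw [← this]
    refine integral_congr_ae (.of_forall fun κ => ?_)
    simp only [hr, hs]
    rw [A.adjoint_inner_left, hA, inner_multiplier_left]
    simp only [Complex.conj_conj]
    have hαm : MemLp (fun ξ => α ξ * m σ ξ) ∞ volume := (hm σ).mul hα
    have hlαm : MemLp (fun ξ => l σ ξ * (α ξ * m σ ξ)) ∞ volume := hαm.mul (hl σ)
    rw [multiplier_multiplier _ _ _ _ hαm]
    refine congrArg _ ((multiplier_multiplier _ _ (hl σ) hαm hlαm _).trans ?_)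
    refine multiplier_apply_congr _ _ _ _ (.of_forall fun ξ => ?_)
    ring
  rw [htrace] at key
  simpa only [hform] using key

theorem exists_schwartzMap_eq_one {K : Set (Space d)} (hK : IsCompact K) :
    ∃ χ : SchwartzMap (Space d) ℂ, ∀ x ∈ K, χ x = 1 := by
  obtain ⟨r, hr⟩ := hK.isBounded.subset_closedBall (0 : Space d)
  let f : ContDiffBump (0 : Space d) := ⟨max r 1, max r 1 + 1, by positivity, by linarith⟩
  have hf : HasCompactSupport fun x => (f x : ℂ) :=
    f.hasCompactSupport.comp_left (g := ((↑) : ℝ → ℂ)) Complex.ofReal_zero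
  have hs : ContDiff ℝ (⊤ : ℕ∞) fun x => (f x : ℂ) := Complex.ofRealCLM.contDiff.comp f.contDiff
  refine ⟨hf.toSchwartzMap hs, fun x hx => ?_⟩
  have h1 : f x = 1 := f.one_of_mem_closedBall (Metric.closedBall_subset_closedBall
    (le_max_left r 1) (hr hx))
  rw [HasCompactSupport.toSchwartzMap_toFun, h1, Complex.ofReal_one]

/-- Superposition of the operators `A† m(D) V l(D) A` for a bounded compactly supported potential,
when one of the two families of symbols decays. -/
theorem hasFormTrace_of_decay (A : H →L[ℂ] L2 d) {α : Space d → ℂ} (hα : MemLp α ∞ volume)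
    (hA : ∀ f, A (A.adjoint f) = multiplier α hα f) {V : Space d → ℂ} (hV : MemLp V ∞ volume)
    (hVc : ∃ K : Set (Space d), IsCompact K ∧ ∀ᵐ x, x ∉ K → V x = 0)
    (ν : Measure ℝ) [IsFiniteMeasure ν] {m l : ℝ → Space d → ℂ}
    (hmc : Continuous (Function.uncurry m)) (hlc : Continuous (Function.uncurry l)) {C : ℝ}
    (hdecay : (∀ σ ξ, ‖m σ ξ‖ ≤ C * decayRate ξ ∧ ‖l σ ξ‖ ≤ C) ∨
      (∀ σ ξ, ‖m σ ξ‖ ≤ C ∧ ‖l σ ξ‖ ≤ C * decayRate ξ))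
    (hm : ∀ σ, MemLp (m σ) ∞ volume) (hl : ∀ σ, MemLp (l σ) ∞ volume) :
    HasFormTrace (fun u z => ∫ σ, inner ℂ (A u)
        (multiplier (m σ) (hm σ) (mulOp V hV (multiplier (l σ) (hl σ) (A z)))) ∂ν)
      ((∫ x, V x) * ∫ σ, (∫ ξ, α ξ * (m σ ξ * l σ ξ)) ∂ν) := by
  obtain ⟨K, hK, hVK⟩ := hVc
  obtain ⟨χ, hχ⟩ := exists_schwartzMap_eq_one hK
  have hχ2 := χ.memLp 2 (μ := volume)
  have hχt := χ.memLp ∞ (μ := volume)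
  have hV1 : MemLp V 1 volume := by
    have h0 : MemLp (fun x => V x * χ x) 1 volume := (χ.memLp 1).mul hV
    refine h0.ae_eq ?_
    filter_upwards [hVK] with x hx
    by_cases hxK : x ∈ K
    · rw [hχ x hxK, mul_one]
    · rw [hx hxK, zero_mul]
  have hV2 : MemLp V 2 volume := by
    have h0 : MemLp (fun x => V x * χ x) 2 volume := hχ2.mul hV
    refine h0.ae_eq ?_
    filter_upwards [hVK] with x hx
    by_cases hxK : x ∈ K
    · rw [hχ x hxK, mul_one]
    · rw [hx hxK, zero_mul]
  obtain ⟨B, hB, hχB⟩ := norm_multiplier_modOp_le χ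
  have hC : 0 ≤ C := by
    rcases hdecay with h | h
    · exact (norm_nonneg _).trans (h 0 0).2
    · exact (norm_nonneg _).trans (h 0 0).1
  have hd1 : ∀ ξ : Space d, C * decayRate ξ ≤ C := fun ξ =>
    mul_le_of_le_one_right hC (decayRate_le_one ξ)
  set C' := C + C ^ 2 + C * B * (C * ‖hV2.toLp V‖) +
    C * ‖(memLp_conj hV2).toLp _‖ * (C * B) with hC'
  have h0a : 0 ≤ C * B * (C * ‖hV2.toLp V‖) := by positivity
  have h0b : 0 ≤ C * ‖(memLp_conj hV2).toLp _‖ * (C * B) := by positivity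
  have hCC' : C ≤ C' := by nlinarith [sq_nonneg C]
  have hml : ∀ σ ξ, ‖m σ ξ * l σ ξ‖ ≤ C' * decayRate ξ := fun σ ξ => by
    have hd := decayRate_pos ξ
    have : ‖m σ ξ * l σ ξ‖ ≤ C ^ 2 * decayRate ξ := by
      rw [norm_mul]
      rcases hdecay with h | h
      · calc _ ≤ (C * decayRate ξ) * C := by gcongr <;> simp [h σ ξ]
          _ = _ := by ring
      · calc _ ≤ C * (C * decayRate ξ) := by gcongr <;> simp [h σ ξ]
          _ = _ := by ring
    refine this.trans ?_
    gcongr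
    nlinarith
  have hmC : ∀ σ ξ, ‖m σ ξ‖ ≤ C := fun σ ξ => by
    rcases hdecay with h | h
    · exact (h σ ξ).1.trans (hd1 ξ)
    · exact (h σ ξ).1
  have hlC : ∀ σ ξ, ‖l σ ξ‖ ≤ C := fun σ ξ => by
    rcases hdecay with h | h
    · exact (h σ ξ).2
    · exact (h σ ξ).2.trans (hd1 ξ)
  have hlC' : ∀ σ ξ, ‖(starRingEnd ℂ) (l σ ξ)‖ ≤ C := fun σ ξ => by
    rw [RCLike.norm_conj]; exact hlC σ ξ
  have hb : ∀ {n : Space d → ℂ} (hn : MemLp n ∞ volume) (_ : ∀ ξ, ‖n ξ‖ ≤ C) (κ) (v : L2 d),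
      ‖multiplier n hn (modOp κ v)‖ ≤ C * ‖v‖ := fun hn h κ v =>
    (norm_multiplier_le hn (.of_forall h) _).trans
      (mul_le_mul_of_nonneg_left (norm_modOp_le κ v) hC)
  rcases hdecay with h | h
  · refine hasFormTrace_symbols A hα hA hV hχ2 hχt χ.integrable (memLp_conj hV2) (memLp_conj hV)
      (memLp_one_iff_integrable.1 (memLp_conj hV1)) ?_ hmc hlc (C := C')
      (fun σ ξ => (hmC σ ξ).trans hCC') (fun σ ξ => (hlC σ ξ).trans hCC') hm hl
      (fun σ κ => ?_) hml
    · filter_upwards [hVK] with x hx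
      rw [Complex.conj_conj]
      by_cases hxK : x ∈ K
      · rw [hχ x hxK, one_mul]
      · rw [hx hxK, mul_zero]
    · have hd := decayRate_pos κ
      calc _ ≤ (C * B * decayRate κ) * (C * ‖(memLp_conj hV2).toLp _‖) := by
            gcongr
            · exact hχB _ (hm σ) C (fun ξ => (h σ ξ).1) κ
            · exact hb _ (hlC' σ) κ _
        _ = C * ‖(memLp_conj hV2).toLp _‖ * (C * B) * decayRate κ := by ring
        _ ≤ C' * decayRate κ := by gcongr; nlinarith
  · refine hasFormTrace_symbols A hα hA hV hV2 hV (memLp_one_iff_integrable.1 hV1) hχ2 hχt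
      χ.integrable ?_ hmc hlc (C := C')
      (fun σ ξ => (hmC σ ξ).trans hCC') (fun σ ξ => (hlC σ ξ).trans hCC') hm hl
      (fun σ κ => ?_) hml
    · filter_upwards [hVK] with x hx
      by_cases hxK : x ∈ K
      · rw [hχ x hxK, map_one, mul_one]
      · rw [hx hxK, zero_mul]
    · have hd := decayRate_pos κ
      calc _ ≤ (C * ‖hV2.toLp V‖) * (C * B * decayRate κ) := by
            gcongr
            · exact hb _ (hmC σ) κ _
            · exact hχB _ (memLp_conj (hl σ)) C
                (fun ξ => by rw [RCLike.norm_conj]; exact (h σ ξ).2) κ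
        _ = C * B * (C * ‖hV2.toLp V‖) * decayRate κ := by ring
        _ ≤ C' * decayRate κ := by gcongr; nlinarith

end Symbols

/-! ### Test functions and their half-line transforms -/

section TestFunction

/-- `φ` is an even smooth function supported in `(-R, R)`. -/
structure IsTest (R : ℝ) (φ : ℝ → ℂ) : Prop where
  smooth : ContDiff ℝ (⊤ : ℕ∞) φ
  even : ∀ t, φ (-t) = φ t
  supp : tsupport φ ⊆ Ioo (-R) R

theorem exists_isTest {φ : ℝ → ℂ} (hφ : ContDiff ℝ (⊤ : ℕ∞) φ) (hφc : HasCompactSupport φ)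
    (hφe : ∀ t, φ (-t) = φ t) : ∃ R, 0 < R ∧ IsTest R φ := by
  obtain ⟨r, hr⟩ := hφc.isBounded.subset_closedBall (0 : ℝ)
  refine ⟨max r 0 + 1, by positivity, hφ, hφe, hr.trans fun t ht => ?_⟩
  rw [Metric.mem_closedBall, dist_zero_right, Real.norm_eq_abs, abs_le] at ht
  have := le_max_left r 0
  constructor <;> linarith [ht.1, ht.2]

variable {R : ℝ} {φ : ℝ → ℂ}

theorem IsTest.hasCompactSupport (h : IsTest R φ) : HasCompactSupport φ :=
  (isCompact_Icc (a := -R) (b := R)).of_isClosed_subset (isClosed_tsupport φ)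
    (h.supp.trans Ioo_subset_Icc_self)

theorem IsTest.eq_zero (h : IsTest R φ) {t : ℝ} (ht : R ≤ t) : φ t = 0 :=
  image_eq_zero_of_notMem_tsupport fun h' => absurd (h.supp h').2 (not_lt.2 ht)

theorem IsTest.differentiable (h : IsTest R φ) : Differentiable ℝ φ :=
  h.smooth.differentiable (by simp)

theorem IsTest.continuous (h : IsTest R φ) : Continuous φ := h.smooth.continuous

theorem IsTest.smooth_deriv (h : IsTest R φ) : ContDiff ℝ (⊤ : ℕ∞) (deriv φ) :=
  (contDiff_infty_iff_deriv.1 h.smooth).2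

theorem IsTest.deriv_neg (h : IsTest R φ) (t : ℝ) : deriv φ (-t) = -deriv φ t := by
  have h1 : φ = fun t => φ (-t) := funext fun t => (h.even t).symm
  conv_rhs => rw [h1]
  rw [deriv_comp_neg, neg_neg]

theorem IsTest.deriv_zero (h : IsTest R φ) : deriv φ 0 = 0 := by
  have := h.deriv_neg 0
  rw [neg_zero] at this
  exact self_eq_neg.1 this

theorem IsTest.deriv_eq_zero (h : IsTest R φ) {t : ℝ} (ht : R ≤ t) : deriv φ t = 0 :=
  image_eq_zero_of_notMem_tsupport fun h' =>
    absurd (h.supp (tsupport_deriv_subset (𝕜 := ℝ) h')).2 (not_lt.2 ht)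

/-- The operator `1 - ∂_t²`. -/
def oneSubDeriv2 (φ : ℝ → ℂ) : ℝ → ℂ := fun t => φ t - deriv (deriv φ) t

theorem IsTest.oneSubDeriv2 (h : IsTest R φ) : IsTest R (oneSubDeriv2 φ) where
  smooth := h.smooth.sub (contDiff_infty_iff_deriv.1 h.smooth_deriv).2
  even t := by
    have h1 : deriv φ = fun t => -deriv φ (-t) := funext fun t => by rw [h.deriv_neg, neg_neg]
    have h2 : deriv (deriv φ) (-t) = deriv (deriv φ) t := by
      conv_rhs => rw [h1]
      rw [deriv.fun_neg, deriv_comp_neg, neg_neg]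
    simp only [WaveTrace.oneSubDeriv2, h.even, h2]
  supp := by
    refine subset_trans ?_ h.supp
    refine (tsupport_sub φ (deriv (deriv φ))).trans (union_subset subset_rfl ?_)
    exact (tsupport_deriv_subset (𝕜 := ℝ)).trans (tsupport_deriv_subset (𝕜 := ℝ))

theorem IsTest.iterate (h : IsTest R φ) (n : ℕ) : IsTest R (WaveTrace.oneSubDeriv2^[n] φ) := by
  induction n generalizing φ with
  | zero => exact h
  | succ n ih => exact ih h.oneSubDeriv2

end TestFunction

/-! ### The symbols and their expansion in powers of `(1 + |D|²)⁻¹` -/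

section Symbol

variable {d : ℕ} {R : ℝ} {φ : ℝ → ℂ}

/-- The symbol `1 + |D|²`. -/
def weight (ξ : Space d) : ℝ := 1 + absSymbol ξ ^ 2

theorem one_le_weight (ξ : Space d) : 1 ≤ weight ξ := by
  unfold weight
  nlinarith [sq_nonneg (absSymbol ξ)]

theorem weight_ne_zero (ξ : Space d) : (weight ξ : ℂ) ≠ 0 := by
  have := one_le_weight ξ
  exact_mod_cast (by linarith : weight ξ ≠ 0)

theorem continuous_weight : Continuous (weight (d := d)) :=
  continuous_const.add (continuous_absSymbol.pow 2)

/-- The symbol `∫₀^∞ φ(u + s) |D|⁻¹ sin (u|D|) du`. The integral is cut off at `R`, which changes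
nothing for `s ≥ 0` when `φ` vanishes on `[R, ∞)`. -/
def tailSymbol (R : ℝ) (φ : ℝ → ℂ) (s : ℝ) (ξ : Space d) : ℂ :=
  ∫ u in (0 : ℝ)..R, φ (u + s) * sincSymbol u ξ

/-- The symbol `∫₀^∞ φ(s) cos (s|D|) ds`, for `φ` vanishing on `[R, ∞)`. -/
def cosTransform (R : ℝ) (φ : ℝ → ℂ) (ξ : Space d) : ℂ :=
  ∫ s in (0 : ℝ)..R, φ s * cosSymbol s ξ

theorem hasDerivAt_sincSymbol (ξ : Space d) (u : ℝ) :
    HasDerivAt (fun u => sincSymbol u ξ) (cosSymbol u ξ) u := by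
  unfold sincSymbol cosSymbol
  refine HasDerivAt.ofReal_comp ?_
  by_cases ha : absSymbol ξ = 0
  · simpa [ha] using hasDerivAt_id' u
  have e : (fun u : ℝ => u * Real.sinc (u * absSymbol ξ)) =
      fun u => Real.sin (u * absSymbol ξ) / absSymbol ξ := by
    funext u
    by_cases hu : u = 0
    · simp [hu]
    · rw [Real.sinc_of_ne_zero (mul_ne_zero hu ha)]; field_simp
  rw [e]
  have := (((hasDerivAt_id' u).mul_const (absSymbol ξ)).sin).div_const (absSymbol ξ)
  simpa [ha] using this

theorem hasDerivAt_cosSymbol (ξ : Space d) (u : ℝ) :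
    HasDerivAt (fun u => cosSymbol u ξ) (-(absSymbol ξ : ℂ) ^ 2 * sincSymbol u ξ) u := by
  have e : -(absSymbol ξ : ℂ) ^ 2 * sincSymbol u ξ =
      ((-Real.sin (u * absSymbol ξ) * absSymbol ξ : ℝ) : ℂ) := by
    have := absSymbol_mul_sincSymbol u ξ
    unfold sinSymbol at this
    push_cast at this ⊢
    linear_combination (-(absSymbol ξ : ℂ)) * this
  rw [e]
  unfold cosSymbol
  refine HasDerivAt.ofReal_comp ?_
  simpa using ((hasDerivAt_id' u).mul_const (absSymbol ξ)).cos

theorem continuous_sincSymbol : Continuous fun p : ℝ × Space d => sincSymbol p.1 p.2 := by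
  unfold sincSymbol
  have := Real.continuous_sinc
  have := continuous_absSymbol (d := d)
  fun_prop

theorem continuous_cosSymbol : Continuous fun p : ℝ × Space d => cosSymbol p.1 p.2 := by
  unfold cosSymbol
  have := continuous_absSymbol (d := d)
  fun_prop

theorem continuous_sinSymbol : Continuous fun p : ℝ × Space d => sinSymbol p.1 p.2 := by
  unfold sinSymbol
  have := continuous_absSymbol (d := d)
  fun_prop

theorem norm_cosSymbol_le (t : ℝ) (ξ : Space d) : ‖cosSymbol t ξ‖ ≤ 1 := by
  rw [cosSymbol, Complex.norm_real]; exact Real.abs_cos_le_one _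

theorem norm_sinSymbol_le (t : ℝ) (ξ : Space d) : ‖sinSymbol t ξ‖ ≤ 1 := by
  rw [sinSymbol, Complex.norm_real]; exact Real.abs_sin_le_one _

theorem norm_sincSymbol_le (t : ℝ) (ξ : Space d) : ‖sincSymbol t ξ‖ ≤ |t| := by
  rw [sincSymbol, Complex.norm_real, Real.norm_eq_abs, abs_mul]
  exact mul_le_of_le_one_right (abs_nonneg t) (Real.abs_sinc_le_one _)

@[simp] theorem sincSymbol_zero (ξ : Space d) : sincSymbol 0 ξ = 0 := by simp [sincSymbol]

@[simp] theorem cosSymbol_zero (ξ : Space d) : cosSymbol 0 ξ = 1 := by simp [cosSymbol]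

/-- Two integrations by parts: `y(u) = |D|⁻¹ sin (u|D|)` solves `y'' + |D|² y = 0` with `y(0) = 0`
and `y'(0) = 1`, so that the boundary term is `φ(s)`. -/
theorem weight_mul_tailSymbol (h : IsTest R φ) {s : ℝ} (hs : 0 ≤ s) (ξ : Space d) :
    (weight ξ : ℂ) * tailSymbol R φ s ξ = tailSymbol R (oneSubDeriv2 φ) s ξ + φ s := by
  have hφ1 : ∀ u, HasDerivAt (fun u => φ (u + s)) (deriv φ (u + s)) u := fun u =>
    (h.differentiable (u + s)).hasDerivAt.comp_add_const u s
  have hφ2 : ∀ u, HasDerivAt (fun u => deriv φ (u + s)) (deriv (deriv φ) (u + s)) u := fun u =>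
    ((h.smooth_deriv.differentiable (by simp)) (u + s)).hasDerivAt.comp_add_const u s
  have c0 := h.continuous
  have c1 := h.smooth_deriv.continuous
  have c2 : Continuous (deriv (deriv φ)) := (contDiff_infty_iff_deriv.1 h.smooth_deriv).2.continuous
  have cs : Continuous fun u => sincSymbol u ξ :=
    continuous_sincSymbol.comp (by fun_prop : Continuous fun u : ℝ => (u, ξ))
  have key := intervalIntegral.integral_eq_sub_of_hasDerivAt (a := 0) (b := R)
    (f := fun u => φ (u + s) * cosSymbol u ξ - deriv φ (u + s) * sincSymbol u ξ)
    (f' := fun u => -(absSymbol ξ : ℂ) ^ 2 * (φ (u + s) * sincSymbol u ξ) -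
      deriv (deriv φ) (u + s) * sincSymbol u ξ)
    (fun u _ => by
      refine (((hφ1 u).mul (hasDerivAt_cosSymbol ξ u)).sub
        ((hφ2 u).mul (hasDerivAt_sincSymbol ξ u))).congr_deriv ?_
      ring) (Continuous.intervalIntegrable (by fun_prop) _ _)
  rw [h.eq_zero (by linarith : R ≤ R + s), h.deriv_eq_zero (by linarith : R ≤ R + s)] at key
  simp only [sincSymbol_zero, cosSymbol_zero, zero_add, zero_mul, mul_zero, mul_one, sub_zero,
    zero_sub] at key
  rw [intervalIntegral.integral_sub (Continuous.intervalIntegrable (by fun_prop) _ _)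
    (Continuous.intervalIntegrable (by fun_prop) _ _), intervalIntegral.integral_const_mul] at key
  have e : tailSymbol R (oneSubDeriv2 φ) s ξ = (∫ u in (0 : ℝ)..R, φ (u + s) * sincSymbol u ξ) -
      ∫ u in (0 : ℝ)..R, deriv (deriv φ) (u + s) * sincSymbol u ξ := by
    rw [← intervalIntegral.integral_sub (Continuous.intervalIntegrable (by fun_prop) _ _)
      (Continuous.intervalIntegrable (by fun_prop) _ _)]
    simp only [tailSymbol, oneSubDeriv2, sub_mul]
  rw [e, tailSymbol, weight]
  push_cast
  linear_combination -key

/-- Two integrations by parts; the boundary terms at `0` vanish because `φ` is even. -/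
theorem weight_mul_cosTransform (h : IsTest R φ) (ξ : Space d) :
    (weight ξ : ℂ) * cosTransform R φ ξ = cosTransform R (oneSubDeriv2 φ) ξ := by
  have hφ1 : ∀ u, HasDerivAt φ (deriv φ u) u := fun u => (h.differentiable u).hasDerivAt
  have hφ2 : ∀ u, HasDerivAt (deriv φ) (deriv (deriv φ) u) u := fun u =>
    ((h.smooth_deriv.differentiable (by simp)) u).hasDerivAt
  have c0 := h.continuous
  have c1 := h.smooth_deriv.continuous
  have c2 : Continuous (deriv (deriv φ)) := (contDiff_infty_iff_deriv.1 h.smooth_deriv).2.continuous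
  have cs : Continuous fun u => cosSymbol u ξ :=
    continuous_cosSymbol.comp (by fun_prop : Continuous fun u : ℝ => (u, ξ))
  have key := intervalIntegral.integral_eq_sub_of_hasDerivAt (a := 0) (b := R)
    (f := fun u => deriv φ u * cosSymbol u ξ + (absSymbol ξ : ℂ) ^ 2 * (φ u * sincSymbol u ξ))
    (f' := fun u => deriv (deriv φ) u * cosSymbol u ξ +
      (absSymbol ξ : ℂ) ^ 2 * (φ u * cosSymbol u ξ))
    (fun u _ => by
      refine (((hφ2 u).mul (hasDerivAt_cosSymbol ξ u)).add
        (((hφ1 u).mul (hasDerivAt_sincSymbol ξ u)).const_mul _)).congr_deriv ?_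
      ring) (Continuous.intervalIntegrable (by fun_prop) _ _)
  simp only [h.eq_zero le_rfl, h.deriv_eq_zero le_rfl, h.deriv_zero, sincSymbol_zero,
    zero_mul, mul_zero, sub_zero, add_zero] at key
  rw [intervalIntegral.integral_add (Continuous.intervalIntegrable (by fun_prop) _ _)
    (Continuous.intervalIntegrable (by fun_prop) _ _), intervalIntegral.integral_const_mul] at key
  have e : cosTransform R (oneSubDeriv2 φ) ξ = (∫ u in (0 : ℝ)..R, φ u * cosSymbol u ξ) -
      ∫ u in (0 : ℝ)..R, deriv (deriv φ) u * cosSymbol u ξ := by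
    rw [← intervalIntegral.integral_sub (Continuous.intervalIntegrable (by fun_prop) _ _)
      (Continuous.intervalIntegrable (by fun_prop) _ _)]
    simp only [cosTransform, oneSubDeriv2, sub_mul]
  rw [e, cosTransform, weight]
  push_cast
  linear_combination key

/-- Expansion of `tailSymbol` in powers of `(1 + |D|²)⁻¹`. The exponent of the remainder is at our
disposal, and the coefficients depend on `s` only through a test function. -/
theorem tailSymbol_eq (h : IsTest R φ) {s : ℝ} (hs : 0 ≤ s) (ξ : Space d) (n : ℕ) :
    tailSymbol R φ s ξ = ((weight ξ : ℂ)⁻¹) ^ n * tailSymbol R (oneSubDeriv2^[n] φ) s ξ +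
      ∑ j ∈ Finset.range n, ((weight ξ : ℂ)⁻¹) ^ (j + 1) * (oneSubDeriv2^[j] φ) s := by
  have hw := weight_ne_zero ξ
  induction n with
  | zero => simp
  | succ n ih =>
    have h1 := weight_mul_tailSymbol (h.iterate n) hs ξ
    have h2 : tailSymbol R (oneSubDeriv2^[n] φ) s ξ = (weight ξ : ℂ)⁻¹ *
        (tailSymbol R (oneSubDeriv2 (oneSubDeriv2^[n] φ)) s ξ + (oneSubDeriv2^[n] φ) s) := by
      rw [← h1, inv_mul_cancel_left₀ hw]
    rw [ih, Finset.sum_range_succ, Function.iterate_succ_apply', h2]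
    ring

/-- As there are no boundary terms, `cosTransform` decays to all orders. -/
theorem cosTransform_eq (h : IsTest R φ) (ξ : Space d) (n : ℕ) :
    cosTransform R φ ξ = ((weight ξ : ℂ)⁻¹) ^ n * cosTransform R (oneSubDeriv2^[n] φ) ξ := by
  have hw := weight_ne_zero ξ
  induction n with
  | zero => simp
  | succ n ih =>
    rw [ih, Function.iterate_succ_apply', ← weight_mul_cosTransform (h.iterate n) ξ, pow_succ,
      mul_assoc, inv_mul_cancel_left₀ hw]

/-- Since `1 + ‖ξ‖ ≤ 2 (1 + |D|²)`, the power `d + 1` of `(1 + |D|²)⁻¹` is integrable. -/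
theorem weight_inv_pow_le (ξ : Space d) :
    ‖((weight ξ : ℂ)⁻¹) ^ (d + 1)‖ ≤ 2 ^ (d + 1) * decayRate ξ := by
  have hw := one_le_weight ξ
  rw [norm_pow, norm_inv, Complex.norm_real, Real.norm_of_nonneg (by linarith), decayRate,
    ← inv_pow, ← mul_pow]
  refine pow_le_pow_left₀ (by positivity) ?_ _
  rw [← div_eq_mul_inv, inv_le_comm₀ (by positivity) (by positivity), inv_div,
    div_le_iff₀ (by norm_num)]
  -- `1 + r ≤ 2 (1 + (2πr)²)`
  have hpi : 1 ≤ 2 * Real.pi := by linarith [Real.pi_gt_three]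
  have h1 : ‖ξ‖ ^ 2 ≤ absSymbol ξ ^ 2 := by
    refine pow_le_pow_left₀ (norm_nonneg _) ?_ 2
    exact le_mul_of_one_le_left (norm_nonneg ξ) hpi
  unfold weight
  nlinarith [sq_nonneg (‖ξ‖ - 1)]

theorem norm_weight_inv_pow_le_one (ξ : Space d) (n : ℕ) : ‖((weight ξ : ℂ)⁻¹) ^ n‖ ≤ 1 := by
  have hw := one_le_weight ξ
  rw [norm_pow, norm_inv, Complex.norm_real, Real.norm_of_nonneg (by linarith)]
  exact pow_le_one₀ (by positivity) (inv_le_one_of_one_le₀ hw)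

theorem continuous_tailSymbol (h : IsTest R φ) :
    Continuous fun p : ℝ × Space d => tailSymbol R φ p.1 p.2 := by
  have c0 := h.continuous
  have cs := continuous_sincSymbol (d := d)
  refine intervalIntegral.continuous_parametric_intervalIntegral_of_continuous'
    (f := fun (p : ℝ × Space d) u => φ (u + p.1) * sincSymbol u p.2) ?_ 0 R
  exact (c0.comp (by fun_prop)).mul
    (cs.comp (by fun_prop : Continuous fun q : (ℝ × Space d) × ℝ => (q.2, q.1.2)))

theorem continuous_cosTransform (h : IsTest R φ) :
    Continuous fun ξ : Space d => cosTransform R φ ξ := by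
  have c0 := h.continuous
  have cs := continuous_cosSymbol (d := d)
  refine intervalIntegral.continuous_parametric_intervalIntegral_of_continuous'
    (f := fun (ξ : Space d) u => φ u * cosSymbol u ξ) ?_ 0 R
  exact (c0.comp (by fun_prop)).mul
    (cs.comp (by fun_prop : Continuous fun q : Space d × ℝ => (q.2, q.1)))

theorem exists_norm_tailSymbol_le (hR : 0 < R) (h : IsTest R φ) :
    ∃ C, ∀ s (ξ : Space d), ‖tailSymbol R φ s ξ‖ ≤ C := by
  obtain ⟨B, hB⟩ := h.hasCompactSupport.exists_bound_of_continuous h.continuous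
  refine ⟨B * R * |R - 0|, fun s ξ => intervalIntegral.norm_integral_le_of_norm_le_const
    fun u hu => ?_⟩
  rw [uIoc_of_le hR.le] at hu
  rw [norm_mul]
  have := (norm_nonneg _).trans (hB 0)
  gcongr
  · exact hB _
  · exact (norm_sincSymbol_le u ξ).trans (by rw [abs_of_pos hu.1]; exact hu.2)

theorem exists_norm_cosTransform_le (h : IsTest R φ) :
    ∃ C, ∀ ξ : Space d, ‖cosTransform R φ ξ‖ ≤ C := by
  obtain ⟨B, hB⟩ := h.hasCompactSupport.exists_bound_of_continuous h.continuous
  refine ⟨B * 1 * |R - 0|, fun ξ => intervalIntegral.norm_integral_le_of_norm_le_const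
    fun u _ => ?_⟩
  rw [norm_mul]
  have := (norm_nonneg _).trans (hB 0)
  gcongr
  · exact hB _
  · exact norm_cosSymbol_le u ξ

theorem exists_norm_cosTransform_le_decayRate (h : IsTest R φ) :
    ∃ C, ∀ ξ : Space d, ‖cosTransform R φ ξ‖ ≤ C * decayRate ξ := by
  obtain ⟨C, hC⟩ := exists_norm_cosTransform_le (d := d) (h.iterate (d + 1))
  refine ⟨C * 2 ^ (d + 1), fun ξ => ?_⟩
  rw [cosTransform_eq h ξ (d + 1), norm_mul]
  calc _ ≤ (2 ^ (d + 1) * decayRate ξ) * C :=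
        mul_le_mul (weight_inv_pow_le ξ) (hC ξ) (norm_nonneg _)
          (mul_nonneg (by positivity) (decayRate_pos ξ).le)
    _ = _ := by ring

end Symbol

/-! ### Strong continuity of the free group and the operator `⟨φ, W₁⟩` -/

section FreeGroup

variable {d : ℕ}

section Continuity

variable {X : Type*} [TopologicalSpace X] [FirstCountableTopology X]

theorem continuous_cosOp {t : X → ℝ} (ht : Continuous t) {f : X → L2 d} (hf : Continuous f) :
    Continuous fun x => cosOp d (t x) (f x) := by
  have hc : ∀ ξ : Space d, Continuous fun x => cosSymbol (t x) ξ := fun ξ => by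
    unfold cosSymbol
    fun_prop
  have hb : ∀ x₀ : X, ∃ M, ∀ᶠ x in nhds x₀, ∀ ξ : Space d, ‖cosSymbol (t x) ξ‖ ≤ M := fun _ =>
    ⟨1, .of_forall fun x ξ => norm_cosSymbol_le (t x) ξ⟩
  exact continuous_multiplier _ (fun x => memLp_cosSymbol d (t x)) hc hb hf

theorem continuous_sinOp {t : X → ℝ} (ht : Continuous t) {f : X → L2 d} (hf : Continuous f) :
    Continuous fun x => sinOp d (t x) (f x) := by
  have hc : ∀ ξ : Space d, Continuous fun x => sinSymbol (t x) ξ := fun ξ => by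
    unfold sinSymbol
    fun_prop
  have hb : ∀ x₀ : X, ∃ M, ∀ᶠ x in nhds x₀, ∀ ξ : Space d, ‖sinSymbol (t x) ξ‖ ≤ M := fun _ =>
    ⟨1, .of_forall fun x ξ => norm_sinSymbol_le (t x) ξ⟩
  exact continuous_multiplier _ (fun x => memLp_sinSymbol d (t x)) hc hb hf

theorem continuous_sincOp {t : X → ℝ} (ht : Continuous t) {f : X → L2 d} (hf : Continuous f) :
    Continuous fun x => sincOp d (t x) (f x) := by
  refine continuous_multiplier (fun x => sincSymbol (t x)) (fun x => memLp_sincSymbol d (t x))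
    (fun ξ => continuous_sincSymbol.comp (ht.prodMk (continuous_const (y := ξ))))
    (fun x₀ => ⟨|t x₀| + 1, ?_⟩) hf
  filter_upwards [(ht.abs.tendsto x₀).eventually (gt_mem_nhds (lt_add_one |t x₀|))] with x hx ξ
  exact (norm_sincSymbol_le (t x) ξ).trans hx.le

theorem continuous_freeGroup {t : X → ℝ} (ht : Continuous t) {F : X → Energy d}
    (hF : Continuous F) : Continuous fun x => freeGroup d (t x) (F x) := by
  have h1 : Continuous fun x => H1.toL2 d (F x).fst :=
    (H1.toL2 d ∘L WithLp.fstL 2 ℂ (H1 d) (L2 d)).continuous.comp hF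
  have h2 : Continuous fun x => H1.absD d (F x).fst :=
    (H1.absD d ∘L WithLp.fstL 2 ℂ (H1 d) (L2 d)).continuous.comp hF
  have h3 : Continuous fun x => (F x).snd := (WithLp.sndL 2 ℂ (H1 d) (L2 d)).continuous.comp hF
  have hpair : ∀ {E E' : Type} [NormedAddCommGroup E] [NormedSpace ℂ E] [NormedAddCommGroup E']
      [NormedSpace ℂ E'] {a : X → E} {b : X → E'}, Continuous a → Continuous b →
      Continuous fun x => (WithLp.prodContinuousLinearEquiv 2 ℂ E E').symm (a x, b x) :=
    fun ha hb => (WithLp.prodContinuousLinearEquiv 2 ℂ _ _).symm.continuous.comp (ha.prodMk hb)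
  have c1 : Continuous fun x => cosH1 d (t x) (F x).fst :=
    (hpair (continuous_cosOp ht h1) (continuous_cosOp ht h2)).subtype_mk _
  have c2 : Continuous fun x => sincH1 d (t x) (F x).snd :=
    (hpair (continuous_sincOp ht h3) (continuous_sinOp ht h3)).subtype_mk _
  exact hpair (c1.add c2) ((continuous_sinOp ht h2).neg.add (continuous_cosOp ht h3))

end Continuity

variable {V : Space d → ℂ} {hV : MemLp V ∞ volume}

theorem continuous_duhamelIntegrand (F : Energy d) :
    Continuous fun p : ℝ × ℝ => duhamelIntegrand V hV p.1 p.2 F :=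
  continuous_freeGroup (by fun_prop) ((potentialOp V hV).continuous.comp
    (continuous_freeGroup continuous_snd continuous_const))

theorem continuous_W1 (F : Energy d) : Continuous fun t => W1 V hV t F :=
  intervalIntegral.continuous_parametric_intervalIntegral_of_continuous
    (f := fun t s => duhamelIntegrand V hV t s F) (continuous_duhamelIntegrand F) continuous_id

theorem exists_isPairingW1 {R : ℝ} (hR : 0 < R) {φ : ℝ → ℂ} (hφ : IsTest R φ) :
    ∃ T : Energy d →L[ℂ] Energy d, IsPairingW1 V hV φ T := by
  have hint : ∀ t F, IntervalIntegrable (fun s => duhamelIntegrand V hV t s F) volume 0 t :=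
    fun t F => ((continuous_duhamelIntegrand F).comp
      (by fun_prop : Continuous fun s : ℝ => (t, s))).intervalIntegrable _ _
  have hint2 : ∀ F, Integrable fun t => φ t • W1 V hV t F := fun F =>
    (hφ.continuous.smul (continuous_W1 F)).integrable_of_hasCompactSupport
      hφ.hasCompactSupport.smul_right
  have hadd : ∀ t F G, W1 V hV t (F + G) = W1 V hV t F + W1 V hV t G := fun t F G => by
    unfold W1
    rw [← intervalIntegral.integral_add (hint t F) (hint t G)]
    simp only [duhamelIntegrand, map_add]
  have hsmul : ∀ t (c : ℂ) F, W1 V hV t (c • F) = c • W1 V hV t F := fun t c F => by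
    unfold W1
    rw [← intervalIntegral.integral_smul]
    simp only [duhamelIntegrand, map_smul]
  let T : Energy d →ₗ[ℂ] Energy d :=
    { toFun := fun F => ∫ t, φ t • W1 V hV t F
      map_add' := fun F G => by
        rw [← integral_add (hint2 F) (hint2 G)]
        simp only [hadd, smul_add]
      map_smul' := fun c F => by
        rw [RingHom.id_apply, ← integral_smul]
        simp only [hsmul, smul_comm c] }
  -- uniform boundedness of `U₀(t - s) 𝐕 U₀(s)` for `|s|, |t| ≤ R`
  obtain ⟨C, hC⟩ := banach_steinhaus (ι := Icc (-R) R ×ˢ Icc (-R) R)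
    (g := fun p => freeGroup d (p.1.1 - p.1.2) ∘L potentialOp V hV ∘L freeGroup d p.1.2)
    (fun F => by
      obtain ⟨C, hC⟩ := (isCompact_Icc.prod isCompact_Icc).exists_bound_of_continuousOn
        (continuous_duhamelIntegrand (V := V) (hV := hV) F).continuousOn
      exact ⟨C, fun p => hC p.1 p.2⟩)
  obtain ⟨B, hB⟩ := hφ.hasCompactSupport.exists_bound_of_continuous hφ.continuous
  refine ⟨T.mkContinuous (B * (|C| * R) * |R - -R|) fun F => ?_, fun F => ⟨fun t => hint t F,
    hint2 F, rfl⟩⟩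
  have hsupp : Function.support (fun t => φ t • W1 V hV t F) ⊆ Ioc (-R) R := fun t ht =>
    Ioo_subset_Ioc_self (hφ.supp (subset_tsupport φ (left_ne_zero_of_smul ht)))
  change ‖∫ t, φ t • W1 V hV t F‖ ≤ _
  rw [← intervalIntegral.integral_eq_integral_of_support_subset hsupp]
  calc _ ≤ B * (|C| * ‖F‖ * R) * |R - -R| := by
        refine intervalIntegral.norm_integral_le_of_norm_le_const fun t ht => ?_
        have htR : |t| ≤ R := by
          rw [uIoc_of_le (by linarith)] at ht
          exact abs_le.2 ⟨ht.1.le, ht.2⟩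
        rw [norm_smul]
        have := (norm_nonneg _).trans (hB 0)
        gcongr
        · exact hB t
        · calc ‖W1 V hV t F‖ ≤ (|C| * ‖F‖) * |t - 0| := by
                refine intervalIntegral.norm_integral_le_of_norm_le_const fun s hs => ?_
                have hs' : |s| ≤ |t| := by
                  have := abs_sub_left_of_mem_uIcc (uIoc_subset_uIcc hs)
                  simpa using this
                have := (hC ⟨(t, s), abs_le.1 htR, abs_le.1 (hs'.trans htR)⟩)
                refine (ContinuousLinearMap.le_of_opNorm_le _ (this.trans (le_abs_self C)) F)
            _ ≤ _ := by gcongr; simpa using htR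
    _ = _ := by ring

end FreeGroup

/-! ### The matrix elements of `⟨φ, W₁⟩` -/

section MatrixElements

theorem inner_smul_intervalIntegral {E : Type*} [NormedAddCommGroup E] [InnerProductSpace ℂ E]
    [CompleteSpace E] (u : E) {f : ℝ → E} {a b : ℝ} (hf : IntervalIntegrable f volume a b)
    (c : ℂ) : inner ℂ u (c • ∫ s in a..b, f s) = c * ∫ s in a..b, inner ℂ u (f s) := by
  rw [inner_smul_right]
  exact congrArg _ ((innerSL ℂ u).intervalIntegral_comp_comm hf).symm

variable {d : ℕ}

/-- The first component `f` of `(f, g) ∈ H¹ × L²`, as an element of `L²`. -/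
def posOp (d : ℕ) : Energy d →L[ℂ] L2 d := H1.toL2 d ∘L WithLp.fstL 2 ℂ (H1 d) (L2 d)

/-- The map `(f, g) ↦ |D| f`. -/
def absPosOp (d : ℕ) : Energy d →L[ℂ] L2 d := H1.absD d ∘L WithLp.fstL 2 ℂ (H1 d) (L2 d)

/-- The second component `g` of `(f, g) ∈ H¹ × L²`. -/
def velOp (d : ℕ) : Energy d →L[ℂ] L2 d := WithLp.sndL 2 ℂ (H1 d) (L2 d)

theorem isAbsD_posOp (u : Energy d) : IsAbsD (posOp d u) (absPosOp d u) := u.fst.2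

theorem inner_energy (u v : Energy d) : inner ℂ u v =
    inner ℂ (posOp d u) (posOp d v) + inner ℂ (absPosOp d u) (absPosOp d v) +
      inner ℂ (velOp d u) (velOp d v) := by
  rw [WithLp.prod_inner_apply, Submodule.coe_inner, WithLp.prod_inner_apply]
  rfl

variable {V : Space d → ℂ} {hV : MemLp V ∞ volume}

theorem inner_duhamelIntegrand (u z : Energy d) (t s : ℝ) :
    inner ℂ u (duhamelIntegrand V hV t s z) =
      inner ℂ (posOp d u) (sincOp d (t - s)
        (mulOp V hV (cosOp d s (posOp d z) + sincOp d s (velOp d z)))) +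
      inner ℂ (absPosOp d u) (sinOp d (t - s)
        (mulOp V hV (cosOp d s (posOp d z) + sincOp d s (velOp d z)))) +
      inner ℂ (velOp d u) (cosOp d (t - s)
        (mulOp V hV (cosOp d s (posOp d z) + sincOp d s (velOp d z)))) := by
  set ψ := mulOp V hV (cosOp d s (posOp d z) + sincOp d s (velOp d z)) with hψ
  have e1 : posOp d (duhamelIntegrand V hV t s z) = cosOp d (t - s) 0 + sincOp d (t - s) ψ := rfl
  have e2 : absPosOp d (duhamelIntegrand V hV t s z) = cosOp d (t - s) 0 + sinOp d (t - s) ψ := rfl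
  have e3 : velOp d (duhamelIntegrand V hV t s z) = -(sinOp d (t - s) 0) + cosOp d (t - s) ψ := rfl
  rw [inner_energy, e1, e2, e3]
  simp only [map_zero, neg_zero, zero_add]

theorem multiplier_neg (m m' : Space d → ℂ) (hm : MemLp m ∞ volume) (hm' : MemLp m' ∞ volume)
    (h : ∀ ξ, m' ξ = -m ξ) (f : L2 d) : multiplier m' hm' f = -multiplier m hm f := by
  refine (fourierL2 d).injective (Lp.ext ?_)
  rw [map_neg]
  filter_upwards [fourier_multiplier_ae m hm f, fourier_multiplier_ae m' hm' f,
    Lp.coeFn_neg (fourierL2 d (multiplier m hm f))] with ξ h1 h2 h3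
  rw [h3, Pi.neg_apply, h1, h2, h, neg_mul]

theorem cosOp_neg (t : ℝ) (f : L2 d) : cosOp d (-t) f = cosOp d t f :=
  multiplier_apply_congr _ _ _ _ (.of_forall fun ξ => by simp [cosSymbol])

theorem sinOp_neg (t : ℝ) (f : L2 d) : sinOp d (-t) f = -sinOp d t f :=
  multiplier_neg _ _ _ _ (fun ξ => by simp [sinSymbol]) f

theorem sincOp_neg (t : ℝ) (f : L2 d) : sincOp d (-t) f = -sincOp d t f :=
  multiplier_neg _ _ _ _ (fun ξ => by simp [sincSymbol]) f

/-- The part of the matrix element `⟨u, U₀(τ) 𝐕 U₀(s) z⟩` that is odd under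
`(τ, s) ↦ (-τ, -s)`. -/
def oddKernel (V : Space d → ℂ) (hV : MemLp V ∞ volume) (u z : Energy d) (τ s : ℝ) : ℂ :=
  (inner ℂ (posOp d u) (sincOp d τ (mulOp V hV (cosOp d s (posOp d z)))) +
    inner ℂ (absPosOp d u) (sinOp d τ (mulOp V hV (cosOp d s (posOp d z))))) +
  inner ℂ (velOp d u) (cosOp d τ (mulOp V hV (sincOp d s (velOp d z))))

/-- Of the four terms of the matrix element, those between position and velocity are even under
`(t, s) ↦ (-t, -s)` and cancel. -/
theorem inner_duhamelIntegrand_sub (u z : Energy d) (t s : ℝ) :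
    inner ℂ u (duhamelIntegrand V hV t s z) - inner ℂ u (duhamelIntegrand V hV (-t) (-s) z) =
      2 * oddKernel V hV u z (t - s) s := by
  have e : -t - -s = -(t - s) := by ring
  simp only [inner_duhamelIntegrand, oddKernel, e, cosOp_neg, sinOp_neg, sincOp_neg, map_add,
    map_neg, inner_add_right, inner_neg_right]
  ring

theorem continuous_oddKernel (u z : Energy d) :
    Continuous fun p : ℝ × ℝ => oddKernel V hV u z p.1 p.2 := by
  have hc : Continuous fun p : ℝ × ℝ => mulOp V hV (cosOp d p.2 (posOp d z)) :=
    (mulOp V hV).continuous.comp (continuous_cosOp continuous_snd continuous_const)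
  have hs : Continuous fun p : ℝ × ℝ => mulOp V hV (sincOp d p.2 (velOp d z)) :=
    (mulOp V hV).continuous.comp (continuous_sincOp continuous_snd continuous_const)
  exact ((continuous_const.inner (continuous_sincOp continuous_fst hc)).add
    (continuous_const.inner (continuous_sinOp continuous_fst hc))).add
    (continuous_const.inner (continuous_cosOp continuous_fst hs))

/-- As `φ` is even, only the odd part of the kernel contributes to `⟨φ, W₁⟩`. -/
theorem inner_pairingW1 {R : ℝ} {φ : ℝ → ℂ} (hφ : IsTest R φ)
    {T : Energy d →L[ℂ] Energy d} (hT : IsPairingW1 V hV φ T) (u z : Energy d) :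
    inner ℂ u (T z) =
      2 * ∫ t in (0 : ℝ)..R, φ t * ∫ s in (0 : ℝ)..t, oddKernel V hV u z (t - s) s := by
  obtain ⟨h1, h2, h3⟩ := hT z
  have hk : Continuous fun p : ℝ × ℝ => inner ℂ u (duhamelIntegrand V hV p.1 p.2 z) :=
    Continuous.inner (𝕜 := ℂ) continuous_const (continuous_duhamelIntegrand z)
  set h : ℝ → ℂ := fun t => φ t * ∫ s in (0 : ℝ)..t, inner ℂ u (duhamelIntegrand V hV t s z)
    with hh
  have hcont : Continuous h := hφ.continuous.mul
    (intervalIntegral.continuous_parametric_intervalIntegral_of_continuous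
      (f := fun t s => inner ℂ u (duhamelIntegrand V hV t s z)) hk continuous_id)
  have e1 : inner ℂ u (T z) = ∫ t, h t := by
    rw [h3, ← integral_inner h2]
    refine integral_congr_ae (.of_forall fun t => ?_)
    exact inner_smul_intervalIntegral u (h1 t) (φ t)
  have hsupp : Function.support h ⊆ Ioc (-R) R := fun t ht =>
    Ioo_subset_Ioc_self (hφ.supp (subset_tsupport φ (left_ne_zero_of_mul ht)))
  rw [e1, ← intervalIntegral.integral_eq_integral_of_support_subset hsupp,
    ← intervalIntegral.integral_add_adjacent_intervals (b := 0) (hcont.intervalIntegrable _ _)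
      (hcont.intervalIntegrable _ _)]
  have e2 : ∫ t in (-R)..0, h t = ∫ t in (0 : ℝ)..R, h (-t) := by
    rw [intervalIntegral.integral_comp_neg, neg_zero]
  have i0 : IntervalIntegrable (fun t => h (-t)) volume 0 R :=
    (hcont.comp continuous_neg).intervalIntegrable _ _
  rw [e2, ← intervalIntegral.integral_add i0 (hcont.intervalIntegrable _ _),
    ← intervalIntegral.integral_const_mul]
  refine intervalIntegral.integral_congr fun t _ => ?_
  have e3 : ∫ s in (0 : ℝ)..(-t), inner ℂ u (duhamelIntegrand V hV (-t) s z) =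
      -∫ s in (0 : ℝ)..t, inner ℂ u (duhamelIntegrand V hV (-t) (-s) z) := by
    rw [intervalIntegral.integral_comp_neg (fun s => inner ℂ u (duhamelIntegrand V hV (-t) s z)),
      neg_zero, intervalIntegral.integral_symm]
  simp only [hh, hφ.even, e3]
  have i1 : IntervalIntegrable (fun s => inner ℂ u (duhamelIntegrand V hV t s z)) volume 0 t :=
    (hk.comp (by fun_prop : Continuous fun s : ℝ => (t, s))).intervalIntegrable _ _
  have i2 : IntervalIntegrable (fun s => inner ℂ u (duhamelIntegrand V hV (-t) (-s) z))
      volume 0 t :=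
    (hk.comp (by fun_prop : Continuous fun s : ℝ => (-t, -s))).intervalIntegrable _ _
  rw [mul_neg, neg_add_eq_sub, ← mul_sub, ← intervalIntegral.integral_sub i1 i2]
  simp only [inner_duhamelIntegrand_sub]
  rw [intervalIntegral.integral_const_mul, mul_left_comm]

end MatrixElements

/-- Integration over the triangle `0 < s < t < R` in the coordinates `(t - s, s)`. -/
theorem integral_triangle {R : ℝ} (hR : 0 < R) {φ : ℝ → ℂ} (hφ : Continuous φ)
    (hφR : ∀ t, R ≤ t → φ t = 0) {K : ℝ → ℝ → ℂ} (hK : Continuous fun p : ℝ × ℝ => K p.1 p.2) :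
    ∫ t in (0 : ℝ)..R, φ t * ∫ s in (0 : ℝ)..t, K (t - s) s =
      ∫ s in (0 : ℝ)..R, ∫ u in (0 : ℝ)..R, φ (u + s) * K u s := by
  set μ : Measure ℝ := volume.restrict (Ioc 0 R) with hμ
  set g : ℝ → ℝ → ℂ := fun t s => φ t * K (t - s) s with hg
  have hgc : Continuous fun p : ℝ × ℝ => g p.1 p.2 := (hφ.comp continuous_fst).mul
    (hK.comp (by fun_prop : Continuous fun p : ℝ × ℝ => (p.1 - p.2, p.2)))
  set S : Set (ℝ × ℝ) := {p | p.2 ≤ p.1} with hS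
  have hSm : MeasurableSet S := measurableSet_le measurable_snd measurable_fst
  have hint : Integrable (Function.uncurry fun t s => S.indicator (fun p => g p.1 p.2) (t, s))
      (μ.prod μ) := by
    refine Integrable.indicator (f := fun p : ℝ × ℝ => g p.1 p.2) ?_ hSm
    rw [hμ, Measure.prod_restrict]
    exact (hgc.continuousOn.integrableOn_compact (isCompact_Icc.prod isCompact_Icc)).mono_set
      (prod_mono Ioc_subset_Icc_self Ioc_subset_Icc_self)
  have hL : ∫ t in (0 : ℝ)..R, φ t * ∫ s in (0 : ℝ)..t, K (t - s) s =
      ∫ t, (∫ s, S.indicator (fun p => g p.1 p.2) (t, s) ∂μ) ∂μ := by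
    rw [intervalIntegral.integral_of_le hR.le]
    refine setIntegral_congr_fun measurableSet_Ioc fun t ht => ?_
    have e : (fun s => S.indicator (fun p => g p.1 p.2) (t, s)) = (Iic t).indicator (g t) := by
      funext s
      simp only [indicator, hS, mem_ofPred_eq, mem_Iic]
    rw [e, hμ, setIntegral_indicator measurableSet_Iic, Ioc_inter_Iic, min_eq_right ht.2,
      ← intervalIntegral.integral_const_mul, intervalIntegral.integral_of_le ht.1.le]
  rw [hL, integral_integral_swap hint, intervalIntegral.integral_of_le hR.le]
  refine setIntegral_congr_fun measurableSet_Ioc fun s hs => ?_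
  have e : (fun t => S.indicator (fun p => g p.1 p.2) (t, s)) =
      (Ici s).indicator (fun t => g t s) := by
    funext t
    simp only [indicator, hS, mem_ofPred_eq, mem_Ici]
  have e2 : Ioc 0 R ∩ Ici s = Icc s R := by
    ext t
    simp only [mem_inter_iff, mem_Ioc, mem_Ici, mem_Icc]
    constructor
    · rintro ⟨⟨_, h2⟩, h3⟩; exact ⟨h3, h2⟩
    · rintro ⟨h1, h2⟩; exact ⟨⟨hs.1.trans_le h1, h2⟩, h1⟩
  have c1 : Continuous fun u => φ (u + s) * K u s :=
    (hφ.comp (by fun_prop)).mul (hK.comp (by fun_prop : Continuous fun u : ℝ => (u, s)))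
  rw [e, hμ, setIntegral_indicator measurableSet_Ici, e2, integral_Icc_eq_integral_Ioc,
    ← intervalIntegral.integral_of_le hs.2,
    ← intervalIntegral.integral_add_adjacent_intervals (a := 0) (b := R - s) (c := R)
      (c1.intervalIntegrable _ _) (c1.intervalIntegrable _ _)]
  have e3 : ∫ u in (R - s)..R, φ (u + s) * K u s = 0 := by
    refine intervalIntegral.integral_zero_ae (.of_forall fun u hu => ?_)
    rw [uIoc_of_le (by linarith [hs.1])] at hu
    rw [hφR _ (by linarith [hu.1]), zero_mul]
  have e4 := intervalIntegral.integral_comp_add_right (fun t => g t s) s (a := 0) (b := R - s)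
  rw [zero_add, sub_add_cancel] at e4
  rw [e3, add_zero, ← e4]
  simp only [hg, add_sub_cancel_right]

/-! ### `⟨φ, W₁⟩` as a sum of nuclear forms -/

section NuclearForm

variable {d : ℕ}

theorem multiplier_add_smul {m k M : Space d → ℂ} {c : ℂ} (hm : MemLp m ∞ volume)
    (hk : MemLp k ∞ volume) (hM : MemLp M ∞ volume) (h : ∀ ξ, M ξ = m ξ + k ξ * c) (f : L2 d) :
    multiplier M hM f = multiplier m hm f + c • multiplier k hk f := by
  refine (fourierL2 d).injective (Lp.ext ?_)
  rw [map_add, map_smul]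
  filter_upwards [fourier_multiplier_ae m hm f, fourier_multiplier_ae k hk f,
    fourier_multiplier_ae M hM f,
    Lp.coeFn_add (fourierL2 d (multiplier m hm f)) (c • fourierL2 d (multiplier k hk f)),
    Lp.coeFn_smul c (fourierL2 d (multiplier k hk f))] with ξ h1 h2 h3 h4 h5
  rw [h4, Pi.add_apply, h5, Pi.smul_apply, h1, h2, h3, h, smul_eq_mul]
  ring

theorem multiplier_add_sum {κ : Type*} (S : Finset κ) {m M : Space d → ℂ}
    {k : κ → Space d → ℂ} {c : κ → ℂ} (hm : MemLp m ∞ volume) (hk : ∀ j, MemLp (k j) ∞ volume)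
    (hM : MemLp M ∞ volume) (h : ∀ ξ, M ξ = m ξ + ∑ j ∈ S, k j ξ * c j) (f : L2 d) :
    multiplier M hM f = multiplier m hm f + ∑ j ∈ S, c j • multiplier (k j) (hk j) f := by
  classical
  induction S using Finset.induction_on generalizing m with
  | empty =>
    rw [Finset.sum_empty, add_zero]
    exact multiplier_apply_congr _ _ _ _ (.of_forall fun ξ => by simp [h])
  | insert a S ha ih =>
    have hm' : MemLp (fun ξ => m ξ + k a ξ * c a) ∞ volume := hm.add ((hk a).mul_const (c a))
    rw [ih hm' fun ξ => by rw [h, Finset.sum_insert ha, add_assoc],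
      multiplier_add_smul hm (hk a) hm' fun _ => rfl, Finset.sum_insert ha, add_assoc]

/-- The two parts of the inner product of `H¹` combine: if `q = |D| p`, a symbol `m'` paired with
`q` acts as the symbol `|D| m'` paired with `p`. -/
theorem inner_multiplier_add_of_isAbsD {p q : L2 d} (hpq : IsAbsD p q) {m m' M : Space d → ℂ}
    (hm : MemLp m ∞ volume) (hm' : MemLp m' ∞ volume) (hM : MemLp M ∞ volume)
    (h : ∀ ξ, M ξ = m ξ + absSymbol ξ * m' ξ) (f : L2 d) :
    inner ℂ p (multiplier m hm f) + inner ℂ q (multiplier m' hm' f) =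
      inner ℂ p (multiplier M hM f) := by
  rw [← (fourierL2 d).inner_map_map, ← (fourierL2 d).inner_map_map q,
    ← (fourierL2 d).inner_map_map p (multiplier M hM f), inner_L2_eq, inner_L2_eq, inner_L2_eq,
    ← integral_add (integrable_conj_mul _ _) (integrable_conj_mul _ _)]
  refine integral_congr_ae ?_
  filter_upwards [hpq, fourier_multiplier_ae m hm f, fourier_multiplier_ae m' hm' f,
    fourier_multiplier_ae M hM f] with ξ h0 h1 h2 h3
  rw [h0, h1, h2, h3, h, map_mul, Complex.conj_ofReal]
  ring

/-- Integration against a test function under the inner product amounts to integration of the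
symbol. -/
theorem integral_mul_inner_multiplier {R : ℝ} (hR : 0 < R) {c : ℝ → ℂ} (hc : Continuous c)
    {m : ℝ → Space d → ℂ} (hmc : Continuous (Function.uncurry m))
    (hm : ∀ s, MemLp (m s) ∞ volume) {b : ℝ → ℝ} (hb : Continuous b)
    (hmb : ∀ s ξ, ‖m s ξ‖ ≤ b s) {M : Space d → ℂ} (hM : MemLp M ∞ volume)
    (hMm : ∀ ξ, M ξ = ∫ s in (0 : ℝ)..R, c s * m s ξ) (B : L2 d →L[ℂ] L2 d) (p q : L2 d) :
    ∫ s in (0 : ℝ)..R, c s * inner ℂ p (B (multiplier (m s) (hm s) q)) =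
      inner ℂ p (B (multiplier M hM q)) := by
  have hcm : ∀ s, MemLp (fun ξ => c s * m s ξ) ∞ volume := fun s => (hm s).const_mul (c s)
  have hM' : M = fun ξ => ∫ s in Ioc (0 : ℝ) R, c s * m s ξ := funext fun ξ => by
    rw [hMm, intervalIntegral.integral_of_le hR.le]
  subst hM'
  have hcc : Continuous (Function.uncurry fun s ξ => c s * m s ξ) :=
    (hc.comp continuous_fst).mul hmc
  have hbi : Integrable (fun s => ‖c s‖ * b s) (volume.restrict (Ioc 0 R)) :=
    ((hc.norm.mul hb).integrableOn_Icc (a := 0) (b := R)).mono_set Ioc_subset_Icc_self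
  have key := (integral_inner_multiplier (ν := volume.restrict (Ioc 0 R))
    (fun s ξ => c s * m s ξ) hcm hcc.aestronglyMeasurable hbi
    (fun s ξ => by rw [norm_mul]; exact mul_le_mul_of_nonneg_left (hmb s ξ) (norm_nonneg _))
    hM (B.adjoint p) q).2
  rw [intervalIntegral.integral_of_le hR.le, ← ContinuousLinearMap.adjoint_inner_left, ← key]
  refine integral_congr_ae (.of_forall fun s => ?_)
  simp only [← ContinuousLinearMap.adjoint_inner_left B, inner_multiplier]
  rw [← integral_const_mul]
  congr 1 with ξ
  ring

theorem intervalIntegral_swap {R : ℝ} (hR : 0 < R) {K : ℝ → ℝ → ℂ}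
    (hK : Continuous fun p : ℝ × ℝ => K p.1 p.2) :
    ∫ s in (0 : ℝ)..R, ∫ u in (0 : ℝ)..R, K s u =
      ∫ u in (0 : ℝ)..R, ∫ s in (0 : ℝ)..R, K s u := by
  simp only [intervalIntegral.integral_of_le hR.le]
  refine integral_integral_swap ?_
  rw [Measure.prod_restrict]
  exact (hK.continuousOn.integrableOn_compact (isCompact_Icc.prod isCompact_Icc)).mono_set
      (prod_mono Ioc_subset_Icc_self Ioc_subset_Icc_self)

theorem memLp_weight_inv_pow (n : ℕ) :
    MemLp (fun ξ : Space d => ((weight ξ : ℂ)⁻¹) ^ n) ∞ volume :=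
  memLp_of_continuous_of_bound
    (((Complex.continuous_ofReal.comp continuous_weight).inv₀ weight_ne_zero).pow n)
    (fun ξ => norm_weight_inv_pow_le_one ξ n)

theorem continuous_weight_inv_pow (n : ℕ) :
    Continuous fun ξ : Space d => ((weight ξ : ℂ)⁻¹) ^ n :=
  ((Complex.continuous_ofReal.comp continuous_weight).inv₀ weight_ne_zero).pow n

theorem continuous_weight_inv_pow_mul_tailSymbol {R : ℝ} {φ : ℝ → ℂ} (h : IsTest R φ) (n : ℕ) :
    Continuous fun p : ℝ × Space d => ((weight p.2 : ℂ)⁻¹) ^ n * tailSymbol R φ p.1 p.2 :=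
  ((continuous_weight_inv_pow n).comp continuous_snd).mul (continuous_tailSymbol h)

theorem exists_norm_weight_inv_pow_mul_tailSymbol_le {R : ℝ} (hR : 0 < R) {φ : ℝ → ℂ}
    (h : IsTest R φ) (n : ℕ) :
    ∃ C, ∀ s (ξ : Space d), ‖((weight ξ : ℂ)⁻¹) ^ n * tailSymbol R φ s ξ‖ ≤ C := by
  obtain ⟨C, hC⟩ := exists_norm_tailSymbol_le (d := d) hR h
  refine ⟨C, fun s ξ => ?_⟩
  rw [norm_mul]
  exact (mul_le_of_le_one_left (norm_nonneg _) (norm_weight_inv_pow_le_one ξ n)).trans (hC s ξ)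

theorem memLp_weight_inv_pow_mul_tailSymbol {R : ℝ} (hR : 0 < R) {φ : ℝ → ℂ} (h : IsTest R φ)
    (n : ℕ) (s : ℝ) :
    MemLp (fun ξ : Space d => ((weight ξ : ℂ)⁻¹) ^ n * tailSymbol R φ s ξ) ∞ volume := by
  obtain ⟨C, hC⟩ := exists_norm_weight_inv_pow_mul_tailSymbol_le (d := d) hR h n
  have h1 : Continuous fun ξ : Space d => tailSymbol R φ s ξ :=
    (continuous_tailSymbol h).comp (Continuous.prodMk_right s)
  have hc : Continuous fun ξ : Space d => ((weight ξ : ℂ)⁻¹) ^ n * tailSymbol R φ s ξ :=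
    (continuous_weight_inv_pow n).mul h1
  exact memLp_of_continuous_of_bound hc (hC s)

theorem memLp_tailSymbol {R : ℝ} (hR : 0 < R) {φ : ℝ → ℂ} (h : IsTest R φ) (s : ℝ) :
    MemLp (fun ξ : Space d => tailSymbol R φ s ξ) ∞ volume := by
  simpa using memLp_weight_inv_pow_mul_tailSymbol (d := d) hR h 0 s

theorem memLp_cosTransform {R : ℝ} {φ : ℝ → ℂ} (h : IsTest R φ) :
    MemLp (fun ξ : Space d => cosTransform R φ ξ) ∞ volume := by
  obtain ⟨C, hC⟩ := exists_norm_cosTransform_le (d := d) h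
  exact memLp_of_continuous_of_bound (continuous_cosTransform h) hC

/-! ### The adjoints of the two projections of `H¹ × L²` to `L²` -/

/-- The adjoint of `posOp` is taken with respect to the inner product of `H¹`, whence
`posOp posOp† = (1 + |D|²)⁻¹`. -/
theorem posOp_adjoint (f : L2 d) : posOp d ((posOp d).adjoint f) =
    multiplier _ (memLp_weight_inv_pow 1) f := by
  have hc := continuous_absSymbol (d := d)
  have hb : MemLp (fun ξ : Space d => (absSymbol ξ : ℂ) * ((weight ξ : ℂ)⁻¹) ^ 1) ∞ volume := by
    refine memLp_of_continuous_of_bound (C := 1)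
      ((Complex.continuous_ofReal.comp hc).mul (continuous_weight_inv_pow 1)) fun ξ => ?_
    have h1 := one_le_weight ξ
    have h2 : 0 ≤ absSymbol ξ := by unfold absSymbol; positivity
    rw [pow_one, norm_mul, norm_inv, Complex.norm_real, Complex.norm_real,
      Real.norm_of_nonneg h2, Real.norm_of_nonneg (by linarith), ← div_eq_mul_inv]
    refine div_le_one_of_le₀ ?_ (by linarith)
    unfold weight
    nlinarith [sq_nonneg (absSymbol ξ - 1)]
  have hone : MemLp (fun _ : Space d => (1 : ℂ)) ∞ volume := memLp_top_const 1
  have hmul : multiplier _ hone f = f := by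
    refine (fourierL2 d).injective (Lp.ext ?_)
    filter_upwards [fourier_multiplier_ae _ hone f] with ξ h
    rw [h, one_mul]
  have hpq : IsAbsD (multiplier _ (memLp_weight_inv_pow 1) f) (multiplier _ hb f) := by
    filter_upwards [fourier_multiplier_ae _ (memLp_weight_inv_pow 1) f,
      fourier_multiplier_ae _ hb f] with ξ h1 h2
    rw [h1, h2, mul_assoc]
  set v : Energy d := WithLp.toLp 2 (⟨WithLp.toLp 2 (_, _), hpq⟩, 0) with hv
  have e1 : posOp d v = multiplier _ (memLp_weight_inv_pow 1) f := rfl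
  have e2 : absPosOp d v = multiplier _ hb f := rfl
  have e3 : velOp d v = 0 := rfl
  have key : (posOp d).adjoint f = v := by
    refine ext_inner_left ℂ fun u => ?_
    refine (ContinuousLinearMap.adjoint_inner_right (posOp d) u f).trans ?_
    rw [inner_energy, e1, e2, e3, inner_zero_right, add_zero,
      inner_multiplier_add_of_isAbsD (isAbsD_posOp u) _ _ hone, hmul]
    intro ξ
    have := weight_ne_zero ξ
    have e : (weight ξ : ℂ) = 1 + (absSymbol ξ : ℂ) ^ 2 := by unfold weight; push_cast; rfl
    field_simp
    rw [e]
  rw [key, e1]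

/-- `velOp velOp† = 1`, written as the power `(1 + |D|²)⁰` for uniformity with `posOp_adjoint`. -/
theorem velOp_adjoint (f : L2 d) : velOp d ((velOp d).adjoint f) =
    multiplier _ (memLp_weight_inv_pow 0) f := by
  set v : Energy d := WithLp.toLp 2 (0, f) with hv
  have e1 : posOp d v = 0 := rfl
  have e2 : absPosOp d v = 0 := rfl
  have e3 : velOp d v = f := rfl
  have key : (velOp d).adjoint f = v := by
    refine ext_inner_left ℂ fun u => ?_
    refine (ContinuousLinearMap.adjoint_inner_right (velOp d) u f).trans ?_
    rw [inner_energy, e1, e2, e3, inner_zero_right, inner_zero_right, zero_add, zero_add]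
  rw [key, e3]
  refine (fourierL2 d).injective (Lp.ext ?_)
  filter_upwards [fourier_multiplier_ae _ (memLp_weight_inv_pow 0) f] with ξ h
  rw [h, pow_zero, one_mul]

end NuclearForm

section NuclearForm

variable {d : ℕ} {R : ℝ} {φ : ℝ → ℂ}

theorem integrable_iterate_mul_inner (hφ : IsTest R φ) {g : ℝ → L2 d} (hg : Continuous g)
    (p : L2 d) : IntervalIntegrable (fun s => φ s * inner ℂ p (g s)) volume 0 R :=
  (hφ.continuous.mul (continuous_const.inner hg)).intervalIntegrable _ _

/-- The test function integral over `u`, applied to the position component. The symbol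
`(1 + |D|²) ∫ φ(u + s) |D|⁻¹ sin (u|D|) du` is expanded in powers of `(1 + |D|²)⁻¹`. -/
theorem integral_inner_sincOp_add_sinOp (hR : 0 < R) (hφ : IsTest R φ) {p q : L2 d}
    (hpq : IsAbsD p q) (ψ : L2 d) {s : ℝ} (hs : 0 ≤ s) (n : ℕ) :
    ∫ u in (0 : ℝ)..R, φ (u + s) * (inner ℂ p (sincOp d u ψ) + inner ℂ q (sinOp d u ψ)) =
      inner ℂ p (multiplier _
        (memLp_weight_inv_pow_mul_tailSymbol hR (hφ.iterate (n + 1)) n s) ψ) +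
      ∑ j ∈ Finset.range (n + 1), (oneSubDeriv2^[j] φ) s *
        inner ℂ p (multiplier _ (memLp_weight_inv_pow j) ψ) := by
  have hc : Continuous fun u => φ (u + s) := hφ.continuous.comp (by fun_prop)
  have ha := continuous_absSymbol (d := d)
  have ht := memLp_tailSymbol (d := d) hR hφ s
  have hsc := continuous_sincSymbol (d := d)
  have c1 : Continuous fun u : ℝ => sincOp d u ψ := continuous_sincOp continuous_id continuous_const
  have c2 : Continuous fun u : ℝ => sinOp d u ψ := continuous_sinOp continuous_id continuous_const
  have hM : ∀ ξ : Space d, (weight ξ : ℂ) * tailSymbol R φ s ξ =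
      ((weight ξ : ℂ)⁻¹) ^ n * tailSymbol R (oneSubDeriv2^[n + 1] φ) s ξ +
        ∑ j ∈ Finset.range (n + 1), ((weight ξ : ℂ)⁻¹) ^ j * (oneSubDeriv2^[j] φ) s := by
    intro ξ
    have hw := weight_ne_zero ξ
    rw [tailSymbol_eq hφ hs ξ (n + 1), mul_add, Finset.mul_sum]
    simp only [pow_succ' _ _, mul_assoc, mul_inv_cancel_left₀ hw]
  have hMm : MemLp (fun ξ : Space d => (weight ξ : ℂ) * tailSymbol R φ s ξ) ∞ volume := by
    simp only [hM]
    exact (memLp_weight_inv_pow_mul_tailSymbol hR (hφ.iterate (n + 1)) n s).add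
      (memLp_finsetSum _ fun j _ => (memLp_weight_inv_pow j).mul_const _)
  have hsin : ∀ ξ : Space d, (absSymbol ξ : ℂ) * tailSymbol R φ s ξ =
      ∫ u in (0 : ℝ)..R, φ (u + s) * sinSymbol u ξ := fun ξ => by
    rw [tailSymbol, ← intervalIntegral.integral_const_mul]
    congr 1 with u
    rw [← absSymbol_mul_sincSymbol]
    ring
  have hsinm : MemLp (fun ξ : Space d => (absSymbol ξ : ℂ) * tailSymbol R φ s ξ) ∞ volume := by
    obtain ⟨B, hB⟩ := hφ.hasCompactSupport.exists_bound_of_continuous hφ.continuous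
    have h1 : Continuous fun ξ : Space d => tailSymbol R φ s ξ :=
      (continuous_tailSymbol hφ).comp (Continuous.prodMk_right s)
    refine memLp_of_continuous_of_bound (C := B * 1 * |R - 0|)
      ((Complex.continuous_ofReal.comp ha).mul h1) fun ξ => ?_
    rw [hsin]
    refine intervalIntegral.norm_integral_le_of_norm_le_const fun u _ => ?_
    rw [norm_mul]
    exact mul_le_mul (hB _) (norm_sinSymbol_le u ξ) (norm_nonneg _) ((norm_nonneg _).trans (hB 0))
  have i1 := integral_mul_inner_multiplier hR hc (continuous_sincSymbol (d := d))
    (memLp_sincSymbol d) continuous_abs norm_sincSymbol_le ht (fun ξ => rfl)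
    (ContinuousLinearMap.id ℂ (L2 d)) p ψ
  have i2 := integral_mul_inner_multiplier hR hc (continuous_sinSymbol (d := d))
    (memLp_sinSymbol d) (continuous_const (y := (1 : ℝ))) norm_sinSymbol_le hsinm hsin
    (ContinuousLinearMap.id ℂ (L2 d)) q ψ
  have e := inner_multiplier_add_of_isAbsD hpq ht hsinm hMm (fun ξ => by
    unfold weight; push_cast; ring) ψ
  simp only [ContinuousLinearMap.coe_id', id_eq] at i1 i2
  have s1 : ∫ u in (0 : ℝ)..R, φ (u + s) *
      (inner ℂ p (sincOp d u ψ) + inner ℂ q (sinOp d u ψ)) =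
      (∫ u in (0 : ℝ)..R, φ (u + s) * inner ℂ p (sincOp d u ψ)) +
        ∫ u in (0 : ℝ)..R, φ (u + s) * inner ℂ q (sinOp d u ψ) := by
    have j1 : IntervalIntegrable (fun u => φ (u + s) * inner ℂ p (sincOp d u ψ)) volume 0 R :=
      (hc.mul (continuous_const.inner c1)).intervalIntegrable _ _
    have j2 : IntervalIntegrable (fun u => φ (u + s) * inner ℂ q (sinOp d u ψ)) volume 0 R :=
      (hc.mul (continuous_const.inner c2)).intervalIntegrable _ _
    rw [← intervalIntegral.integral_add j1 j2]
    simp only [mul_add]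
  rw [s1]
  refine (congrArg₂ (· + ·) i1 i2).trans (e.trans ?_)
  rw [multiplier_add_sum (Finset.range (n + 1))
    (memLp_weight_inv_pow_mul_tailSymbol hR (hφ.iterate (n + 1)) n s) memLp_weight_inv_pow hMm hM,
    inner_add_right, inner_sum]
  simp only [inner_smul_right]

variable {V : Space d → ℂ} {hV : MemLp V ∞ volume}

/-- The contribution of the position component to `⟨φ, W₁⟩`. -/
theorem integral_position (hR : 0 < R) (hφ : IsTest R φ) {p q : L2 d} (hpq : IsAbsD p q)
    (f : L2 d) (n : ℕ) :
    ∫ s in (0 : ℝ)..R, ∫ u in (0 : ℝ)..R, φ (u + s) *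
      (inner ℂ p (sincOp d u (mulOp V hV (cosOp d s f))) +
        inner ℂ q (sinOp d u (mulOp V hV (cosOp d s f)))) =
      (∫ s in Ioc 0 R, inner ℂ p (multiplier _
        (memLp_weight_inv_pow_mul_tailSymbol hR (hφ.iterate (n + 1)) n s)
          (mulOp V hV (multiplier _ (memLp_cosSymbol d s) f)))) +
      ∑ j ∈ Finset.range (n + 1), inner ℂ p (multiplier _ (memLp_weight_inv_pow j)
        (mulOp V hV (multiplier _ (memLp_cosTransform (hφ.iterate j)) f))) := by
  have c0 : Continuous fun s : ℝ => mulOp V hV (cosOp d s f) :=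
    (mulOp V hV).continuous.comp (continuous_cosOp continuous_id continuous_const)
  obtain ⟨C, hC⟩ := exists_norm_weight_inv_pow_mul_tailSymbol_le (d := d) hR
    (hφ.iterate (n + 1)) n
  have ct := continuous_weight_inv_pow_mul_tailSymbol (d := d) (hφ.iterate (n + 1)) n
  have c1 : Continuous fun s : ℝ => multiplier _
        (memLp_weight_inv_pow_mul_tailSymbol hR (hφ.iterate (n + 1)) n s)
          (mulOp V hV (cosOp d s f)) :=
    continuous_multiplier _ _ (fun ξ => ct.comp (by fun_prop : Continuous fun s : ℝ => (s, ξ)))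
      (fun _ => ⟨C, .of_forall fun s => hC s⟩) c0
  have c2 : ∀ j : ℕ, Continuous fun s : ℝ => multiplier _ (memLp_weight_inv_pow j)
      (mulOp V hV (cosOp d s f)) := fun j => (multiplier _ _).continuous.comp c0
  have i1 : IntervalIntegrable (fun s => inner ℂ p (multiplier _
        (memLp_weight_inv_pow_mul_tailSymbol hR (hφ.iterate (n + 1)) n s)
          (mulOp V hV (cosOp d s f)))) volume 0 R :=
    (continuous_const.inner c1).intervalIntegrable _ _
  have i2 : ∀ j ∈ Finset.range (n + 1), IntervalIntegrable (fun s => (oneSubDeriv2^[j] φ) s *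
      inner ℂ p (multiplier _ (memLp_weight_inv_pow j) (mulOp V hV (cosOp d s f))))
      volume 0 R := fun j _ => integrable_iterate_mul_inner (hφ.iterate j) (c2 j) p
  have i3 := IntervalIntegrable.sum _ i2
  rw [intervalIntegral.integral_congr (g := fun s => inner ℂ p (multiplier _
      (memLp_weight_inv_pow_mul_tailSymbol hR (hφ.iterate (n + 1)) n s)
        (mulOp V hV (cosOp d s f))) +
      ∑ j ∈ Finset.range (n + 1), (oneSubDeriv2^[j] φ) s *
        inner ℂ p (multiplier _ (memLp_weight_inv_pow j) (mulOp V hV (cosOp d s f))))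
      fun s hs => ?_]
  · rw [intervalIntegral.integral_add i1 (by simpa [Finset.sum_fn] using i3),
      intervalIntegral.integral_finsetSum i2, intervalIntegral.integral_of_le hR.le]
    congr 1
    refine Finset.sum_congr rfl fun j _ => ?_
    exact integral_mul_inner_multiplier hR (hφ.iterate j).continuous
      (continuous_cosSymbol (d := d)) (memLp_cosSymbol d) (continuous_const (y := (1 : ℝ)))
      norm_cosSymbol_le (memLp_cosTransform (hφ.iterate j)) (fun ξ => rfl)
      (multiplier _ (memLp_weight_inv_pow j) ∘L mulOp V hV) p f
  · rw [uIcc_of_le hR.le] at hs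
    exact integral_inner_sincOp_add_sinOp hR hφ hpq _ hs.1 n

/-- The contribution of the velocity component to `⟨φ, W₁⟩`. -/
theorem integral_velocity (hR : 0 < R) (hφ : IsTest R φ) (p f : L2 d) (n : ℕ) :
    ∫ s in (0 : ℝ)..R, ∫ u in (0 : ℝ)..R, φ (u + s) *
      inner ℂ p (cosOp d u (mulOp V hV (sincOp d s f))) =
      (∫ u in Ioc 0 R, inner ℂ p (multiplier _ (memLp_cosSymbol d u) (mulOp V hV (multiplier _
        (memLp_weight_inv_pow_mul_tailSymbol hR (hφ.iterate n) n u) f)))) +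
      ∑ j ∈ Finset.range n, inner ℂ p (multiplier _ (memLp_cosTransform (hφ.iterate j))
        (mulOp V hV (multiplier _ (memLp_weight_inv_pow (j + 1)) f))) := by
  have cK : Continuous fun x : ℝ × ℝ => φ (x.2 + x.1) *
      inner ℂ p (cosOp d x.2 (mulOp V hV (sincOp d x.1 f))) :=
    (hφ.continuous.comp (by fun_prop)).mul (continuous_const.inner
      (continuous_cosOp continuous_snd ((mulOp V hV).continuous.comp
        (continuous_sincOp continuous_fst continuous_const))))
  -- here the sine integral is the one over `s`, so it is done first
  rw [intervalIntegral_swap hR cK]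
  obtain ⟨C, hC⟩ := exists_norm_weight_inv_pow_mul_tailSymbol_le (d := d) hR (hφ.iterate n) n
  have ct := continuous_weight_inv_pow_mul_tailSymbol (d := d) (hφ.iterate n) n
  have c1 : Continuous fun s : ℝ => multiplier _
        (memLp_weight_inv_pow_mul_tailSymbol hR (hφ.iterate n) n s) f :=
    continuous_multiplier _ _ (fun ξ => ct.comp (by fun_prop : Continuous fun s : ℝ => (s, ξ)))
      (fun _ => ⟨C, .of_forall fun s => hC s⟩) continuous_const
  have c2 : ∀ g : ℝ → L2 d, Continuous g → Continuous fun u => cosOp d u (mulOp V hV (g u)) :=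
    fun g hg => continuous_cosOp continuous_id ((mulOp V hV).continuous.comp hg)
  have i1 : IntervalIntegrable (fun u => inner ℂ p (cosOp d u (mulOp V hV (multiplier _
        (memLp_weight_inv_pow_mul_tailSymbol hR (hφ.iterate n) n u) f)))) volume 0 R :=
    (continuous_const.inner (c2 _ c1)).intervalIntegrable _ _
  have i2 : ∀ j ∈ Finset.range n, IntervalIntegrable (fun u => (oneSubDeriv2^[j] φ) u *
      inner ℂ p (cosOp d u (mulOp V hV (multiplier _ (memLp_weight_inv_pow (j + 1)) f))))
      volume 0 R := fun j _ =>
    integrable_iterate_mul_inner (hφ.iterate j) (c2 _ continuous_const) p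
  have i3 := IntervalIntegrable.sum _ i2
  rw [intervalIntegral.integral_congr (g := fun u => inner ℂ p (cosOp d u (mulOp V hV (multiplier _
        (memLp_weight_inv_pow_mul_tailSymbol hR (hφ.iterate n) n u) f))) +
      ∑ j ∈ Finset.range n, (oneSubDeriv2^[j] φ) u *
        inner ℂ p (cosOp d u (mulOp V hV (multiplier _ (memLp_weight_inv_pow (j + 1)) f))))
      fun u hu => ?_]
  · rw [intervalIntegral.integral_add i1 (by simpa [Finset.sum_fn] using i3),
      intervalIntegral.integral_finsetSum i2, intervalIntegral.integral_of_le hR.le]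
    congr 1
    refine Finset.sum_congr rfl fun j _ => ?_
    exact integral_mul_inner_multiplier hR (hφ.iterate j).continuous
      (continuous_cosSymbol (d := d)) (memLp_cosSymbol d) (continuous_const (y := (1 : ℝ)))
      norm_cosSymbol_le (memLp_cosTransform (hφ.iterate j)) (fun ξ => rfl)
      (ContinuousLinearMap.id ℂ (L2 d)) p
      (mulOp V hV (multiplier _ (memLp_weight_inv_pow (j + 1)) f))
  · rw [uIcc_of_le hR.le] at hu
    have hc : Continuous fun s => φ (u + s) := hφ.continuous.comp (by fun_prop)
    have e1 := integral_mul_inner_multiplier hR hc (continuous_sincSymbol (d := d))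
      (memLp_sincSymbol d) continuous_abs norm_sincSymbol_le (memLp_tailSymbol hR hφ u)
      (fun ξ => by simp only [tailSymbol, add_comm]) (cosOp d u ∘L mulOp V hV) p f
    refine e1.trans ?_
    rw [multiplier_add_sum (Finset.range n)
      (memLp_weight_inv_pow_mul_tailSymbol hR (hφ.iterate n) n u)
      (fun j => memLp_weight_inv_pow (j + 1)) (memLp_tailSymbol hR hφ u)
      (fun ξ => tailSymbol_eq hφ hu.1 ξ n), map_add, map_sum, inner_add_right, inner_sum]
    simp only [map_smul, inner_smul_right, ContinuousLinearMap.comp_apply]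

end NuclearForm

/-! ### The trace as an integral over phase space -/

section Trace

variable {d : ℕ} {R : ℝ} {φ : ℝ → ℂ}

theorem exists_norm_weight_inv_pow_mul_tailSymbol_le_decayRate (hR : 0 < R) (h : IsTest R φ)
    {N : ℕ} (hN : d + 1 ≤ N) :
    ∃ C, ∀ s (ξ : Space d), ‖((weight ξ : ℂ)⁻¹) ^ N * tailSymbol R φ s ξ‖ ≤ C * decayRate ξ := by
  obtain ⟨C, hC⟩ := exists_norm_tailSymbol_le (d := d) hR h
  refine ⟨2 ^ (d + 1) * C, fun s ξ => ?_⟩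
  have e : ((weight ξ : ℂ)⁻¹) ^ N =
      ((weight ξ : ℂ)⁻¹) ^ (d + 1) * ((weight ξ : ℂ)⁻¹) ^ (N - (d + 1)) := by
    rw [← pow_add, Nat.add_sub_cancel' hN]
  rw [e, norm_mul, norm_mul]
  have h0 := (norm_nonneg _).trans (hC s ξ)
  calc _ ≤ (2 ^ (d + 1) * decayRate ξ * 1) * C := by
        refine mul_le_mul ?_ (hC s ξ) (norm_nonneg _)
          (mul_nonneg (mul_nonneg (by positivity) (decayRate_pos ξ).le) zero_le_one)
        exact mul_le_mul (weight_inv_pow_le ξ) (norm_weight_inv_pow_le_one ξ _) (norm_nonneg _)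
          (mul_nonneg (by positivity) (decayRate_pos ξ).le)
    _ = _ := by ring

theorem integrable_of_norm_le_decayRate {m : Space d → ℂ} (hm : Continuous m) {C : ℝ}
    (h : ∀ ξ, ‖m ξ‖ ≤ C * decayRate ξ) : Integrable m :=
  (integrable_decayRate.const_mul C).mono' hm.aestronglyMeasurable (.of_forall h)

/-- The symbol `∫₀^∞ ∫₀^∞ φ(u + s) |D|⁻¹ sin (u|D|) cos (s|D|) du ds`, for `φ` vanishing on
`[R, ∞)`. -/
def phaseSymbol (R : ℝ) (φ : ℝ → ℂ) (ξ : Space d) : ℂ :=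
  ∫ s in (0 : ℝ)..R, tailSymbol R φ s ξ * cosSymbol s ξ

/-- Reassembling the traces of the terms of the expansion in powers of `(1 + |D|²)⁻¹`. -/
theorem integral_tail_add_sum_cosTransform (hR : 0 < R) (hφ : IsTest R φ) {N : ℕ}
    (hN : d + 1 ≤ N) :
    (∫ s in Ioc 0 R, ∫ ξ : Space d,
      ((weight ξ : ℂ)⁻¹) ^ N * tailSymbol R (oneSubDeriv2^[N] φ) s ξ * cosSymbol s ξ) +
      ∑ j ∈ Finset.range N, ∫ ξ : Space d,
        ((weight ξ : ℂ)⁻¹) ^ (j + 1) * cosTransform R (oneSubDeriv2^[j] φ) ξ =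
      ∫ ξ : Space d, phaseSymbol R φ ξ := by
  obtain ⟨C, hC⟩ := exists_norm_weight_inv_pow_mul_tailSymbol_le_decayRate (d := d) hR
    (hφ.iterate N) hN
  have ct := continuous_weight_inv_pow_mul_tailSymbol (d := d) (hφ.iterate N) N
  have cc := continuous_cosSymbol (d := d)
  have hint : Integrable (Function.uncurry fun (s : ℝ) (ξ : Space d) =>
      ((weight ξ : ℂ)⁻¹) ^ N * tailSymbol R (oneSubDeriv2^[N] φ) s ξ * cosSymbol s ξ)
      ((volume.restrict (Ioc 0 R)).prod volume) := by
    refine ((integrable_decayRate (d := d)).const_mul C).comp_snd _ |>.mono'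
      (ct.mul cc).aestronglyMeasurable (.of_forall fun p => ?_)
    simp only [Function.uncurry]
    rw [norm_mul]
    exact (mul_le_of_le_one_right (norm_nonneg _) (norm_cosSymbol_le _ _)).trans (hC p.1 p.2)
  have hj : ∀ j ∈ Finset.range N, Integrable fun ξ : Space d =>
      ((weight ξ : ℂ)⁻¹) ^ (j + 1) * cosTransform R (oneSubDeriv2^[j] φ) ξ := fun j _ => by
    obtain ⟨C', hC'⟩ := exists_norm_cosTransform_le_decayRate (d := d) (hφ.iterate j)
    refine integrable_of_norm_le_decayRate
      ((continuous_weight_inv_pow _).mul (continuous_cosTransform (hφ.iterate j))) (C := C')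
      fun ξ => ?_
    rw [norm_mul]
    exact (mul_le_of_le_one_left (norm_nonneg _) (norm_weight_inv_pow_le_one ξ _)).trans (hC' ξ)
  rw [integral_integral_swap hint, ← integral_finsetSum _ hj,
    ← integral_add (f := fun ξ : Space d => ∫ s in Ioc 0 R, ((weight ξ : ℂ)⁻¹) ^ N *
      tailSymbol R (oneSubDeriv2^[N] φ) s ξ * cosSymbol s ξ) hint.integral_prod_right
      (integrable_finsetSum _ hj)]
  refine integral_congr_ae (.of_forall fun ξ => ?_)
  have i1 : IntervalIntegrable (fun s => ((weight ξ : ℂ)⁻¹) ^ N *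
      tailSymbol R (oneSubDeriv2^[N] φ) s ξ * cosSymbol s ξ) volume 0 R :=
    ((ct.mul cc).comp (Continuous.prodMk_left ξ)).intervalIntegrable _ _
  have i2 : ∀ j ∈ Finset.range N, IntervalIntegrable (fun s => ((weight ξ : ℂ)⁻¹) ^ (j + 1) *
      ((oneSubDeriv2^[j] φ) s * cosSymbol s ξ)) volume 0 R := fun j _ =>
    (continuous_const.mul ((hφ.iterate j).continuous.mul
      (cc.comp (Continuous.prodMk_left ξ)))).intervalIntegrable _ _
  have i3 := IntervalIntegrable.sum _ i2
  simp only [phaseSymbol, cosTransform]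
  simp only [← intervalIntegral.integral_const_mul]
  rw [← intervalIntegral.integral_of_le hR.le, ← intervalIntegral.integral_finsetSum i2,
    ← intervalIntegral.integral_add i1 (by simpa [Finset.sum_fn] using i3)]
  refine intervalIntegral.integral_congr fun s hs => ?_
  rw [uIcc_of_le hR.le] at hs
  rw [tailSymbol_eq hφ hs.1 ξ N, add_mul, Finset.sum_mul]
  simp only [mul_assoc]

variable {V : Space d → ℂ} {hV : MemLp V ∞ volume}

instance instSeparableSpaceEnergy : TopologicalSpace.SeparableSpace (Energy d) := by
  have : Fact ((2 : ℝ≥0∞) ≠ ∞) := ⟨by norm_num⟩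
  have h1 : SecondCountableTopology (L2 d) := Lp.SecondCountableTopology
  have h2 : SecondCountableTopology (WithLp 2 (L2 d × L2 d)) := WithLp.secondCountableTopology 2 _ _
  have h3 : SecondCountableTopology (H1 d) := TopologicalSpace.Subtype.secondCountableTopology _
  have h4 : SecondCountableTopology (Energy d) := WithLp.secondCountableTopology 2 _ _
  exact TopologicalSpace.SecondCountableTopology.to_separableSpace

/-- The position part. The factor `1 + |D|²` from the inner product of `H¹` costs one power of
`(1 + |D|²)⁻¹` in the symbol to the left of `V`, and `posOp posOp†` restores it in the trace. In the
terms of the sum the symbol to the right of `V` decays. -/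
theorem hasFormTrace_position (hR : 0 < R) (hφ : IsTest R φ)
    (hVc : ∃ K : Set (Space d), IsCompact K ∧ ∀ᵐ x, x ∉ K → V x = 0) :
    HasFormTrace (fun u z : Energy d => ∫ s in (0 : ℝ)..R, ∫ t in (0 : ℝ)..R, φ (t + s) *
      (inner ℂ (posOp d u) (sincOp d t (mulOp V hV (cosOp d s (posOp d z)))) +
        inner ℂ (absPosOp d u) (sinOp d t (mulOp V hV (cosOp d s (posOp d z))))))
      ((∫ x, V x) * ∫ ξ : Space d, phaseSymbol R φ ξ) := by
  simp only [fun u z : Energy d => integral_position (hV := hV) hR hφ (isAbsD_posOp u)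
    (posOp d z) (d + 1)]
  rw [← integral_tail_add_sum_cosTransform hR hφ (Nat.le_succ (d + 1)), mul_add, Finset.mul_sum]
  refine HasFormTrace.add ?_ (HasFormTrace.sum _ fun j _ => ?_)
  · obtain ⟨C, hC⟩ := exists_norm_weight_inv_pow_mul_tailSymbol_le_decayRate (d := d) hR
      (hφ.iterate (d + 2)) le_rfl
    have key := hasFormTrace_of_decay (posOp d) (memLp_weight_inv_pow 1) posOp_adjoint hV hVc
      (volume.restrict (Ioc 0 R))
      (continuous_weight_inv_pow_mul_tailSymbol (hφ.iterate (d + 2)) (d + 1)) continuous_cosSymbol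
      (C := max C 1) (.inl fun σ ξ => ⟨(hC σ ξ).trans
        (mul_le_mul_of_nonneg_right (le_max_left _ _) (decayRate_pos ξ).le),
        (norm_cosSymbol_le σ ξ).trans (le_max_right _ _)⟩)
      (memLp_weight_inv_pow_mul_tailSymbol hR (hφ.iterate (d + 2)) (d + 1)) (memLp_cosSymbol d)
    convert key using 2
    refine integral_congr_ae (.of_forall fun s => ?_)
    refine integral_congr_ae (.of_forall fun ξ => ?_)
    change ((weight ξ : ℂ)⁻¹) ^ (d + 1 + 1) * tailSymbol R (oneSubDeriv2^[d + 2] φ) s ξ *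
      cosSymbol s ξ = _
    ring
  · obtain ⟨C, hC⟩ := exists_norm_cosTransform_le_decayRate (d := d) (hφ.iterate j)
    -- a single operator is a superposition over a point mass
    have key := hasFormTrace_of_decay (posOp d) (memLp_weight_inv_pow 1) posOp_adjoint hV hVc
      (Measure.dirac 0)
      (m := fun _ ξ => ((weight ξ : ℂ)⁻¹) ^ j)
      (l := fun _ ξ => cosTransform R (oneSubDeriv2^[j] φ) ξ)
      ((continuous_weight_inv_pow j).comp continuous_snd)
      ((continuous_cosTransform (hφ.iterate j)).comp continuous_snd)
      (C := max C 1) (.inr fun σ ξ => ⟨(norm_weight_inv_pow_le_one ξ j).trans (le_max_right _ _),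
        (hC ξ).trans (mul_le_mul_of_nonneg_right (le_max_left _ _) (decayRate_pos ξ).le)⟩)
      (fun _ => memLp_weight_inv_pow j) (fun _ => memLp_cosTransform (hφ.iterate j))
    simp only [integral_dirac] at key
    convert key using 4 with ξ
    ring

/-- The velocity part. Its trace equals that of the position part, the two symbols having changed
sides. -/
theorem hasFormTrace_velocity (hR : 0 < R) (hφ : IsTest R φ)
    (hVc : ∃ K : Set (Space d), IsCompact K ∧ ∀ᵐ x, x ∉ K → V x = 0) :
    HasFormTrace (fun u z : Energy d => ∫ s in (0 : ℝ)..R, ∫ t in (0 : ℝ)..R, φ (t + s) *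
      inner ℂ (velOp d u) (cosOp d t (mulOp V hV (sincOp d s (velOp d z)))))
      ((∫ x, V x) * ∫ ξ : Space d, phaseSymbol R φ ξ) := by
  simp only [fun u z : Energy d => integral_velocity (hV := hV) hR hφ (velOp d u)
    (velOp d z) (d + 1)]
  rw [← integral_tail_add_sum_cosTransform hR hφ le_rfl, mul_add, Finset.mul_sum]
  refine HasFormTrace.add ?_ (HasFormTrace.sum _ fun j _ => ?_)
  · obtain ⟨C, hC⟩ := exists_norm_weight_inv_pow_mul_tailSymbol_le_decayRate (d := d) hR
      (hφ.iterate (d + 1)) le_rfl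
    have key := hasFormTrace_of_decay (velOp d) (memLp_weight_inv_pow 0) velOp_adjoint hV hVc
      (volume.restrict (Ioc 0 R)) continuous_cosSymbol
      (continuous_weight_inv_pow_mul_tailSymbol (hφ.iterate (d + 1)) (d + 1))
      (C := max C 1) (.inr fun σ ξ => ⟨(norm_cosSymbol_le σ ξ).trans (le_max_right _ _),
        (hC σ ξ).trans (mul_le_mul_of_nonneg_right (le_max_left _ _) (decayRate_pos ξ).le)⟩)
      (memLp_cosSymbol d) (memLp_weight_inv_pow_mul_tailSymbol hR (hφ.iterate (d + 1)) (d + 1))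
    convert key using 2
    refine integral_congr_ae (.of_forall fun s => ?_)
    refine integral_congr_ae (.of_forall fun ξ => ?_)
    dsimp only
    ring
  · obtain ⟨C, hC⟩ := exists_norm_cosTransform_le_decayRate (d := d) (hφ.iterate j)
    have key := hasFormTrace_of_decay (velOp d) (memLp_weight_inv_pow 0) velOp_adjoint hV hVc
      (Measure.dirac 0)
      (m := fun _ ξ => cosTransform R (oneSubDeriv2^[j] φ) ξ)
      (l := fun _ ξ => ((weight ξ : ℂ)⁻¹) ^ (j + 1))
      ((continuous_cosTransform (hφ.iterate j)).comp continuous_snd)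
      ((continuous_weight_inv_pow (j + 1)).comp continuous_snd)
      (C := max C 1) (.inl fun σ ξ => ⟨(hC ξ).trans
        (mul_le_mul_of_nonneg_right (le_max_left _ _) (decayRate_pos ξ).le),
        (norm_weight_inv_pow_le_one ξ (j + 1)).trans (le_max_right _ _)⟩)
      (fun _ => memLp_cosTransform (hφ.iterate j)) (fun _ => memLp_weight_inv_pow (j + 1))
    simp only [integral_dirac] at key
    convert key using 4 with ξ
    ring

theorem intervalIntegral_integral_add {K L : ℝ × ℝ → ℂ} (hK : Continuous K) (hL : Continuous L) :
    ∫ s in (0 : ℝ)..R, ∫ u in (0 : ℝ)..R, (K (u, s) + L (u, s)) =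
      (∫ s in (0 : ℝ)..R, ∫ u in (0 : ℝ)..R, K (u, s)) +
        ∫ s in (0 : ℝ)..R, ∫ u in (0 : ℝ)..R, L (u, s) := by
  have h : ∀ {K : ℝ × ℝ → ℂ}, Continuous K →
      Continuous fun s => ∫ u in (0 : ℝ)..R, K (u, s) := fun {K} hK =>
    intervalIntegral.continuous_parametric_intervalIntegral_of_continuous'
      (f := fun s u => K (u, s)) (hK.comp continuous_swap) 0 R
  rw [← intervalIntegral.integral_add ((h hK).intervalIntegrable _ _)
    ((h hL).intervalIntegrable _ _)]
  congr 1 with s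
  exact intervalIntegral.integral_add
    ((hK.comp (Continuous.prodMk_left s)).intervalIntegrable _ _)
    ((hL.comp (Continuous.prodMk_left s)).intervalIntegrable _ _)

/-- One factor `2` comes from the two signs of `t`, the other from the equality of the traces of the
position and velocity parts. -/
theorem hasTrace_pairingW1 (hR : 0 < R) (hφ : IsTest R φ)
    (hVc : ∃ K : Set (Space d), IsCompact K ∧ ∀ᵐ x, x ∉ K → V x = 0)
    {T : Energy d →L[ℂ] Energy d} (hT : IsPairingW1 V hV φ T) :
    HasTrace T (4 * ((∫ x, V x) * ∫ ξ : Space d, phaseSymbol R φ ξ)) := by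
  have key := ((hasFormTrace_position (hV := hV) hR hφ hVc).add
    (hasFormTrace_velocity (hV := hV) hR hφ hVc)).const_mul 2
  rw [← two_mul, ← mul_assoc, show (2 : ℂ) * 2 = 4 by norm_num] at key
  refine key.hasTrace fun u z => ?_
  rw [inner_pairingW1 hφ hT u z, integral_triangle hR hφ.continuous (fun t => hφ.eq_zero)
    (continuous_oddKernel u z)]
  have hsh : Continuous fun x : ℝ × ℝ => φ (x.1 + x.2) := hφ.continuous.comp (by fun_prop)
  have hc : Continuous fun x : ℝ × ℝ => mulOp V hV (cosOp d x.2 (posOp d z)) :=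
    (mulOp V hV).continuous.comp (continuous_cosOp continuous_snd continuous_const)
  have hs : Continuous fun x : ℝ × ℝ => mulOp V hV (sincOp d x.2 (velOp d z)) :=
    (mulOp V hV).continuous.comp (continuous_sincOp continuous_snd continuous_const)
  have e := intervalIntegral_integral_add (R := R)
    (hsh.mul ((continuous_const.inner (continuous_sincOp continuous_fst hc)).add
      (continuous_const.inner (continuous_sinOp continuous_fst hc))))
    (hsh.mul (continuous_const.inner (continuous_cosOp continuous_fst hs)))
    (K := fun x => φ (x.1 + x.2) *
      (inner ℂ (posOp d u) (sincOp d x.1 (mulOp V hV (cosOp d x.2 (posOp d z)))) +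
        inner ℂ (absPosOp d u) (sinOp d x.1 (mulOp V hV (cosOp d x.2 (posOp d z))))))
    (L := fun x => φ (x.1 + x.2) *
      inner ℂ (velOp d u) (cosOp d x.1 (mulOp V hV (sincOp d x.2 (velOp d z)))))
  rw [← e]
  simp only [oddKernel, mul_add]

end Trace

/-! ### The symbol of the trace and its radial profile -/

section PhaseSymbol

variable {d : ℕ} {R : ℝ} {φ : ℝ → ℂ}

theorem sincSymbol_neg (t : ℝ) (ξ : Space d) : sincSymbol (-t) ξ = -sincSymbol t ξ := by
  simp [sincSymbol]

theorem two_mul_sincSymbol_mul_cosSymbol (t s : ℝ) (ξ : Space d) :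
    2 * (sincSymbol (t - s) ξ * cosSymbol s ξ) = sincSymbol t ξ + sincSymbol (t - 2 * s) ξ := by
  by_cases ha : absSymbol ξ = 0
  · simp only [sincSymbol, cosSymbol, ha, mul_zero, Real.sinc_zero, Real.cos_zero]
    push_cast
    ring
  · have ha' : (absSymbol ξ : ℂ) ≠ 0 := by exact_mod_cast ha
    refine mul_left_cancel₀ ha' ?_
    have h1 := absSymbol_mul_sincSymbol (t - s) ξ
    have h2 := absSymbol_mul_sincSymbol t ξ
    have h3 := absSymbol_mul_sincSymbol (t - 2 * s) ξ
    have e : 2 * (sinSymbol (t - s) ξ * cosSymbol s ξ) =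
        sinSymbol t ξ + sinSymbol (t - 2 * s) ξ := by
      simp only [sinSymbol, cosSymbol]
      norm_cast
      have e1 : t * absSymbol ξ = (t - s) * absSymbol ξ + s * absSymbol ξ := by ring
      have e2 : (t - 2 * s) * absSymbol ξ = (t - s) * absSymbol ξ - s * absSymbol ξ := by ring
      rw [e1, e2, Real.sin_add, Real.sin_sub]
      ring
    linear_combination 2 * cosSymbol s ξ * h1 - h2 - h3 + e

/-- The integrand is `½ |D|⁻¹ (sin (t|D|) + sin ((t - 2s)|D|))`. -/
theorem integral_sincSymbol_mul_cosSymbol (t : ℝ) (ξ : Space d) :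
    ∫ s in (0 : ℝ)..t, sincSymbol (t - s) ξ * cosSymbol s ξ = 1 / 2 * (t * sincSymbol t ξ) := by
  have cs : Continuous fun s : ℝ => sincSymbol s ξ :=
    continuous_sincSymbol.comp (Continuous.prodMk_left ξ)
  have i1 : IntervalIntegrable (fun _ : ℝ => sincSymbol t ξ) volume 0 t :=
    continuous_const.intervalIntegrable _ _
  have i2 : IntervalIntegrable (fun s : ℝ => sincSymbol (t - 2 * s) ξ) volume 0 t :=
    (cs.comp (by fun_prop : Continuous fun s : ℝ => t - 2 * s)).intervalIntegrable _ _
  -- the second term is odd about the midpoint `s = t / 2`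
  have h0 : ∫ s in (0 : ℝ)..t, sincSymbol (t - 2 * s) ξ = 0 := by
    have e := intervalIntegral.integral_comp_sub_left
      (fun s => sincSymbol (t - 2 * s) ξ) t (a := 0) (b := t)
    rw [sub_self, sub_zero] at e
    have e' : (fun s : ℝ => sincSymbol (t - 2 * (t - s)) ξ) =
        fun s => -sincSymbol (t - 2 * s) ξ := by
      funext s
      rw [show t - 2 * (t - s) = -(t - 2 * s) by ring, sincSymbol_neg]
    rw [e', intervalIntegral.integral_neg] at e
    exact self_eq_neg.1 e.symm
  have e : ∀ s : ℝ, sincSymbol (t - s) ξ * cosSymbol s ξ =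
      1 / 2 * (sincSymbol t ξ + sincSymbol (t - 2 * s) ξ) := fun s => by
    rw [← two_mul_sincSymbol_mul_cosSymbol]
    ring
  simp only [e]
  rw [intervalIntegral.integral_const_mul, intervalIntegral.integral_add i1 i2, h0,
    intervalIntegral.integral_const, sub_zero, add_zero, Complex.real_smul]

/-- The radial profile `½ ∫₀^∞ t φ(t) |D|⁻¹ sin (t|D|) dt` of `phaseSymbol`, as a function of
`r = ‖ξ‖`, so that `|D| = 2πr`. -/
def phaseProfile (R : ℝ) (φ : ℝ → ℂ) (r : ℝ) : ℂ :=
  1 / 2 * ∫ t in (0 : ℝ)..R, φ t * ((t * (t * Real.sinc (t * (2 * Real.pi * r))) : ℝ) : ℂ)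

theorem phaseSymbol_eq (hR : 0 < R) (hφ : IsTest R φ) (ξ : Space d) :
    phaseSymbol R φ ξ = phaseProfile R φ ‖ξ‖ := by
  have hK : Continuous fun p : ℝ × ℝ => sincSymbol p.1 ξ * cosSymbol p.2 ξ :=
    (continuous_sincSymbol.comp (by fun_prop : Continuous fun p : ℝ × ℝ => (p.1, ξ))).mul
      (continuous_cosSymbol.comp (by fun_prop : Continuous fun p : ℝ × ℝ => (p.2, ξ)))
  have h := integral_triangle hR hφ.continuous (fun t => hφ.eq_zero)
    (K := fun u s => sincSymbol u ξ * cosSymbol s ξ) hK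
  simp only [integral_sincSymbol_mul_cosSymbol] at h
  rw [phaseSymbol, phaseProfile, ← intervalIntegral.integral_const_mul]
  refine Eq.trans ?_ (h.symm.trans ?_)
  · congr 1 with s
    rw [tailSymbol, ← intervalIntegral.integral_mul_const]
    simp only [mul_assoc]
  · congr 1 with t
    simp only [sincSymbol, absSymbol]
    push_cast
    ring

end PhaseSymbol

/-! ### Fourier transforms of even test functions on the line -/

section Fourier

open SchwartzMap

variable {R : ℝ} {φ : ℝ → ℂ}

theorem IsTest.integrable_mul (h : IsTest R φ) {g : ℝ → ℂ} (hg : Continuous g) :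
    Integrable fun t => g t * φ t :=
  (hg.mul h.continuous).integrable_of_hasCompactSupport h.hasCompactSupport.mul_left

theorem IsTest.integrable (h : IsTest R φ) : Integrable φ :=
  h.continuous.integrable_of_hasCompactSupport h.hasCompactSupport

theorem IsTest.exists_schwartzMap (h : IsTest R φ) : ∃ Ψ : 𝓢(ℝ, ℂ), ⇑Ψ = 𝓕 φ :=
  ⟨𝓕 (h.hasCompactSupport.toSchwartzMap h.smooth), by
    rw [SchwartzMap.fourier_coe]; rfl⟩

theorem IsTest.fourier_neg (h : IsTest R φ) (r : ℝ) : 𝓕 φ (-r) = 𝓕 φ r := by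
  rw [← Real.fourierInv_eq_fourier_neg, Real.fourierInv_eq_fourier_comp_neg]
  simp only [h.even]

theorem integral_eq_two_mul_integral_Ioi {f : ℝ → ℂ} (hf : Integrable f)
    (he : ∀ x, f (-x) = f x) : ∫ x, f x = 2 * ∫ x in Ioi (0 : ℝ), f x := by
  have h := integral_add_compl (measurableSet_Ioi (a := (0 : ℝ))) hf
  rw [compl_Ioi] at h
  have h2 := integral_comp_neg_Iic (0 : ℝ) f
  simp only [he, neg_zero] at h2
  rw [← h, h2, two_mul]

theorem integral_Ioi_deriv_schwartzMap (h : 𝓢(ℝ, ℂ)) :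
    ∫ r in Ioi (0 : ℝ), deriv h r = -h 0 := by
  have hd := integral_Ioi_of_hasDerivAt_of_tendsto' (a := 0) (m := 0) (f := h) (f' := deriv h)
    (fun r _ => h.differentiableAt.hasDerivAt)
    ((derivCLM ℂ ℂ h).integrable (μ := volume)).integrableOn
    (h.tendsto_cocompact.mono_left atTop_le_cocompact)
  rw [hd, zero_sub]

theorem integrable_pow_mul_schwartzMap (Ψ : 𝓢(ℝ, ℂ)) (m : ℕ) :
    Integrable fun r : ℝ => (r : ℂ) ^ m * Ψ r := by
  have hg : (fun r : ℝ => (r : ℂ) ^ m).HasTemperateGrowth :=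
    Function.HasTemperateGrowth.pow Function.Complex.hasTemperateGrowth_ofReal m
  refine (smulLeftCLM ℂ (fun r : ℝ => (r : ℂ) ^ m) Ψ).integrable.congr (.of_forall fun r => ?_)
  exact smulLeftCLM_apply_apply hg Ψ r

theorem integral_Ioi_pow_mul_deriv (Ψ : 𝓢(ℝ, ℂ)) (m : ℕ) :
    ∫ r in Ioi (0 : ℝ), (r : ℂ) ^ (m + 1) * deriv Ψ r =
      -((m + 1 : ℕ) : ℂ) * ∫ r in Ioi (0 : ℝ), (r : ℂ) ^ m * Ψ r := by
  have hg : (fun r : ℝ => (r : ℂ) ^ (m + 1)).HasTemperateGrowth :=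
    Function.HasTemperateGrowth.pow Function.Complex.hasTemperateGrowth_ofReal (m + 1)
  set h := smulLeftCLM ℂ (fun r : ℝ => (r : ℂ) ^ (m + 1)) Ψ with hh
  have hap : ∀ r, h r = (r : ℂ) ^ (m + 1) * Ψ r := fun r => smulLeftCLM_apply_apply hg Ψ r
  have hd : ∀ r, deriv h r = ((m + 1 : ℕ) : ℂ) * ((r : ℂ) ^ m * Ψ r) +
      (r : ℂ) ^ (m + 1) * deriv Ψ r := fun r => by
    have h1 : HasDerivAt (fun r : ℝ => (r : ℂ) ^ (m + 1)) (((m + 1 : ℕ) : ℂ) * (r : ℂ) ^ m) r := by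
      simpa using (HasDerivAt.ofReal_comp (hasDerivAt_id' r)).fun_pow (m + 1)
    have h2 : HasDerivAt (fun r : ℝ => (r : ℂ) ^ (m + 1) * Ψ r)
        (((m + 1 : ℕ) : ℂ) * (r : ℂ) ^ m * Ψ r + (r : ℂ) ^ (m + 1) * deriv Ψ r) r :=
      h1.mul Ψ.differentiableAt.hasDerivAt
    rw [show (h : ℝ → ℂ) = fun r : ℝ => (r : ℂ) ^ (m + 1) * Ψ r from funext hap]
    rw [← mul_assoc]
    exact h2.deriv
  have i1 := (integrable_pow_mul_schwartzMap Ψ m).integrableOn (s := Ioi 0)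
  have i2 : IntegrableOn (fun r : ℝ => (r : ℂ) ^ (m + 1) * deriv Ψ r) (Ioi 0) :=
    (integrable_pow_mul_schwartzMap (derivCLM ℂ ℂ Ψ) (m + 1)).integrableOn
  have key := integral_Ioi_deriv_schwartzMap h
  simp only [hd] at key
  rw [integral_add (i1.const_mul _) i2, integral_const_mul, hap] at key
  simp only [Complex.ofReal_zero, zero_pow (Nat.succ_ne_zero m), zero_mul, neg_zero] at key
  linear_combination key

/-- If `t ψ = φ'` then `(𝓕 ψ)' = 4π² r 𝓕 φ`. -/
theorem hasDerivAt_fourier_of_mul_eq_deriv {R' : ℝ} {ψ : ℝ → ℂ} (hφ : IsTest R φ)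
    (hψ : IsTest R' ψ) (h : ∀ t : ℝ, t * ψ t = deriv φ t) (r : ℝ) :
    HasDerivAt (𝓕 ψ) (4 * (Real.pi : ℂ) ^ 2 * (r * 𝓕 φ r)) r := by
  have hi : Integrable fun t : ℝ => t • ψ t := hψ.integrable_mul Complex.continuous_ofReal
  have hd : Integrable (deriv φ) :=
    hi.congr (.of_forall fun t => h t)
  have key := Real.hasDerivAt_fourier hψ.integrable hi r
  have e : 𝓕 (fun t : ℝ => (-2 * (Real.pi : ℂ) * Complex.I * t) • ψ t) r =
      (-2 * (Real.pi : ℂ) * Complex.I) * 𝓕 (deriv φ) r := by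
    rw [Real.fourier_eq, Real.fourier_eq, ← integral_const_mul]
    refine integral_congr_ae (.of_forall fun t => ?_)
    simp only [← h, Circle.smul_def, smul_eq_mul]
    ring
  have e2 : (-2 * (Real.pi : ℂ) * Complex.I) * 𝓕 (deriv φ) r =
      4 * (Real.pi : ℂ) ^ 2 * (r * 𝓕 φ r) := by
    rw [Real.fourier_deriv hφ.integrable hφ.differentiable hd]
    simp only [smul_eq_mul]
    linear_combination -(4 * (Real.pi : ℂ) ^ 2 * (r * 𝓕 φ r)) * Complex.I_mul_I
  rw [← e2, ← e]
  exact key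

theorem integral_Ioi_eq_intervalIntegral (hR : 0 < R) {f : ℝ → ℂ} (hf : ∀ t, R ≤ t → f t = 0) :
    ∫ t in Ioi (0 : ℝ), f t = ∫ t in (0 : ℝ)..R, f t := by
  rw [intervalIntegral.integral_of_le hR.le]
  refine (setIntegral_eq_of_subset_of_forall_sdiff_eq_zero measurableSet_Ioi Ioc_subset_Ioi_self
    fun t ht => hf t ?_)
  by_contra hlt
  exact ht.2 ⟨ht.1, (not_le.1 hlt).le⟩

/-- As `φ` is even, `𝓕 φ(r) = 2 ∫₀^∞ φ(t) cos (2πrt) dt`, and differentiation in `r` brings out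
`-2πt sin (2πrt)`. -/
theorem hasDerivAt_fourier_phaseProfile (hR : 0 < R) (hφ : IsTest R φ) (r : ℝ) :
    HasDerivAt (𝓕 φ) (-16 * (Real.pi : ℂ) ^ 2 * (r * phaseProfile R φ r)) r := by
  have hi : Integrable fun t : ℝ => t • φ t := hφ.integrable_mul Complex.continuous_ofReal
  have key := Real.hasDerivAt_fourier hφ.integrable hi r
  set h : ℝ → ℂ := fun t => Complex.exp (↑(-2 * Real.pi * t * r) * Complex.I) •
    ((-2 * (Real.pi : ℂ) * Complex.I * t) • φ t) with hh
  have hhi : Integrable h := by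
    refine (hφ.integrable_mul (g := fun t : ℝ => Complex.exp (↑(-2 * Real.pi * t * r) *
      Complex.I) * (-2 * (Real.pi : ℂ) * Complex.I * t)) (by fun_prop)).congr
      (.of_forall fun t => ?_)
    simp only [hh, smul_eq_mul, mul_assoc]
  have hsym : ∀ t, h t + h (-t) = -8 * (Real.pi : ℂ) ^ 2 * r *
      (φ t * ((t * (t * Real.sinc (t * (2 * Real.pi * r))) : ℝ) : ℂ)) := fun t => by
    set θ : ℝ := t * (2 * Real.pi * r) with hθ
    have h1 : ((Real.sin θ : ℝ) : ℂ) = θ * (Real.sinc θ : ℝ) := by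
      rw [← Complex.ofReal_mul]
      congr 1
      by_cases h0 : θ = 0
      · simp [h0]
      · rw [Real.sinc_of_ne_zero h0]
        field_simp
    have h2 : (θ : ℂ) = t * (2 * Real.pi * r) := by rw [hθ]; push_cast; rfl
    have e1 : -2 * Real.pi * t * r = -θ := by rw [hθ]; ring
    have e2 : -2 * Real.pi * -t * r = θ := by rw [hθ]; ring
    simp only [hh, e1, e2, hφ.even, Complex.exp_mul_I, smul_eq_mul, Complex.ofReal_neg,
      Complex.cos_neg, Complex.sin_neg]
    rw [← Complex.ofReal_sin, h1, h2]
    push_cast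
    linear_combination (8 * (Real.pi : ℂ) ^ 2 * r * (φ t * (t * (t * Real.sinc θ)))) *
      Complex.I_mul_I
  have hgi : Integrable fun t => 1 / 2 * (h t + h (-t)) := (hhi.add hhi.comp_neg).const_mul _
  have e : 𝓕 (fun t : ℝ => (-2 * (Real.pi : ℂ) * Complex.I * t) • φ t) r =
      -16 * (Real.pi : ℂ) ^ 2 * (r * phaseProfile R φ r) := by
    rw [Real.fourier_real_eq_integral_exp_smul]
    have e1 : ∫ t, h t = ∫ t, 1 / 2 * (h t + h (-t)) := by
      rw [integral_const_mul, integral_add hhi hhi.comp_neg, integral_neg_eq_self h]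
      ring
    refine e1.trans ?_
    rw [integral_eq_two_mul_integral_Ioi hgi (fun t => by rw [neg_neg, add_comm]),
      integral_Ioi_eq_intervalIntegral hR (fun t ht => by rw [hsym, hφ.eq_zero ht]; simp)]
    simp only [hsym]
    rw [intervalIntegral.integral_const_mul, intervalIntegral.integral_const_mul, phaseProfile]
    ring
  rw [← e]
  exact key

end Fourier

/-! ### Half-line moments of the Fourier transform -/

section Moments

open SchwartzMap

variable {R : ℝ} {φ : ℝ → ℂ}

/-- The moment `∫₀^∞ r^m 𝓕φ(r) dr`. -/
def halfMoment (m : ℕ) (φ : ℝ → ℂ) : ℂ := ∫ r in Ioi (0 : ℝ), (r : ℂ) ^ m * 𝓕 φ r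

theorem fourier_zero_eq (hφ : IsTest R φ) : 𝓕 φ 0 = 2 * ∫ t in Ioi (0 : ℝ), φ t := by
  rw [← integral_eq_two_mul_integral_Ioi hφ.integrable hφ.even,
    Real.fourier_real_eq_integral_exp_smul]
  simp

theorem fourierInv_zero (f : ℝ → ℂ) : 𝓕⁻ f 0 = ∫ r, f r := by
  rw [Real.fourierInv_eq_fourier_neg, neg_zero, Real.fourier_real_eq_integral_exp_smul]
  simp

theorem integral_fourier_eq {f : ℝ → ℂ} (hf : ContDiff ℝ (⊤ : ℕ∞) f) (hfc : HasCompactSupport f) :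
    ∫ r, 𝓕 f r = f 0 := by
  have h : 𝓕⁻ (𝓕 (hfc.toSchwartzMap hf)) = hfc.toSchwartzMap hf :=
    FourierTransform.fourierInv_fourier_eq _
  have h2 := congrArg (fun g : 𝓢(ℝ, ℂ) => g 0) h
  simp only [SchwartzMap.fourierInv_coe, SchwartzMap.fourier_coe, fourierInv_zero] at h2
  exact h2

theorem halfMoment_zero (hφ : IsTest R φ) : halfMoment 0 φ = 1 / 2 * φ 0 := by
  obtain ⟨Ψ, hΨ⟩ := hφ.exists_schwartzMap
  have hi : Integrable (𝓕 φ) := hΨ ▸ Ψ.integrable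
  rw [← integral_fourier_eq hφ.smooth hφ.hasCompactSupport,
    integral_eq_two_mul_integral_Ioi hi hφ.fourier_neg, halfMoment]
  simp

theorem powAbsD_eq (hφ : IsTest R φ) (k : ℕ) :
    powAbsD k φ = 2 * (2 * Real.pi) ^ k * halfMoment k φ := by
  obtain ⟨Ψ, hΨ⟩ := hφ.exists_schwartzMap
  have hi : Integrable fun r : ℝ => (((2 * Real.pi * |r|) ^ k : ℝ) : ℂ) * 𝓕 φ r := by
    rw [← hΨ]
    have h0 := ((integrable_pow_mul_schwartzMap Ψ k).const_mul ((2 * Real.pi : ℂ) ^ k)).norm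
    have hc := Ψ.continuous
    refine h0.mono' (Continuous.aestronglyMeasurable (by fun_prop)) (.of_forall fun r => ?_)
    simp only [norm_mul, norm_pow, Complex.norm_real, Complex.ofReal_pow, Complex.ofReal_mul,
      Complex.norm_ofNat, Complex.ofReal_ofNat, mul_pow, Real.norm_eq_abs, abs_abs, mul_assoc]
    exact le_rfl
  rw [powAbsD, fourierInv_zero, integral_eq_two_mul_integral_Ioi hi
    (fun r => by rw [abs_neg, hφ.fourier_neg]), halfMoment, mul_assoc,
    ← integral_const_mul ((2 * Real.pi : ℂ) ^ k)]
  congr 1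
  refine setIntegral_congr_fun measurableSet_Ioi fun r hr => ?_
  simp only [abs_of_pos (show (0 : ℝ) < r from hr)]
  push_cast
  ring

theorem powD_eq_powAbsD (hφ : IsTest R φ) {k : ℕ} (hk : Even k) : powD k φ = powAbsD k φ := by
  have hs : ∀ n : ℕ, ContDiff ℝ (⊤ : ℕ∞) (iteratedDeriv n φ) ∧
      HasCompactSupport (iteratedDeriv n φ) := fun n => by
    induction n with
    | zero => simpa using ⟨hφ.smooth, hφ.hasCompactSupport⟩
    | succ n ih =>
      rw [iteratedDeriv_succ]
      exact ⟨(contDiff_infty_iff_deriv.1 ih.1).2, ih.2.deriv⟩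
  have h := Real.fourier_iteratedDeriv (N := ⊤) (n := k) hφ.smooth
    (fun n _ => (hs n).1.continuous.integrable_of_hasCompactSupport (hs n).2) le_top
  rw [powD, ← integral_fourier_eq (hs k).1 (hs k).2, h, powAbsD, fourierInv_zero,
    ← integral_const_mul]
  refine integral_congr_ae (.of_forall fun r => ?_)
  simp only [smul_eq_mul]
  rw [mul_pow (2 * Real.pi) |r| k, hk.pow_abs, ← mul_assoc, ← mul_pow, ← mul_pow]
  push_cast
  congr 2
  linear_combination (-2 * Real.pi * r : ℂ) * Complex.I_mul_I

theorem halfMoment_add_two {R' : ℝ} {ψ : ℝ → ℂ} (hφ : IsTest R φ) (hψ : IsTest R' ψ)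
    (h : ∀ t : ℝ, t * ψ t = deriv φ t) (m : ℕ) :
    4 * (Real.pi : ℂ) ^ 2 * halfMoment (m + 2) φ = -((m + 1 : ℕ) : ℂ) * halfMoment m ψ := by
  obtain ⟨Ψ, hΨ⟩ := hψ.exists_schwartzMap
  have key := integral_Ioi_pow_mul_deriv Ψ m
  rw [hΨ] at key
  rw [halfMoment, halfMoment, ← key, ← integral_const_mul]
  refine integral_congr_ae (.of_forall fun r => ?_)
  simp only [(hasDerivAt_fourier_of_mul_eq_deriv hφ hψ h r).deriv]
  ring

theorem halfMoment_one {R' : ℝ} {ψ : ℝ → ℂ} (hφ : IsTest R φ) (hψ : IsTest R' ψ)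
    (h : ∀ t : ℝ, t * ψ t = deriv φ t) :
    4 * (Real.pi : ℂ) ^ 2 * halfMoment 1 φ = -2 * ∫ t in Ioi (0 : ℝ), ψ t := by
  obtain ⟨Ψ, hΨ⟩ := hψ.exists_schwartzMap
  have key := integral_Ioi_deriv_schwartzMap Ψ
  rw [hΨ, fourier_zero_eq hψ] at key
  rw [halfMoment, neg_mul, ← key, ← integral_const_mul]
  refine integral_congr_ae (.of_forall fun r => ?_)
  simp only [(hasDerivAt_fourier_of_mul_eq_deriv hφ hψ h r).deriv]
  ring

end Moments

/-! ### The distribution `ν_d` -/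

section Nu

open SchwartzMap

variable {R : ℝ} {φ : ℝ → ℂ}

/-- The constant in `ν_d(φ) = κ_d ∫₀^∞ r^{d-3} 𝓕φ(r) dr`. -/
def momentConst (d : ℕ) : ℝ :=
  2 * Real.pi ^ ((d : ℝ) / 2 - 2) / Real.Gamma ((d : ℝ) / 2 - 1)

theorem cConst_mul_eq (m : ℕ) :
    cConst (m + 3) * (2 * (2 * Real.pi) ^ m) = momentConst (m + 3) := by
  have h2 : (2 : ℝ) ^ (3 - ((m + 3 : ℕ) : ℝ)) = ((2 : ℝ) ^ m)⁻¹ := by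
    rw [← Real.rpow_natCast, ← Real.rpow_neg (by norm_num)]
    congr 1; push_cast; ring
  have hp : Real.pi ^ (((m + 3 : ℕ) : ℝ) / 2 - 2) =
      Real.pi ^ (1 - ((m + 3 : ℕ) : ℝ) / 2) * Real.pi ^ m := by
    rw [← Real.rpow_natCast, ← Real.rpow_add Real.pi_pos]
    congr 1; push_cast; ring
  rw [cConst, momentConst, h2, hp, mul_pow]
  field_simp

/-- For `d = m + 3` of either parity `ν_d` is `c_d |D|^{d-3}` at `0`, because `D^{d-3}` and
`|D|^{d-3}` coincide when `d - 3` is even. -/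
theorem nu_eq_halfMoment (hφ : IsTest R φ) (m : ℕ) :
    nu (m + 3) φ = momentConst (m + 3) * halfMoment m φ := by
  have h : nu (m + 3) φ = (cConst (m + 3) : ℂ) * powAbsD m φ := by
    rw [nu, if_neg (by omega), if_neg (by omega)]
    split_ifs with h
    · rw [Nat.add_sub_cancel, powD_eq_powAbsD hφ]
      rw [Nat.odd_iff] at h
      rw [Nat.even_iff]
      omega
    · rw [Nat.add_sub_cancel]
  rw [h, powAbsD_eq hφ, ← cConst_mul_eq]
  push_cast
  ring

theorem momentConst_add_two (m : ℕ) :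
    momentConst (m + 5) * (m + 1) = 2 * Real.pi * momentConst (m + 3) := by
  have hg : Real.Gamma (((m + 5 : ℕ) : ℝ) / 2 - 1) =
      (((m : ℝ) + 1) / 2) * Real.Gamma (((m + 3 : ℕ) : ℝ) / 2 - 1) := by
    have h0 : ((m + 3 : ℕ) : ℝ) / 2 - 1 = ((m : ℝ) + 1) / 2 := by push_cast; ring
    rw [h0, ← Real.Gamma_add_one (by positivity)]
    congr 1; push_cast; ring
  have hpos : 0 < Real.Gamma (((m + 3 : ℕ) : ℝ) / 2 - 1) :=
    Real.Gamma_pos_of_pos (by push_cast; linarith [(Nat.cast_nonneg m : (0 : ℝ) ≤ m)])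
  have hp : Real.pi ^ (((m + 5 : ℕ) : ℝ) / 2 - 2) =
      Real.pi ^ (((m + 3 : ℕ) : ℝ) / 2 - 2) * Real.pi := by
    rw [← Real.rpow_add_one Real.pi_pos.ne']
    congr 1; push_cast; ring
  rw [momentConst, momentConst, hg, hp]
  field_simp

theorem momentConst_three : momentConst 3 = 2 / Real.pi := by
  have h1 : ((3 : ℕ) : ℝ) / 2 - 1 = 1 / 2 := by norm_num
  have h2 : ((3 : ℕ) : ℝ) / 2 - 2 = -(1 / 2) := by norm_num
  rw [momentConst, h1, h2, Real.Gamma_one_half_eq, Real.rpow_neg Real.pi_pos.le,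
    ← Real.sqrt_eq_rpow]
  have h3 := Real.mul_self_sqrt Real.pi_pos.le
  have h4 : √Real.pi ≠ 0 := (Real.sqrt_pos.2 Real.pi_pos).ne'
  conv_rhs => rw [← h3]
  field_simp

theorem momentConst_four : momentConst 4 = 2 := by
  have h1 : ((4 : ℕ) : ℝ) / 2 - 1 = 1 := by norm_num
  have h2 : ((4 : ℕ) : ℝ) / 2 - 2 = 0 := by norm_num
  rw [momentConst, h1, h2, Real.Gamma_one, Real.rpow_zero]
  norm_num

/-- Passing from dimension `d` to `d + 2` amounts to applying `-(2π)⁻¹ t⁻¹ ∂_t`. -/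
theorem nu_add_two {R' : ℝ} {ψ : ℝ → ℂ} (hφ : IsTest R φ) (hψ : IsTest R' ψ)
    (h : ∀ t : ℝ, t * ψ t = deriv φ t) {d : ℕ} (hd : 2 ≤ d) :
    nu (d + 2) φ = (-2 * (Real.pi : ℂ))⁻¹ * nu d ψ := by
  have hpi : (Real.pi : ℂ) ≠ 0 := by exact_mod_cast Real.pi_ne_zero
  obtain rfl | hd := hd.eq_or_lt
  · have h1 := halfMoment_one hφ hψ h
    have e : nu (2 + 2) φ = nu (1 + 3) φ := rfl
    rw [e, nu_eq_halfMoment hφ, momentConst_four, nu, if_neg (by norm_num), if_pos rfl]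
    push_cast
    field_simp
    linear_combination 1 / 2 * h1
  · obtain ⟨m, rfl⟩ := Nat.exists_eq_add_of_le' hd
    have h1 := halfMoment_add_two hφ hψ h m
    have h2 : (momentConst (m + 5) : ℂ) * (m + 1) = 2 * Real.pi * momentConst (m + 3) := by
      exact_mod_cast momentConst_add_two m
    change nu (m + 2 + 3) φ = _ * nu (m + 3) ψ
    rw [nu_eq_halfMoment hφ, nu_eq_halfMoment hψ]
    have hm : (4 * (Real.pi : ℂ) ^ 2) * (m + 1) ≠ 0 :=
      mul_ne_zero (by simp [hpi]) (Nat.cast_add_one_ne_zero m)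
    have hinv : (-2 * (Real.pi : ℂ))⁻¹ * (4 * (Real.pi : ℂ) ^ 2) = -2 * Real.pi := by
      field_simp
      norm_num
    refine mul_left_cancel₀ hm ?_
    push_cast at h1
    linear_combination (momentConst (m + 5) * (m + 1) : ℂ) * h1 -
      (m + 1) * halfMoment m ψ * h2 - (m + 1) * momentConst (m + 3) * halfMoment m ψ * hinv

end Nu

/-! ### The quotient `t⁻¹ φ'` and the primitive of `t φ` -/

section Quotient

variable {R : ℝ} {φ : ℝ → ℂ}

theorem hasDerivAt_integral_pow_mul_comp {g : ℝ → ℂ} (hg : ContDiff ℝ (⊤ : ℕ∞) g)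
    (hgc : HasCompactSupport g) (j : ℕ) (t : ℝ) :
    HasDerivAt (fun t : ℝ => ∫ θ in (0 : ℝ)..1, (θ : ℂ) ^ j * g (θ * t))
      (∫ θ in (0 : ℝ)..1, (θ : ℂ) ^ (j + 1) * deriv g (θ * t)) t := by
  have hg' : Continuous (deriv g) := (contDiff_infty_iff_deriv.1 hg).2.continuous
  obtain ⟨B, hB⟩ := hgc.deriv.exists_bound_of_continuous hg'
  have hgd : Differentiable ℝ g := hg.differentiable (by simp)
  have hgc := hg.continuous
  have c1 : ∀ x : ℝ, Continuous fun θ : ℝ => (θ : ℂ) ^ j * g (θ * x) := fun x => by fun_prop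
  have c2 : ∀ x : ℝ, Continuous fun θ : ℝ => (θ : ℂ) ^ (j + 1) * deriv g (θ * x) :=
    fun x => by fun_prop
  refine (intervalIntegral.hasDerivAt_integral_of_dominated_loc_of_deriv_le (s := univ)
    (F' := fun x θ => (θ : ℂ) ^ (j + 1) * deriv g (θ * x)) (bound := fun _ => 1 * B)
    Filter.univ_mem (.of_forall fun x => (c1 x).aestronglyMeasurable)
    ((c1 t).intervalIntegrable _ _) (c2 t).aestronglyMeasurable
    (.of_forall fun θ hθ x _ => ?_) (continuous_const.intervalIntegrable _ _)
    (.of_forall fun θ hθ x _ => ?_)).2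
  · rw [uIoc_of_le zero_le_one] at hθ
    rw [norm_mul, norm_pow, Complex.norm_real, Real.norm_of_nonneg hθ.1.le]
    exact mul_le_mul (pow_le_one₀ hθ.1.le hθ.2) (hB _) (norm_nonneg _) zero_le_one
  · have h1 : HasDerivAt (fun x : ℝ => θ * x) θ x := by
      simpa using (hasDerivAt_id' x).const_mul θ
    have h2 := ((hgd (θ * x)).hasDerivAt.scomp x h1).const_mul ((θ : ℂ) ^ j)
    rw [Complex.real_smul, ← mul_assoc, ← pow_succ] at h2
    exact h2

theorem contDiff_integral_pow_mul_comp {g : ℝ → ℂ} (hg : ContDiff ℝ (⊤ : ℕ∞) g)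
    (hgc : HasCompactSupport g) (j : ℕ) :
    ContDiff ℝ (⊤ : ℕ∞) (fun t : ℝ => ∫ θ in (0 : ℝ)..1, (θ : ℂ) ^ j * g (θ * t)) := by
  refine contDiff_infty.2 fun n => ?_
  induction n generalizing g j with
  | zero =>
    exact contDiff_zero.2 (continuous_iff_continuousAt.2 fun t =>
      (hasDerivAt_integral_pow_mul_comp hg hgc j t).continuousAt)
  | succ n ih =>
    have hd := hasDerivAt_integral_pow_mul_comp hg hgc j
    rw [Nat.cast_succ, contDiff_succ_iff_deriv]
    refine ⟨fun t => (hd t).differentiableAt, by simp, ?_⟩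
    rw [funext fun t => (hd t).deriv]
    exact ih (contDiff_infty_iff_deriv.1 hg).2 hgc.deriv (j + 1)

/-- `t⁻¹ φ'` extends to an even test function, namely `∫₀¹ φ''(θ t) dθ`. -/
theorem IsTest.exists_mul_eq_deriv (hR : 0 < R) (hφ : IsTest R φ) :
    ∃ ψ, IsTest R ψ ∧ ∀ t : ℝ, t * ψ t = deriv φ t := by
  have h2 := (contDiff_infty_iff_deriv.1 hφ.smooth_deriv)
  have hc : HasCompactSupport (deriv (deriv φ)) := hφ.hasCompactSupport.deriv.deriv
  set ψ : ℝ → ℂ := fun t => ∫ θ in (0 : ℝ)..1, (θ : ℂ) ^ 0 * deriv (deriv φ) (θ * t) with hψ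
  have hmul : ∀ t : ℝ, t * ψ t = deriv φ t := fun t => by
    have hd : ∀ θ ∈ uIcc (0 : ℝ) 1, HasDerivAt (fun θ : ℝ => deriv φ (θ * t))
        (t * deriv (deriv φ) (θ * t)) θ := fun θ _ => by
      have h1 : HasDerivAt (fun θ : ℝ => θ * t) t θ := by
        simpa using (hasDerivAt_id' θ).mul_const t
      have h3 := (h2.1 (θ * t)).hasDerivAt.scomp θ h1
      rw [Complex.real_smul] at h3
      exact h3
    have hcont := h2.2.continuous
    have hi : IntervalIntegrable (fun θ : ℝ => (t : ℂ) * deriv (deriv φ) (θ * t)) volume 0 1 :=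
      Continuous.intervalIntegrable (by fun_prop) _ _
    have key := intervalIntegral.integral_eq_sub_of_hasDerivAt hd hi
    rw [one_mul, zero_mul, hφ.deriv_zero, sub_zero, intervalIntegral.integral_const_mul] at key
    simpa only [hψ, pow_zero, one_mul] using key
  have hsupp : tsupport ψ ⊆ Ioo (-R) R := by
    have h3 : Function.support ψ ⊆ tsupport φ ∪ {0} := fun t ht => by
      by_cases h0 : t = 0
      · exact .inr h0
      · refine .inl (tsupport_deriv_subset (𝕜 := ℝ) (subset_tsupport _ ?_))
        rw [Function.mem_support, ← hmul]
        exact mul_ne_zero (by exact_mod_cast h0) ht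
    refine (closure_minimal h3 ((isClosed_tsupport φ).union isClosed_singleton)).trans
      (union_subset hφ.supp ?_)
    rintro t rfl
    exact ⟨by linarith, hR⟩
  refine ⟨ψ, ⟨contDiff_integral_pow_mul_comp h2.2 hc 0, fun t => ?_, hsupp⟩, hmul⟩
  have he : ∀ t, deriv (deriv φ) (-t) = deriv (deriv φ) t := fun t => by
    have h1 : deriv φ = fun t => -deriv φ (-t) := funext fun t => by rw [hφ.deriv_neg, neg_neg]
    conv_rhs => rw [h1]
    rw [deriv.fun_neg, deriv_comp_neg, neg_neg]
  simp only [hψ, mul_neg, he]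

/-- The primitive of `t φ(t)` that vanishes at infinity is an even test function. The radius grows
because supports are required to lie in the open interval. -/
theorem IsTest.exists_deriv_eq_mul (hR : 0 < R) (hφ : IsTest R φ) :
    ∃ χ, IsTest (R + 1) χ ∧ (∀ t : ℝ, t * φ t = deriv χ t) ∧
      χ 0 = -∫ t in Ioi (0 : ℝ), (t : ℂ) * φ t := by
  have hg : ContDiff ℝ (⊤ : ℕ∞) fun t : ℝ => (t : ℂ) * φ t :=
    Complex.ofRealCLM.contDiff.mul hφ.smooth
  have hgc := hg.continuous
  have hgi : ∀ a b, IntervalIntegrable (fun t : ℝ => (t : ℂ) * φ t) volume a b :=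
    fun a b => hgc.intervalIntegrable a b
  set χ : ℝ → ℂ := fun t => (∫ x in (0 : ℝ)..t, (x : ℂ) * φ x) -
    ∫ x in (0 : ℝ)..R, (x : ℂ) * φ x with hχ
  have hd : ∀ t, HasDerivAt χ (t * φ t) t := fun t =>
    (intervalIntegral.integral_hasDerivAt_right (hgi 0 t)
      (hgc.stronglyMeasurableAtFilter _ _) hgc.continuousAt).sub_const _
  have he : ∀ t, χ (-t) = χ t := fun t => by
    have h := intervalIntegral.integral_comp_neg (fun x : ℝ => (x : ℂ) * φ x) (a := 0) (b := t)
    simp only [hφ.even, Complex.ofReal_neg, neg_mul, neg_zero, intervalIntegral.integral_neg] at h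
    simp only [hχ]
    rw [intervalIntegral.integral_symm, ← h, neg_neg]
  have h0 : ∀ t, R < t → χ t = 0 := fun t ht => by
    simp only [hχ]
    rw [← intervalIntegral.integral_add_adjacent_intervals (hgi 0 R) (hgi R t),
      add_sub_cancel_left]
    refine intervalIntegral.integral_zero_ae (.of_forall fun x hx => ?_)
    rw [uIoc_of_le ht.le] at hx
    rw [hφ.eq_zero hx.1.le, mul_zero]
  refine ⟨χ, ⟨?_, he, ?_⟩, fun t => (hd t).deriv.symm, ?_⟩
  · rw [contDiff_infty_iff_deriv]
    refine ⟨fun t => (hd t).differentiableAt, ?_⟩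
    rw [funext fun t => (hd t).deriv]
    exact hg
  · refine (closure_minimal (fun t ht => ?_) (isClosed_Icc (a := -R) (b := R))).trans
      (Icc_subset_Ioo (by linarith) (by linarith))
    constructor
    · by_contra hlt
      exact ht ((he t).symm.trans (h0 _ (by linarith)))
    · by_contra hlt
      exact ht (h0 t (not_le.1 hlt))
  · rw [integral_Ioi_eq_intervalIntegral hR (fun t ht => by rw [hφ.eq_zero ht, mul_zero])]
    simp [hχ]

end Quotient

/-! ### The formulas for `ν_d` in terms of `t⁻¹ ∂_t` -/

section SecondFormula

variable {R : ℝ} {φ : ℝ → ℂ}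

theorem invTD_iterate_congr {f g : ℝ → ℂ} (h : ∀ t, t ≠ 0 → f t = g t) (k : ℕ) :
    ∀ t, t ≠ 0 → invTD^[k] f t = invTD^[k] g t := by
  induction k generalizing f g with
  | zero => exact h
  | succ k ih =>
    refine ih fun t ht => ?_
    have he : f =ᶠ[nhds t] g := by
      filter_upwards [isOpen_ne.mem_nhds ht] with s hs using h s hs
    rw [invTD, invTD, he.deriv_eq]

theorem invTD_eq {ψ : ℝ → ℂ} (h : ∀ t : ℝ, t * ψ t = deriv φ t) (t : ℝ) (ht : t ≠ 0) :
    invTD φ t = ψ t := by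
  have h0 : (t : ℂ) ≠ 0 := by exact_mod_cast ht
  rw [invTD, ← h, inv_mul_cancel_left₀ h0]

/-- Induction on the dimension in steps of two, starting from `ν_3(φ) = π⁻¹ φ(0)`. -/
theorem nu_odd_eq (hR : 0 < R) (hφ : IsTest R φ) (k : ℕ) :
    nu (2 * k + 3) φ = 2 * (-2 * (Real.pi : ℂ)) ^ (-(k + 1 : ℤ)) *
      ∫ t in Ioi (0 : ℝ), deriv (invTD^[k] φ) t := by
  have hpi : (-2 * (Real.pi : ℂ)) ≠ 0 := by simp [Real.pi_ne_zero]
  have hpi' : (Real.pi : ℂ) ≠ 0 := by exact_mod_cast Real.pi_ne_zero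
  induction k generalizing φ with
  | zero =>
    have h := integral_Ioi_deriv_schwartzMap (hφ.hasCompactSupport.toSchwartzMap hφ.smooth)
    have h' : ∫ t in Ioi (0 : ℝ), deriv φ t = -φ 0 := h
    have e : nu (2 * 0 + 3) φ = nu (0 + 3) φ := rfl
    rw [e, nu_eq_halfMoment hφ, momentConst_three, halfMoment_zero hφ,
      Function.iterate_zero_apply, h']
    norm_num [zpow_neg_one]
    field_simp
  | succ k ih =>
    obtain ⟨ψ, hψ, hm⟩ := hφ.exists_mul_eq_deriv hR
    have e : nu (2 * (k + 1) + 3) φ = nu (2 * k + 3 + 2) φ := rfl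
    have hi : ∫ t in Ioi (0 : ℝ), deriv (invTD^[k + 1] φ) t =
        ∫ t in Ioi (0 : ℝ), deriv (invTD^[k] ψ) t := by
      refine setIntegral_congr_fun measurableSet_Ioi fun t ht => ?_
      have he : invTD^[k + 1] φ =ᶠ[nhds t] invTD^[k] ψ := by
        filter_upwards [isOpen_ne.mem_nhds (ne_of_gt ht)] with s hs
        exact invTD_iterate_congr (invTD_eq hm) k s hs
      exact he.deriv_eq
    rw [e, nu_add_two hφ hψ hm (by omega), ih hψ, hi]
    have hz : (-2 * (Real.pi : ℂ)) ^ (-((k + 1 : ℕ) + 1 : ℤ)) =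
        (-2 * (Real.pi : ℂ))⁻¹ * (-2 * (Real.pi : ℂ)) ^ (-(k + 1 : ℤ)) := by
      rw [← zpow_neg_one, ← zpow_add₀ hpi]
      congr 1; push_cast; ring
    rw [hz]
    ring

/-- Induction on the dimension in steps of two, starting from the definition of `ν_2`. -/
theorem nu_even_eq (hR : 0 < R) (hφ : IsTest R φ) (k : ℕ) :
    nu (2 * k + 2) φ = -4 * (-2 * (Real.pi : ℂ)) ^ (-(k + 1 : ℤ)) *
      ∫ t in Ioi (0 : ℝ), (invTD^[k] φ) t := by
  have hpi : (-2 * (Real.pi : ℂ)) ≠ 0 := by simp [Real.pi_ne_zero]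
  have hpi' : (Real.pi : ℂ) ≠ 0 := by exact_mod_cast Real.pi_ne_zero
  induction k generalizing φ with
  | zero =>
    rw [nu, if_neg (by norm_num), if_pos (by norm_num), Function.iterate_zero_apply]
    norm_num [zpow_neg_one]
    field_simp
    norm_num
  | succ k ih =>
    obtain ⟨ψ, hψ, hm⟩ := hφ.exists_mul_eq_deriv hR
    have e : nu (2 * (k + 1) + 2) φ = nu (2 * k + 2 + 2) φ := rfl
    have hi : ∫ t in Ioi (0 : ℝ), (invTD^[k + 1] φ) t = ∫ t in Ioi (0 : ℝ), (invTD^[k] ψ) t :=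
      setIntegral_congr_fun measurableSet_Ioi fun t ht =>
        invTD_iterate_congr (invTD_eq hm) k t (ne_of_gt ht)
    rw [e, nu_add_two hφ hψ hm (by omega), ih hψ, hi]
    have hz : (-2 * (Real.pi : ℂ)) ^ (-((k + 1 : ℕ) + 1 : ℤ)) =
        (-2 * (Real.pi : ℂ))⁻¹ * (-2 * (Real.pi : ℂ)) ^ (-(k + 1 : ℤ)) := by
      rw [← zpow_neg_one, ← zpow_add₀ hpi]
      congr 1; push_cast; ring
    rw [hz]
    ring

end SecondFormula

/-! ### Polar coordinates -/

section Radial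

variable {R : ℝ} {φ : ℝ → ℂ}

theorem integral_phaseSymbol_eq {d : ℕ} (hd : 1 ≤ d) (hR : 0 < R) (hφ : IsTest R φ) :
    ∫ ξ : Space d, phaseSymbol R φ ξ =
      ((d * (Real.sqrt Real.pi ^ d / Real.Gamma ((d : ℝ) / 2 + 1)) : ℝ) : ℂ) *
        ∫ r in Ioi (0 : ℝ), (r : ℂ) ^ (d - 1) * phaseProfile R φ r := by
  have : Nonempty (Fin d) := ⟨⟨0, hd⟩⟩
  have : Nontrivial (Space d) := inferInstance
  have hvol : volume.real (Metric.ball (0 : Space d) 1) =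
      Real.sqrt Real.pi ^ d / Real.Gamma ((d : ℝ) / 2 + 1) := by
    have hg : 0 < Real.Gamma ((d : ℝ) / 2 + 1) := Real.Gamma_pos_of_pos (by positivity)
    rw [Measure.real, EuclideanSpace.volume_ball, Fintype.card_fin, ENNReal.ofReal_one, one_pow,
      one_mul, ENNReal.toReal_ofReal (by positivity)]
  simp only [phaseSymbol_eq hR hφ]
  rw [integral_fun_norm_addHaar volume (phaseProfile R φ), hvol, finrank_euclideanSpace_fin,
    nsmul_eq_mul, Complex.real_smul]
  simp only [Complex.real_smul]
  push_cast
  ring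

/-- The surface area of the unit sphere of `ℝ^d`, `d = n + 3`, compared with the constant of
`ν_d`. -/
theorem ball_const_mul_eq (n : ℕ) :
    ((n + 3 : ℕ) : ℝ) * (√Real.pi ^ (n + 3) / Real.Gamma (((n + 3 : ℕ) : ℝ) / 2 + 1)) * (n + 1) =
      2 * Real.pi ^ 2 * momentConst (n + 3) := by
  set x : ℝ := ((n + 3 : ℕ) : ℝ) / 2 with hx
  have hn : (n : ℝ) = 2 * x - 3 := by rw [hx]; push_cast; ring
  have hx1 : 0 < x - 1 := by rw [hx]; push_cast; linarith [(Nat.cast_nonneg n : (0 : ℝ) ≤ n)]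
  have hg : Real.Gamma (x + 1) = x * ((x - 1) * Real.Gamma (x - 1)) := by
    rw [Real.Gamma_add_one (by linarith), ← Real.Gamma_add_one hx1.ne', sub_add_cancel]
  have hp : √Real.pi ^ (n + 3) = Real.pi ^ (x - 2) * Real.pi ^ 2 := by
    rw [Real.sqrt_eq_rpow, ← Real.rpow_natCast, ← Real.rpow_mul Real.pi_pos.le,
      ← Real.rpow_natCast Real.pi 2, ← Real.rpow_add Real.pi_pos]
    congr 1
    rw [hx]; push_cast; ring
  have hpos := Real.Gamma_pos_of_pos hx1
  have hx0 : 0 < x := by linarith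
  rw [momentConst, hg, hp, ← hx]
  push_cast
  rw [hn]
  field_simp
  ring

/-- Polar coordinates turn the right side into `∫₀^∞ r^{d-1} q(r) dr`, with `r q(r)` a multiple of
`(𝓕 φ)'(r)`. -/
theorem nu_eq_integral_phaseSymbol {d : ℕ} (hd : 1 ≤ d) (hR : 0 < R) (hφ : IsTest R φ) :
    nu d φ = 8 * ∫ ξ : Space d, phaseSymbol R φ ξ := by
  have hpi : (Real.pi : ℂ) ≠ 0 := by exact_mod_cast Real.pi_ne_zero
  rw [integral_phaseSymbol_eq hd hR hφ]
  obtain rfl | hd := hd.eq_or_lt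
  · obtain ⟨χ, hχ, hm, h0⟩ := hφ.exists_deriv_eq_mul hR
    have h1 : ∀ r : ℝ, 0 < r → phaseProfile R φ r = -(1 / 4) * 𝓕 χ r := fun r hr => by
      have e := (hasDerivAt_fourier_phaseProfile hR hφ r).unique
        (hasDerivAt_fourier_of_mul_eq_deriv hχ hφ hm r)
      have hr' : (r : ℂ) ≠ 0 := by exact_mod_cast hr.ne'
      refine mul_left_cancel₀ (mul_ne_zero (mul_ne_zero (by norm_num : (-16 : ℂ) ≠ 0)
        (pow_ne_zero 2 hpi)) hr') ?_
      linear_combination e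
    have h2 : ∫ r in Ioi (0 : ℝ), (r : ℂ) ^ (1 - 1) * phaseProfile R φ r =
        -(1 / 4) * halfMoment 0 χ := by
      rw [halfMoment, ← integral_const_mul]
      refine setIntegral_congr_fun measurableSet_Ioi fun r hr => ?_
      simp only [h1 r hr]
      ring
    have h3 : ((1 : ℕ) * (Real.sqrt Real.pi ^ 1 / Real.Gamma (((1 : ℕ) : ℝ) / 2 + 1)) : ℝ) = 2 := by
      rw [Nat.cast_one, Real.Gamma_add_one (by norm_num), Real.Gamma_one_half_eq]
      have : √Real.pi ≠ 0 := (Real.sqrt_pos.2 Real.pi_pos).ne'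
      field_simp
    rw [h3, h2, halfMoment_zero hχ, h0, nu, if_pos rfl]
    push_cast
    ring
  · obtain ⟨m, rfl⟩ := Nat.exists_eq_add_of_le' hd
    obtain ⟨Ψ, hΨ⟩ := hφ.exists_schwartzMap
    have hd : ∀ r, deriv Ψ r = -16 * (Real.pi : ℂ) ^ 2 * (r * phaseProfile R φ r) := fun r => by
      rw [hΨ]
      exact (hasDerivAt_fourier_phaseProfile hR hφ r).deriv
    have h2 : -16 * (Real.pi : ℂ) ^ 2 *
        ∫ r in Ioi (0 : ℝ), (r : ℂ) ^ (m + 1 + 1 - 1) * phaseProfile R φ r =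
        ∫ r in Ioi (0 : ℝ), (r : ℂ) ^ m * deriv Ψ r := by
      rw [← integral_const_mul]
      refine setIntegral_congr_fun measurableSet_Ioi fun r _ => ?_
      simp only [hd, Nat.add_sub_cancel, pow_succ]
      ring
    cases m with
    | zero =>
      have h3 : ((0 + 1 + 1 : ℕ) * (√Real.pi ^ (0 + 1 + 1) /
          Real.Gamma (((0 + 1 + 1 : ℕ) : ℝ) / 2 + 1)) : ℝ) = 2 * Real.pi := by
        norm_num [Real.sq_sqrt Real.pi_pos.le, Real.Gamma_two]
      simp only [pow_zero, one_mul] at h2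
      rw [integral_Ioi_deriv_schwartzMap, hΨ, fourier_zero_eq hφ] at h2
      rw [h3, nu, if_neg (by norm_num), if_pos (by norm_num)]
      push_cast
      refine mul_left_cancel₀ hpi ?_
      have e : (Real.pi : ℂ) * (2 * (Real.pi : ℂ)⁻¹ * ∫ t in Ioi (0 : ℝ), φ t) =
          2 * ∫ t in Ioi (0 : ℝ), φ t := by field_simp
      rw [e]
      linear_combination h2
    | succ n =>
      have h3 := ball_const_mul_eq n
      rw [integral_Ioi_pow_mul_deriv, hΨ] at h2
      change _ = -((n + 1 : ℕ) : ℂ) * halfMoment n φ at h2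
      change nu (n + 3) φ = 8 * (((((n + 3 : ℕ) : ℝ) * (√Real.pi ^ (n + 3) /
        Real.Gamma (((n + 3 : ℕ) : ℝ) / 2 + 1)) : ℝ) : ℂ) *
          ∫ r in Ioi (0 : ℝ), (r : ℂ) ^ (n + 2) * phaseProfile R φ r)
      generalize ((n + 3 : ℕ) : ℝ) * (√Real.pi ^ (n + 3) /
        Real.Gamma (((n + 3 : ℕ) : ℝ) / 2 + 1)) = c at h3 ⊢
      have h3' : (c : ℂ) * (n + 1) = 2 * (Real.pi : ℂ) ^ 2 * momentConst (n + 3) := by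
        exact_mod_cast h3
      rw [nu_eq_halfMoment hφ]
      refine mul_left_cancel₀ (mul_ne_zero (by norm_num : (2 : ℂ) ≠ 0) (pow_ne_zero 2 hpi)) ?_
      push_cast at h2
      linear_combination c * h2 - halfMoment n φ * h3'

end Radial

end WaveTrace

end

open MeasureTheory Set WaveTrace in
theorem mainTheorem3 (d : ℕ) (hd : 1 ≤ d)
    (V : Space d → ℂ) (hV : MemLp V ⊤ volume)
    (hVc : ∃ K : Set (Space d), IsCompact K ∧ ∀ᵐ x, x ∉ K → V x = 0)
    (φ : ℝ → ℂ) (hφ : ContDiff ℝ (⊤ : ℕ∞) φ) (hφc : HasCompactSupport φ)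
    (hφe : ∀ t, φ (-t) = φ t) :
    (∃ T : Energy d →L[ℂ] Energy d, IsPairingW1 V hV φ T ∧
      HasTrace T (1 / 2 * nu d φ * ∫ x, V x)) ∧
    (Odd d → 3 ≤ d →
      nu d φ = 2 * (-2 * (Real.pi : ℂ)) ^ ((1 - (d : ℤ)) / 2) *
        ∫ t in Ioi (0 : ℝ), deriv (invTD^[(d - 3) / 2] φ) t) ∧
    (Even d → 2 ≤ d →
      nu d φ = -4 * (-2 * (Real.pi : ℂ)) ^ (-(d : ℤ) / 2) *
        ∫ t in Ioi (0 : ℝ), (invTD^[(d - 2) / 2] φ) t) := by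
  obtain ⟨R, hR, hRφ⟩ := exists_isTest hφ hφc hφe
  refine ⟨?_, fun ho h3 => ?_, fun he h2 => ?_⟩
  · obtain ⟨T, hT⟩ := exists_isPairingW1 (V := V) (hV := hV) hR hRφ
    refine ⟨T, hT, ?_⟩
    have e : 1 / 2 * nu d φ * ∫ x, V x =
        4 * ((∫ x, V x) * ∫ ξ : Space d, phaseSymbol R φ ξ) := by
      rw [nu_eq_integral_phaseSymbol hd hR hRφ]
      ring
    rw [e]
    exact hasTrace_pairingW1 hR hRφ hVc hT
  · obtain ⟨k, rfl⟩ : ∃ k, d = 2 * k + 3 := ⟨(d - 3) / 2, by rw [Nat.odd_iff] at ho; omega⟩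
    have e1 : (1 - ((2 * k + 3 : ℕ) : ℤ)) / 2 = -(k + 1) := by push_cast; omega
    have e2 : (2 * k + 3 - 3) / 2 = k := by omega
    rw [e1, e2]
    exact nu_odd_eq hR hRφ k
  · obtain ⟨k, rfl⟩ : ∃ k, d = 2 * k + 2 := ⟨(d - 2) / 2, by rw [Nat.even_iff] at he; omega⟩
    have e1 : -((2 * k + 2 : ℕ) : ℤ) / 2 = -(k + 1) := by push_cast; omega
    have e2 : (2 * k + 2 - 2) / 2 = k := by omega
    rw [e1, e2]
    exact nu_even_eq hR hRφ k
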